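/- Let $H^1$ be the Heisenberg group: $\mathbb R^3$ with the product $$(t_1,q_1,p_1)(t_2,q_2,p_2)=\bigl(t_1+t_2+\tfrac{p_1q_2-q_1p_2}{2},\,q_1+q_2,\,p_1+p_2\bigr)$$ and its usual topology. Then its centre is $Z=\{(t,0,0)\}$ and $d\mu=\frac{1}{2\pi}dt\,dq\,dp$ is left and right invariant. Put $X=H^1/Z=\mathbb R^2$, $d\alpha=\frac1{2\pi}dq\,dp$, $s(q,p)=(0,q,p)$. For continuous compactly supported $f$ on $H^1$ one has $\int f\,d\mu=\int_X\int_{\mathbb R}f(s(x)(t,0,0))\,dt\,d\alpha(x)$. Let $\pi$ be the Schrödinger representation of $H^1$ on $L^2(\mathbb R)$, $$(\pi(t,q,p)\varphi)(x)=e^{i(t+qx+qp/2)}\varphi(x+p).$$ Let $\tilde l$ be the representation induced by the character $\chi(t,0,0)=e^{it}$ of $Z$, realized on $L^2(\mathbb R^2,\alpha)$ by $(\tilde l(g)f)(x)=\chi(s(x)^{-1}g\,s(g^{-1}.x))f(g^{-1}.x)$; it is strongly continuous and explicitly $(\tilde l(t,q,p)f)(x,y)=e^{i(t+(xp-yq)/2)}f(x-q,y-p)$.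 (1) Number states. Let $\mathcal H$ be a complex Hilbert space with orthonormal basis $(e_n)_{n\ge0}$, let $a,a^*$ be the ladder operators of this basis on their natural domain ($ae_n=\sqrt n\,e_{n-1}$, $a^*e_n=\sqrt{n+1}\,e_{n+1}$), and let $Q=\frac1{\sqrt2}(a+a^*)$, $P=\frac1{\sqrt2\,i}(a-a^*)$. Then there is a unitary representation $(t,q,p)\mapsto e^{i(t+qQ+pP)}$ of $H^1$ on $\mathcal H$, and it is unitarily equivalent to $\pi$. Now let $\rho$ be any unitary representation of $H^1$ on a complex Hilbert space $\mathcal H$ that is unitarily equivalent to $\pi$ (for instance $\pi$ itself, or the representation in (1)). For $u,v\in\mathcal H$ put $c_{u,v}(g)=\langle\rho(g)u,v\rangle$ (inner products are linear in the second variable). (2) $\rho$ is strongly continuous and irreducible, and $\rho(t,0,0)=e^{it}I$. It is square integrable modulo the centre, i.e. $c_{u,v}\circ s\in L^2(\mathbb R^2,\alpha)$ for all $u,v$, with formal degree $1$, i.e. $\int_X\overline{c_{u,v}(s(x))}\,c_{u',v'}(s(x))\,d\alpha(x)=\langle u',u\rangle\langle v,v'\rangle$ for all $u,v,u',v'$.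 (3) $(\tilde l,L^2(\mathbb R^2,\alpha))$ is isotypic, namely a Hilbert direct sum of copies of $\rho$, and $L^2(\mathbb R^2,\alpha)=\tilde M(\rho)$, the closed linear span of the functions $c_{u,v}\circ s$, $u,v\in\mathcal H$. (4) For each $u\in\mathcal H$, $\widetilde W_uv=c_{u,v}\circ s$ defines a bounded operator $\widetilde W_u:\mathcal H\to L^2(\mathbb R^2,\alpha)$. For each state $T$ (positive operator of trace one) the weak integrals $Q_T(E)=\int_E\rho(s(x))T\rho(s(x))^{-1}d\alpha(x)$, $E\subseteq\mathbb R^2$ Borel, exist and form a normalized positive operator measure. If $u$ is a unit vector and $Q_u=Q_{|u\rangle\langle u|}$, then $\widetilde W_u$ is an isometry which, together with the projection measure $\widetilde P(E)f=1_Ef$ on $L^2(\mathbb R^2,\alpha)$, is a minimal Neumark dilation of $Q_u$: $\widetilde W_u^*\widetilde P(E)\widetilde W_u=Q_u(E)$ for all Borel $E$, and the vectors $\widetilde P(E)\widetilde W_uv$ span a dense subspace. (5) For every orthonormal basis $(e_n)_{n\ge0}$ of $\mathcal H$ (in particular for the number states in (1)) the Neumark projections $P_{e_n}=\widetilde W_{e_n}\widetilde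 W_{e_n}^*$ of the phase space observables $Q_{e_n}$ form a resolution of the identity in $L^2(\mathbb R^2,\alpha)$: they are mutually orthogonal orthogonal projections, and $\sum_nP_{e_n}=I$ strongly. (6) If $T$ is a state with $\operatorname{tr}[T\rho(g)]\neq0$ for $\mu$-almost every $g\in H^1$, then $Q_T$ is informationally complete: if $W_1,W_2$ are states with $\operatorname{tr}[W_1Q_T(E)]=\operatorname{tr}[W_2Q_T(E)]$ for all Borel $E$, then $W_1=W_2$. -/

import Mathlib

open MeasureTheory
open scoped ENNReal InnerProductSpace ComplexConjugate

universe u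

noncomputable section

/-! ## Unitary representations -/

section Representations

/-- Build a unitary representation from a multiplicative family of linear isometries. -/
def repOfIsometries {G E : Type*} [Group G] [NormedAddCommGroup E] [InnerProductSpace ℂ E]
    (op : G → E →ₗᵢ[ℂ] E) (h1 : ∀ f, op 1 f = f) (hmul : ∀ a b f, op (a * b) f = op a (op b f)) :
    G →* (E ≃ₗᵢ[ℂ] E) where
  toFun g :=
    { toLinearEquiv := LinearEquiv.ofLinearMap (op g).toLinearMap (op g⁻¹).toLinearMap
        (by ext f; simp [← hmul, h1]) (by ext f; simp [← hmul, h1])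
      norm_map' := fun f => (op g).norm_map f }
  map_one' := by ext f; exact h1 f
  map_mul' a b := by ext f; exact hmul a b f

variable {G : Type*} [Group G]
  {H : Type*} [NormedAddCommGroup H] [InnerProductSpace ℂ H]
  {K : Type*} [NormedAddCommGroup K] [InnerProductSpace ℂ K]

/-- Strong continuity of a unitary representation. -/
def IsStronglyContinuous [TopologicalSpace G] (ρ : G →* (H ≃ₗᵢ[ℂ] H)) : Prop :=
  ∀ v : H, Continuous fun g => ρ g v

/-- A unitary representation on a nonzero Hilbert space is irreducible if the only closed
invariant subspaces are the trivial ones. -/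
def IsIrreducibleRep (ρ : G →* (H ≃ₗᵢ[ℂ] H)) : Prop :=
  Nontrivial H ∧ ∀ V : Submodule ℂ H, IsClosed (V : Set H) → (∀ g, ∀ v ∈ V, ρ g v ∈ V) →
    V = ⊥ ∨ V = ⊤

/-- Unitary equivalence of two representations. -/
def UnitarilyEquivalent (ρ : G →* (H ≃ₗᵢ[ℂ] H)) (σ : G →* (K ≃ₗᵢ[ℂ] K)) : Prop :=
  ∃ V : H ≃ₗᵢ[ℂ] K, ∀ g v, V (ρ g v) = σ g (V v)

/-- The representation `l` on `K` is a Hilbert direct sum of copies of the representation `ρ`: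
there are isometric intertwiners `S i` from `ρ` to `l` whose ranges are mutually orthogonal
and span a dense subspace of `K`. -/
def IsIsotypicRepOfType (l : G →* (K ≃ₗᵢ[ℂ] K)) (ρ : G →* (H ≃ₗᵢ[ℂ] H)) : Prop :=
  ∃ (ι : Type) (S : ι → H →ₗᵢ[ℂ] K),
    (∀ i g v, S i (ρ g v) = l g (S i v)) ∧
    (∀ i j, i ≠ j → ∀ v w, ⟪S i v, S j w⟫_ℂ = 0) ∧
    (⨆ i, LinearMap.range (S i).toLinearMap).topologicalClosure = ⊤

end Representations

/-! ## Trace and states -/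

section Trace

variable {H : Type u} [NormedAddCommGroup H] [InnerProductSpace ℂ H] [CompleteSpace H]

/-- The trace `∑ ⟨bᵢ, A bᵢ⟩` computed in a fixed orthonormal basis; for trace class `A`
it does not depend on the basis. -/
def opTrace (A : H →L[ℂ] H) : ℂ :=
  ∑' i : (exists_hilbertBasis ℂ H).choose,
    ⟪(exists_hilbertBasis ℂ H).choose_spec.choose i,
      A ((exists_hilbertBasis ℂ H).choose_spec.choose i)⟫_ℂ

/-- A state: a positive operator of trace one. -/
def IsState (T : H →L[ℂ] H) : Prop :=
  T.IsPositive ∧ ∀ (ι : Type u) (b : HilbertBasis ι ℂ H), HasSum (fun i => ⟪b i, T (b i)⟫_ℂ) 1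

end Trace

/-! ## The Heisenberg group -/

/-- The Heisenberg group `H¹`, with elements `(t, q, p)`. -/
@[ext] structure Heis where
  t : ℝ
  q : ℝ
  p : ℝ

namespace Heis

/-- `(t₁,q₁,p₁)(t₂,q₂,p₂) = (t₁ + t₂ + (p₁ q₂ - q₁ p₂)/2, q₁ + q₂, p₁ + p₂)`. -/
instance : Mul Heis :=
  ⟨fun a b => ⟨a.t + b.t + (a.p * b.q - a.q * b.p) / 2, a.q + b.q, a.p + b.p⟩⟩

instance : One Heis := ⟨⟨0, 0, 0⟩⟩

instance : Inv Heis := ⟨fun a => ⟨-a.t, -a.q, -a.p⟩⟩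

@[simp] lemma mul_t (a b : Heis) : (a * b).t = a.t + b.t + (a.p * b.q - a.q * b.p) / 2 := rfl
@[simp] lemma mul_q (a b : Heis) : (a * b).q = a.q + b.q := rfl
@[simp] lemma mul_p (a b : Heis) : (a * b).p = a.p + b.p := rfl
@[simp] lemma one_t : (1 : Heis).t = 0 := rfl
@[simp] lemma one_q : (1 : Heis).q = 0 := rfl
@[simp] lemma one_p : (1 : Heis).p = 0 := rfl
@[simp] lemma inv_t (a : Heis) : (a⁻¹).t = -a.t := rfl
@[simp] lemma inv_q (a : Heis) : (a⁻¹).q = -a.q := rfl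
@[simp] lemma inv_p (a : Heis) : (a⁻¹).p = -a.p := rfl

instance : Group Heis :=
  Group.ofLeftAxioms
    (fun a b c => by ext <;> simp <;> ring)
    (fun a => by ext <;> simp)
    (fun a => by ext <;> simp; ring)

/-- The identification of `H¹` with `ℝ³` as a set. -/
def equivProd : Heis ≃ ℝ × ℝ × ℝ where
  toFun g := (g.t, g.q, g.p)
  invFun x := ⟨x.1, x.2.1, x.2.2⟩

/-- The topology of `ℝ³`. -/
instance : TopologicalSpace Heis := TopologicalSpace.induced equivProd inferInstance

/-- The Borel structure of `ℝ³`. -/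
instance : MeasurableSpace Heis := MeasurableSpace.comap equivProd inferInstance

/-- The Haar measure `dt dq dp / 2π` on `H¹`. -/
def haar : Measure Heis :=
  ENNReal.ofReal (1 / (2 * Real.pi)) • (volume : Measure (ℝ × ℝ × ℝ)).map equivProd.symm

/-- The measure `α = dq dp / 2π` on the phase space `X = ℝ²`. -/
def phaseMeasure : Measure (ℝ × ℝ) :=
  ENNReal.ofReal (1 / (2 * Real.pi)) • (volume : Measure (ℝ × ℝ))

/-- The projection `H¹ → X = H¹ / Z`, `(t, q, p) ↦ (q, p)`. -/
def proj (g : Heis) : ℝ × ℝ := (g.q, g.p)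

/-- The section `s(q, p) = (0, q, p)`. -/
def sec (x : ℝ × ℝ) : Heis := ⟨0, x.1, x.2⟩

/-- The action of `H¹` on `X` by left translation of cosets. -/
def act (a : Heis) (x : ℝ × ℝ) : ℝ × ℝ := proj (a * sec x)

/-- The central character `(t, 0, 0) ↦ e^{it}`, used only on central elements. -/
def centralChar (z : Heis) : ℂ := Complex.exp (Complex.I * z.t)

end Heis

/-! ## Translations with a phase on `L²` -/

section PhaseTranslation

variable {X : Type*} [MeasurableSpace X] {ν : Measure X}

lemma memLp_phase_comp {m : X → ℂ} (hm : Measurable m) (hm1 : ∀ x, ‖m x‖ = 1) {τ : X → X}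
    (hτ : MeasurePreserving τ ν ν) (f : Lp ℂ 2 ν) : MemLp (fun x => m x * f (τ x)) 2 ν := by
  have h := (Lp.memLp f).comp_measurePreserving hτ
  refine h.of_le (hm.aestronglyMeasurable.mul h.aestronglyMeasurable) ?_
  filter_upwards with x
  simp [hm1]

/-- The isometry `(A f)(x) = m(x) f(τ x)` of `L²`, for a phase `m` and a measure preserving
map `τ`. -/
def phaseComp (m : X → ℂ) (hm : Measurable m) (hm1 : ∀ x, ‖m x‖ = 1) (τ : X → X)
    (hτ : MeasurePreserving τ ν ν) : Lp ℂ 2 ν →ₗᵢ[ℂ] Lp ℂ 2 ν where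
  toFun f := (memLp_phase_comp hm hm1 hτ f).toLp
  map_add' f g := by
    apply Lp.ext
    filter_upwards [(memLp_phase_comp hm hm1 hτ (f + g)).coeFn_toLp,
      (memLp_phase_comp hm hm1 hτ f).coeFn_toLp, (memLp_phase_comp hm hm1 hτ g).coeFn_toLp,
      Lp.coeFn_add (memLp_phase_comp hm hm1 hτ f).toLp (memLp_phase_comp hm hm1 hτ g).toLp,
      hτ.quasiMeasurePreserving.ae (Lp.coeFn_add f g)] with x h1 h2 h3 h4 h5
    rw [h1, h4, Pi.add_apply, h2, h3, h5, Pi.add_apply, mul_add]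
  map_smul' c f := by
    apply Lp.ext
    filter_upwards [(memLp_phase_comp hm hm1 hτ (c • f)).coeFn_toLp,
      (memLp_phase_comp hm hm1 hτ f).coeFn_toLp,
      Lp.coeFn_smul c (memLp_phase_comp hm hm1 hτ f).toLp,
      hτ.quasiMeasurePreserving.ae (Lp.coeFn_smul c f)] with x h1 h2 h3 h4
    rw [h1, RingHom.id_apply, h3, Pi.smul_apply, h2, h4, Pi.smul_apply, smul_eq_mul, smul_eq_mul]
    ring
  norm_map' f := by
    have h : ‖(memLp_phase_comp hm hm1 hτ f).toLp‖ = ‖Lp.compMeasurePreserving τ hτ f‖ := by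
      rw [Lp.norm_def, Lp.norm_def]
      congr 1
      refine eLpNorm_congr_norm_ae ?_
      filter_upwards [(memLp_phase_comp hm hm1 hτ f).coeFn_toLp,
        Lp.coeFn_compMeasurePreserving f hτ] with x h1 h2
      rw [h1, h2, norm_mul, hm1, one_mul, Function.comp_apply]
    exact h.trans (Lp.norm_compMeasurePreserving f hτ)

lemma phaseComp_coeFn (m : X → ℂ) (hm : Measurable m) (hm1 : ∀ x, ‖m x‖ = 1) (τ : X → X)
    (hτ : MeasurePreserving τ ν ν) (f : Lp ℂ 2 ν) :
    ⇑(phaseComp m hm hm1 τ hτ f) =ᵐ[ν] fun x => m x * f (τ x) :=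
  (memLp_phase_comp hm hm1 hτ f).coeFn_toLp

/-- Multiplication by the indicator function of `E` on `L²` (and `0` if `E` is not measurable). -/
def indicatorProj (ν : Measure X) (E : Set X) : Lp ℂ 2 ν →L[ℂ] Lp ℂ 2 ν :=
  open Classical in
  if hE : MeasurableSet E then
    LinearMap.mkContinuous
      { toFun := fun f => ((Lp.memLp f).indicator hE).toLp
        map_add' := fun f g => by
          apply Lp.ext
          filter_upwards [((Lp.memLp (f + g)).indicator hE).coeFn_toLp,
            ((Lp.memLp f).indicator hE).coeFn_toLp, ((Lp.memLp g).indicator hE).coeFn_toLp,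
            Lp.coeFn_add ((Lp.memLp f).indicator hE).toLp ((Lp.memLp g).indicator hE).toLp,
            Lp.coeFn_add f g] with x h1 h2 h3 h4 h5
          rw [h1, h4, Pi.add_apply, h2, h3]
          by_cases hx : x ∈ E
          · rw [Set.indicator_of_mem hx, Set.indicator_of_mem hx, Set.indicator_of_mem hx, h5,
              Pi.add_apply]
          · simp [hx]
        map_smul' := fun c f => by
          apply Lp.ext
          filter_upwards [((Lp.memLp (c • f)).indicator hE).coeFn_toLp,
            ((Lp.memLp f).indicator hE).coeFn_toLp,
            Lp.coeFn_smul c ((Lp.memLp f).indicator hE).toLp,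
            Lp.coeFn_smul c f] with x h1 h2 h3 h4
          rw [h1, RingHom.id_apply, h3, Pi.smul_apply, h2]
          by_cases hx : x ∈ E
          · rw [Set.indicator_of_mem hx, Set.indicator_of_mem hx, h4, Pi.smul_apply]
          · simp [hx] }
      1 (fun f => by
        rw [one_mul]
        refine Lp.norm_le_norm_of_ae_le ?_
        filter_upwards [((Lp.memLp f).indicator hE).coeFn_toLp] with x h1
        change ‖(((Lp.memLp f).indicator hE).toLp : X → ℂ) x‖ ≤ _
        rw [h1]
        exact norm_indicator_le_norm_self _ _)
  else 0

end PhaseTranslation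

/-! ## The Schrödinger representation and the induced representation -/

namespace Heis

/-- The Schrödinger representation on `L²(ℝ)`:
`(π(t,q,p) φ)(x) = e^{i(t + q x + q p / 2)} φ(x + p)`. -/
def schrodinger :
    Heis →* (Lp ℂ 2 (volume : Measure ℝ) ≃ₗᵢ[ℂ] Lp ℂ 2 (volume : Measure ℝ)) :=
  repOfIsometries
    (fun g => phaseComp
      (fun x : ℝ => Complex.exp (Complex.I * ((g.t + g.q * x + g.q * g.p / 2 : ℝ) : ℂ)))
      (by fun_prop)
      (fun x => by rw [mul_comm]; exact Complex.norm_exp_ofReal_mul_I _)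
      (fun x => x + g.p) (measurePreserving_add_right volume g.p))
    (fun f => by
      apply Lp.ext
      refine (phaseComp_coeFn _ _ _ _ _ f).trans ?_
      filter_upwards with x
      simp)
    (fun a b f => by
      apply Lp.ext
      refine (phaseComp_coeFn _ _ _ _ _ f).trans
        (Filter.EventuallyEq.trans ?_ (phaseComp_coeFn _ _ _ _ _ _).symm)
      have hτ := (measurePreserving_add_right (volume : Measure ℝ) a.p).quasiMeasurePreserving
      filter_upwards [hτ.ae (phaseComp_coeFn
        (fun x : ℝ => Complex.exp (Complex.I * ((b.t + b.q * x + b.q * b.p / 2 : ℝ) : ℂ)))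
        (by fun_prop) (fun x => by rw [mul_comm]; exact Complex.norm_exp_ofReal_mul_I _)
        (fun x => x + b.p) (measurePreserving_add_right volume b.p) f)] with x hx
      rw [hx, ← mul_assoc, ← Complex.exp_add, mul_p, ← add_assoc]
      congr 2
      simp only [mul_t, mul_q]
      push_cast
      ring)

lemma act_eq (a : Heis) (x : ℝ × ℝ) : act a x = (a.q, a.p) + x := rfl

lemma measurePreserving_act (a : Heis) : MeasurePreserving (act a) phaseMeasure phaseMeasure := by
  have h := measurePreserving_add_left (volume : Measure (ℝ × ℝ)) (a.q, a.p)
  exact h.smul_measure _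

/-- The cocycle `χ(s(x)⁻¹ a s(a⁻¹ · x))`. -/
def cocycle (a : Heis) (x : ℝ × ℝ) : ℂ := centralChar ((sec x)⁻¹ * a * sec (act a⁻¹ x))

lemma cocycle_eq (a : Heis) (x : ℝ × ℝ) :
    cocycle a x = Complex.exp (Complex.I * ((a.t + (x.1 * a.p - x.2 * a.q) / 2 : ℝ) : ℂ)) := by
  simp only [cocycle, centralChar, sec, act, proj, mul_t, mul_q, mul_p, inv_q, inv_p, inv_t]
  congr 3
  ring

/-- The representation of `H¹` induced by the character `χ` of its centre, realized on
`L²(X, α)`: `(l̃(a) f)(x) = χ(s(x)⁻¹ a s(a⁻¹ · x)) f(a⁻¹ · x)`. -/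
def inducedRep : Heis →* (Lp ℂ 2 phaseMeasure ≃ₗᵢ[ℂ] Lp ℂ 2 phaseMeasure) :=
  repOfIsometries
    (fun a => phaseComp (cocycle a)
      (by simp only [funext (cocycle_eq a)]; fun_prop)
      (fun x => by rw [cocycle_eq, mul_comm]; exact Complex.norm_exp_ofReal_mul_I _)
      (act a⁻¹) (measurePreserving_act a⁻¹))
    (fun f => by
      apply Lp.ext
      refine (phaseComp_coeFn _ _ _ _ _ f).trans ?_
      filter_upwards with x
      rw [cocycle_eq, act_eq]
      simp [← Prod.zero_eq_mk])
    (fun a b f => by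
      apply Lp.ext
      refine (phaseComp_coeFn _ _ _ _ _ f).trans
        (Filter.EventuallyEq.trans ?_ (phaseComp_coeFn _ _ _ _ _ _).symm)
      have hτ := (measurePreserving_act a⁻¹).quasiMeasurePreserving
      filter_upwards [hτ.ae (phaseComp_coeFn (cocycle b)
        (by simp only [funext (cocycle_eq b)]; fun_prop)
        (fun x => by rw [cocycle_eq, mul_comm]; exact Complex.norm_exp_ofReal_mul_I _)
        (act b⁻¹) (measurePreserving_act b⁻¹) f)] with x hx
      have hact : act (a * b)⁻¹ x = act b⁻¹ (act a⁻¹ x) := by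
        simp only [act_eq, inv_q, inv_p, mul_q, mul_p]
        ext <;> simp <;> ring
      rw [hx, ← mul_assoc, hact, cocycle_eq, cocycle_eq, cocycle_eq, ← Complex.exp_add]
      congr 2
      simp only [act_eq, mul_t, mul_q, mul_p, inv_q, inv_p, Prod.fst_add, Prod.snd_add]
      push_cast
      ring)

/-! ## Coefficients, square integrability, the subspace `M̃(π)` -/

section Coefficients

variable {H : Type u} [NormedAddCommGroup H] [InnerProductSpace ℂ H]

/-- The coefficient `c_{u,v}(g) = ⟨ρ(g) u, v⟩`. -/
def coeff (ρ : Heis →* (H ≃ₗᵢ[ℂ] H)) (u v : H) (g : Heis) : ℂ := ⟪ρ g u, v⟫_ℂ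

/-- Square integrability modulo the centre: `c_{u,v} ∘ s ∈ L²(X, α)` for all `u`, `v`. -/
def SquareIntegrableModCentre (ρ : Heis →* (H ≃ₗᵢ[ℂ] H)) : Prop :=
  ∀ u v : H, MemLp (coeff ρ u v ∘ sec) 2 phaseMeasure

/-- `d > 0` is the formal degree: the orthogonality relations
`⟨c_{u,v}, c_{u',v'}⟩ = d⁻¹ ⟨u', u⟩ ⟨v, v'⟩` hold in `L²(X, α)`. -/
def HasFormalDegree (ρ : Heis →* (H ≃ₗᵢ[ℂ] H)) (d : ℝ) : Prop :=
  0 < d ∧ ∀ u v u' v' : H,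
    ∫ x, conj (coeff ρ u v (sec x)) * coeff ρ u' v' (sec x) ∂phaseMeasure =
      ((1 / d : ℝ) : ℂ) * ⟪u', u⟫_ℂ * ⟪v, v'⟫_ℂ

/-- `M̃(ρ)`: the closed subspace of `L²(X, α)` generated by the coefficients `c_{u,v} ∘ s`. -/
def coeffSpace (ρ : Heis →* (H ≃ₗᵢ[ℂ] H)) : Submodule ℂ (Lp ℂ 2 phaseMeasure) :=
  (Submodule.span ℂ
    {f : Lp ℂ 2 phaseMeasure | ∃ u v : H, ⇑f =ᵐ[phaseMeasure] coeff ρ u v ∘ sec}).topologicalClosure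

/-- `B` is the operator `v ↦ c_{u,v} ∘ s` from `H` to `L²(X, α)`. -/
def IsCoeffOperator (ρ : Heis →* (H ≃ₗᵢ[ℂ] H)) (u : H)
    (B : H →L[ℂ] Lp ℂ 2 phaseMeasure) : Prop :=
  ∀ v, ⇑(B v) =ᵐ[phaseMeasure] coeff ρ u v ∘ sec

/-- The operator `W̃_u v = c_{u,v} ∘ s` (the unique operator with this property, and `0` if
there is none). -/
def coeffOperator (ρ : Heis →* (H ≃ₗᵢ[ℂ] H)) (u : H) : H →L[ℂ] Lp ℂ 2 phaseMeasure :=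
  open Classical in
  if h : ∃ B, IsCoeffOperator ρ u B then h.choose else 0

variable [CompleteSpace H]

/-- The Neumark projection `P_u = W̃_u W̃_u*`. -/
def neumarkProjection (ρ : Heis →* (H ≃ₗᵢ[ℂ] H)) (u : H) :
    Lp ℂ 2 phaseMeasure →L[ℂ] Lp ℂ 2 phaseMeasure :=
  coeffOperator ρ u ∘L ContinuousLinearMap.adjoint (coeffOperator ρ u)

/-! ## Phase space observables -/

/-- `B = ∫_E ρ(s(x)) T ρ(s(x))⁻¹ dα(x)` in the weak sense. -/
def IsWeakOrbitIntegral (ρ : Heis →* (H ≃ₗᵢ[ℂ] H)) (T : H →L[ℂ] H) (E : Set (ℝ × ℝ))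
    (B : H →L[ℂ] H) : Prop :=
  ∀ v w : H,
    IntegrableOn (fun x => ⟪v, ρ (sec x) (T ((ρ (sec x))⁻¹ w))⟫_ℂ) E phaseMeasure ∧
    ⟪v, B w⟫_ℂ = ∫ x in E, ⟪v, ρ (sec x) (T ((ρ (sec x))⁻¹ w))⟫_ℂ ∂phaseMeasure

/-- The phase space observable `Q_T(E) = ∫_E ρ(s(x)) T ρ(s(x))⁻¹ dα(x)` (the unique operator
given by this weak integral, and `0` if there is none). -/
def phaseObservable (ρ : Heis →* (H ≃ₗᵢ[ℂ] H)) (T : H →L[ℂ] H) (E : Set (ℝ × ℝ)) : H →L[ℂ] H :=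
  open Classical in
  if h : ∃ B, IsWeakOrbitIntegral ρ T E B then h.choose else 0

/-- The operator `ρ(g)` as a bounded operator. -/
def repOp (ρ : Heis →* (H ≃ₗᵢ[ℂ] H)) (g : Heis) : H →L[ℂ] H :=
  (ρ g).toContinuousLinearEquiv

end Coefficients

end Heis

/-! ## Operator measures -/

section OperatorMeasures

variable {X : Type*} [MeasurableSpace X]
  {H : Type u} [NormedAddCommGroup H] [InnerProductSpace ℂ H] [CompleteSpace H]
  {K : Type*} [NormedAddCommGroup K] [InnerProductSpace ℂ K] [CompleteSpace K]

/-- A normalized positive operator measure. -/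
structure IsPOM (Q : Set X → H →L[ℂ] H) : Prop where
  positive : ∀ E, MeasurableSet E → (Q E).IsPositive
  univ : Q Set.univ = 1
  iUnion : ∀ E : ℕ → Set X, (∀ n, MeasurableSet (E n)) → Pairwise (Function.onFun Disjoint E) →
    ∀ v w : H, HasSum (fun n => ⟪v, Q (E n) w⟫_ℂ) ⟪v, Q (⋃ n, E n) w⟫_ℂ

/-- The projection measure `P` and the isometry `W` form a minimal Neumark dilation of `Q`. -/
structure IsMinimalNeumarkDilation (Q : Set X → H →L[ℂ] H) (P : Set X → K →L[ℂ] K)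
    (W : H →L[ℂ] K) : Prop where
  pom : IsPOM P
  projection : ∀ E, MeasurableSet E → IsStarProjection (P E)
  isometry : ∀ v, ‖W v‖ = ‖v‖
  dilation : ∀ E, MeasurableSet E → ContinuousLinearMap.adjoint W ∘L P E ∘L W = Q E
  minimal : (Submodule.span ℂ
    {f | ∃ E, MeasurableSet E ∧ ∃ v, f = P E (W v)}).topologicalClosure = ⊤

/-- The operator measure `Q` separates the states. -/
def IsInformationallyComplete (Q : Set X → H →L[ℂ] H) : Prop :=
  ∀ W₁ W₂ : H →L[ℂ] H, IsState W₁ → IsState W₂ →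
    (∀ E, MeasurableSet E → opTrace (W₁ ∘L Q E) = opTrace (W₂ ∘L Q E)) → W₁ = W₂

/-- A family of operators is a resolution of the identity: mutually orthogonal orthogonal
projections which sum up strongly to the identity. -/
def IsResolutionOfIdentity {ι : Type*} (P : ι → K →L[ℂ] K) : Prop :=
  (∀ i, IsStarProjection (P i)) ∧ (∀ i j, i ≠ j → P i ∘L P j = 0) ∧
    ∀ f, HasSum (fun i => P i f) f

end OperatorMeasures

/-! ## Number states and the canonical operators -/

section NumberStates

variable {H : Type*} [NormedAddCommGroup H] [InnerProductSpace ℂ H]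

/-- The natural domain of the ladder operators of the orthonormal basis `e` (the number states,
`e 0` being the ground state). -/
def ladderDomain (e : HilbertBasis ℕ ℂ H) : Set H :=
  {v | Summable fun n : ℕ => (n : ℝ) * ‖⟪e n, v⟫_ℂ‖ ^ 2}

/-- The lowering operator, `a e_{n+1} = √(n+1) e_n`, `a e_0 = 0`, on `ladderDomain e`. -/
def lowering (e : HilbertBasis ℕ ℂ H) (v : H) : H :=
  ∑' n : ℕ, (((√((n : ℝ) + 1) : ℝ) : ℂ) * ⟪e (n + 1), v⟫_ℂ) • e n

/-- The raising operator, `a* e_n = √(n+1) e_{n+1}`, on `ladderDomain e`. -/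
def raising (e : HilbertBasis ℕ ℂ H) (v : H) : H :=
  ∑' n : ℕ, (((√((n : ℝ) + 1) : ℝ) : ℂ) * ⟪e n, v⟫_ℂ) • e (n + 1)

/-- `Q = (a + a*) / √2`. -/
def positionOp (e : HilbertBasis ℕ ℂ H) (v : H) : H :=
  (1 / ((√2 : ℝ) : ℂ)) • (lowering e v + raising e v)

/-- `P = (a - a*) / (√2 i)`. -/
def momentumOp (e : HilbertBasis ℕ ℂ H) (v : H) : H :=
  (1 / (((√2 : ℝ) : ℂ) * Complex.I)) • (lowering e v - raising e v)

/-- `B = e^{iA}` for an operator `A` that is essentially self-adjoint on the domain `D`: `B` is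
the value at `1` of the (then unique) strongly continuous one-parameter unitary group whose
generator extends `iA`. -/
def IsExpI (D : Set H) (A : H → H) (B : H ≃ₗᵢ[ℂ] H) : Prop :=
  ∃ U : ℝ → H ≃ₗᵢ[ℂ] H, (∀ r s, U (r + s) = U r * U s) ∧ (∀ v, Continuous fun r => U r v) ∧
    (∀ v ∈ D, HasDerivAt (fun r => U r v) (Complex.I • A v) 0) ∧ U 1 = B

/-- `ρ(t,q,p) = e^{i(t + qQ + pP)}` for the canonical operators `Q`, `P` of the basis `e`. -/
def IsNumberRep (e : HilbertBasis ℕ ℂ H) (ρ : Heis →* (H ≃ₗᵢ[ℂ] H)) : Prop :=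
  ∀ g : Heis, IsExpI (ladderDomain e)
    (fun v => (g.t : ℂ) • v + (g.q : ℂ) • positionOp e v + (g.p : ℂ) • momentumOp e v) (ρ g)

end NumberStates

end

/-! Everything rests on one identity: `‖c_{u,v} ∘ s‖ = ‖u‖ ‖v‖` in `L²(X, α)` for the Schrödinger
representation. For fixed `p` the coefficient is, up to a phase, the Fourier integral in `q` of
`conj (u (x + p)) * v x`; Plancherel in `q` followed by Tonelli in `p` gives the identity, and the
factor `1 / 2π` in `α` makes the constant one (`lintegral_coeff_schrodinger`). Together with strong
continuity and the central character it passes to every equivalent representation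
(`IsSchrodingerType`), and the rest uses only these three properties and a countable orthonormal
basis.

Polarization in both variables turns the identity into the orthogonality relations
(`inner_eq_of_norm_eq`). Irreducibility follows too: if `v` is orthogonal to the orbit of `u ≠ 0`,
then `c_{u,v} = 0`, so `v = 0`.

The second ingredient is that replacing `(u, v)` by `(ρ(s(a))u, ρ(s(a))v)` multiplies `c_{u,v} ∘ s`
by a character of `ℝ²` (`coeff_apply_apply`). If `f` is orthogonal to all coefficients, the Fourier
transform of `conj c_{u,v} · f` therefore vanishes, and the product is zero almost everywhere. For
fixed `u ≠ 0` the coefficients have no common zero, so `f = 0`. Hence the functions `c_{e_n,e_m} ∘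
s` form an orthonormal basis of `L²(X, α)`, which gives the isotypic decomposition and the
resolution of the identity. The absence of common zeros also gives minimality of the Neumark
dilation.

For informational completeness, `tr[W Q_T(·)]` has a density whose Fourier transform is `conj tr[T
ρ(s(a))] · tr[W ρ(s(a))]`. Where the first factor does not vanish it can be cancelled, and the
orthogonality relations recover `W` from `tr[W ρ(s(x))]`.

For the number states, the basis is matched with the Hermite functions. These are complete because
the coefficients of the Gaussian against `f` are integrals of `f` against `e^{zx} e^{-x²/2}`, so the
norm identity applies again. Differentiation along rays of the group identifies the generators on
Hermite functions, and closedness of the generator extends this to the ladder domain. -/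

noncomputable section

/-! ## Fourier analysis -/

section FourierAnalysis

open scoped FourierTransform SchwartzMap

/-- The `L²`-Fourier transform agrees with the Fourier integral on `L¹ ∩ L²`. -/
theorem MeasureTheory.MemLp.fourier_toLp_ae_eq {f : ℝ → ℂ} (h1 : Integrable f) (h2 : MemLp f 2) :
    ((𝓕 (h2.toLp f) : Lp ℂ 2 (volume : Measure ℝ)) : ℝ → ℂ) =ᵐ[volume] 𝓕 f := by
  have hcont : Continuous (𝓕 f) :=
    VectorFourier.fourierIntegral_continuous Real.continuous_fourierChar
      (by fun_prop : Continuous fun p : ℝ × ℝ => (innerₗ ℝ) p.1 p.2) h1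
  -- It suffices to pair both sides with test functions. The `L²` transform is the one of tempered
  -- distributions, so it moves onto the test function; `e3` moves the Fourier integral there as
  -- well.
  refine ae_eq_of_integral_contDiff_smul_eq
    ((Lp.memLp _).locallyIntegrable (by norm_num)) hcont.locallyIntegrable ?_
  intro g hg hgc
  have hg₁ : HasCompactSupport (Complex.ofRealCLM ∘ g) := hgc.comp_left rfl
  have hg₂ : ContDiff ℝ (⊤ : ℕ∞) (Complex.ofRealCLM ∘ g) := by fun_prop
  set G : 𝓢(ℝ, ℂ) := hg₁.toSchwartzMap hg₂ with hG
  have hGg : ∀ x, G x = (g x : ℂ) := fun x => rfl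
  have key := congrArg (fun T => T G) (Lp.fourier_toTemperedDistribution_eq (h2.toLp f))
  simp only [TemperedDistribution.fourier_apply, Lp.toTemperedDistribution_apply] at key
  have e1 : ∫ x, g x • ((𝓕 (h2.toLp f) : Lp ℂ 2 (volume : Measure ℝ)) : ℝ → ℂ) x =
      ∫ x, G x • ((𝓕 (h2.toLp f) : Lp ℂ 2 (volume : Measure ℝ)) : ℝ → ℂ) x := by
    simp [hGg]
  rw [e1, ← key]
  have e2 : ∫ x, (𝓕 G) x • (h2.toLp f : ℝ → ℂ) x = ∫ x, (𝓕 (G : ℝ → ℂ)) x • f x := by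
    refine integral_congr_ae ?_
    filter_upwards [h2.coeFn_toLp] with x hx
    rw [hx, SchwartzMap.fourier_coe]
  have e3 := VectorFourier.integral_fourierIntegral_smul_eq_flip (μ := volume) (ν := volume)
    (f := (G : ℝ → ℂ)) (g := f) (L := innerₗ ℝ) Real.continuous_fourierChar
    (by fun_prop) G.integrable h1
  rw [e2]
  refine Eq.trans ?_ (e3.trans ?_)
  · rfl
  · refine integral_congr_ae (.of_forall fun x => ?_)
    simp only [hGg, flip_innerₗ]
    rw [Complex.real_smul, smul_eq_mul]
    rfl

/-- Plancherel's theorem for the Fourier integral on `L¹ ∩ L²`. -/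
theorem lintegral_enorm_sq_fourier {f : ℝ → ℂ} (h1 : Integrable f) (h2 : MemLp f 2) :
    ∫⁻ x, ‖𝓕 f x‖ₑ ^ 2 = ∫⁻ x, ‖f x‖ₑ ^ 2 := by
  have h : eLpNorm (𝓕 f) 2 volume = eLpNorm f 2 volume := by
    rw [← eLpNorm_congr_ae (h2.fourier_toLp_ae_eq h1), ← eLpNorm_congr_ae h2.coeFn_toLp,
      ← Lp.enorm_def, ← Lp.enorm_def, ← ofReal_norm, ← ofReal_norm, Lp.norm_fourier_eq]
  have hsq : ∀ g : ℝ → ℂ, eLpNorm g 2 volume ^ (2 : ℝ) = ∫⁻ x, ‖g x‖ₑ ^ 2 := fun g => by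
    have := eLpNorm_nnreal_pow_eq_lintegral (f := g) (μ := (volume : Measure ℝ)) (p := 2)
      two_ne_zero
    simpa using this
  rw [← hsq, ← hsq, h]

/-- Plancherel's theorem for the kernel `e^{-iqx}`. -/
theorem lintegral_enorm_sq_integral_exp {f : ℝ → ℂ} (h1 : Integrable f) (h2 : MemLp f 2) :
    ∫⁻ q : ℝ, ‖∫ x, Complex.exp (-(Complex.I * (q * x : ℝ))) * f x‖ₑ ^ 2 =
      ENNReal.ofReal (2 * Real.pi) * ∫⁻ x, ‖f x‖ₑ ^ 2 := by
  rw [← lintegral_enorm_sq_fourier h1 h2]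
  have hpi : (2 * Real.pi) ≠ 0 := by positivity
  have e : ∀ w : ℝ, 𝓕 f w = ∫ x, Complex.exp (-(Complex.I * ((2 * Real.pi * w) * x : ℝ))) * f x := by
    intro w
    rw [Real.fourier_real_eq_integral_exp_smul]
    refine integral_congr_ae (.of_forall fun x => ?_)
    simp only [smul_eq_mul]
    congr 2
    push_cast
    ring
  simp_rw [e]
  set F : ℝ → ℝ≥0∞ := fun q => ‖∫ x, Complex.exp (-(Complex.I * (q * x : ℝ))) * f x‖ₑ ^ 2 with hF
  -- The factor `2π` is the Jacobian of `q = 2πw`, since `𝓕` has kernel `e^{-2πiwx}`.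
  change ∫⁻ q, F q = _ * ∫⁻ w, F (2 * Real.pi * w)
  have hmap := Real.map_volume_mul_left hpi
  have hemb : MeasurableEmbedding fun w : ℝ => 2 * Real.pi * w :=
    (Homeomorph.mulLeft₀ _ hpi).measurableEmbedding
  rw [← hemb.lintegral_map, hmap, lintegral_smul_measure, smul_eq_mul, ← mul_assoc,
    ← ENNReal.ofReal_mul (by positivity), abs_of_pos (by positivity), mul_inv_cancel₀ hpi,
    ENNReal.ofReal_one, one_mul]

variable {V : Type*} [NormedAddCommGroup V] [NormedSpace ℝ V] [CompleteSpace V]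
  [SecondCountableTopology V] [MeasurableSpace V] [BorelSpace V]

/-- A real integrable function is determined by its Fourier transform. -/
theorem ae_eq_zero_of_integral_exp_eq_zero_real {μ : Measure V} [SigmaFinite μ] {g : V → ℝ}
    (hg : Integrable g μ)
    (h : ∀ L : StrongDual ℝ V, ∫ x, (g x : ℂ) * Complex.exp (L x * Complex.I) ∂μ = 0) :
    g =ᵐ[μ] 0 := by
  have hfin : ∀ {k : V → ℝ}, Integrable k μ →
      IsFiniteMeasure (μ.withDensity fun x => ENNReal.ofReal (k x)) := fun {k} hk =>
    isFiniteMeasure_withDensity_ofReal hk.2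
  have := hfin hg
  have := hfin hg.neg
  have hchar : ∀ {k : V → ℝ}, Integrable k μ → ∀ L : StrongDual ℝ V,
      charFunDual (μ.withDensity fun x => ENNReal.ofReal (k x)) L =
        ∫ x, ((max (k x) 0 : ℝ) : ℂ) * Complex.exp (L x * Complex.I) ∂μ := by
    intro k hk L
    rw [charFunDual_apply, integral_withDensity_eq_integral_toReal_smul₀
      hk.aestronglyMeasurable.aemeasurable.ennreal_ofReal (by simp)]
    refine integral_congr_ae (.of_forall fun x => ?_)
    simp only [ENNReal.toReal_ofReal', Complex.real_smul]
  have hint : ∀ {k : V → ℝ}, Integrable k μ → ∀ L : StrongDual ℝ V,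
      Integrable (fun x => ((max (k x) 0 : ℝ) : ℂ) * Complex.exp (L x * Complex.I)) μ := by
    intro k hk L
    refine (hk.pos_part.ofReal (𝕜 := ℂ)).mul_bdd (c := 1)
      (by fun_prop : Continuous fun x => Complex.exp (L x * Complex.I)).aestronglyMeasurable
      (.of_forall fun x => ?_)
    rw [Complex.norm_exp_ofReal_mul_I]
  -- The positive and negative parts of `g` are densities of finite measures, and the hypothesis
  -- says that their characteristic functions agree.
  have heq : (μ.withDensity fun x => ENNReal.ofReal (g x)) =
      μ.withDensity fun x => ENNReal.ofReal ((-g) x) := by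
    refine Measure.ext_of_charFunDual (funext fun L => ?_)
    rw [hchar hg, hchar hg.neg, ← sub_eq_zero, ← integral_sub (hint hg L) (hint hg.neg L), ← h L]
    refine integral_congr_ae (.of_forall fun x => ?_)
    simp only [Pi.neg_apply, ← sub_mul, ← Complex.ofReal_sub]
    congr 2
    rcases le_total (g x) 0 with h0 | h0
    · rw [max_eq_right h0, max_eq_left (by linarith)]; ring
    · rw [max_eq_left h0, max_eq_right (by linarith)]; ring
  rw [withDensity_eq_iff hg.aestronglyMeasurable.aemeasurable.ennreal_ofReal
    hg.neg.aestronglyMeasurable.aemeasurable.ennreal_ofReal] at heq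
  · filter_upwards [heq] with x hx
    simp only [Pi.neg_apply] at hx
    rcases lt_trichotomy (g x) 0 with h0 | h0 | h0
    · rw [ENNReal.ofReal_of_nonpos h0.le, eq_comm, ENNReal.ofReal_eq_zero] at hx
      exact absurd hx (by linarith)
    · exact h0
    · rw [ENNReal.ofReal_of_nonpos (by linarith : -g x ≤ 0), ENNReal.ofReal_eq_zero] at hx
      exact absurd hx (by linarith)
  · have := hg.2
    exact (hasFiniteIntegral_iff_norm g |>.1 this |> lt_of_le_of_lt
      (lintegral_mono fun x => ENNReal.ofReal_le_ofReal (le_abs_self _))).ne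

/-- An integrable function is determined by its Fourier transform. -/
theorem ae_eq_zero_of_integral_exp_eq_zero {μ : Measure V} [SigmaFinite μ] {g : V → ℂ}
    (hg : Integrable g μ)
    (h : ∀ L : StrongDual ℝ V, ∫ x, g x * Complex.exp (L x * Complex.I) ∂μ = 0) :
    g =ᵐ[μ] 0 := by
  have hexp : ∀ {k : V → ℂ}, Integrable k μ → ∀ L : StrongDual ℝ V,
      Integrable (fun x => k x * Complex.exp (L x * Complex.I)) μ := by
    intro k hk L
    refine hk.mul_bdd (c := 1)
      (by fun_prop : Continuous fun x => Complex.exp (L x * Complex.I)).aestronglyMeasurable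
      (.of_forall fun x => ?_)
    rw [Complex.norm_exp_ofReal_mul_I]
  have hgc : Integrable (fun x => conj (g x)) μ :=
    hg.congr' (Complex.continuous_conj.comp_aestronglyMeasurable hg.1) (.of_forall fun x => by simp)
  -- Conjugating the hypothesis at `-L` shows that `conj g` satisfies it too, which separates real
  -- and imaginary parts.
  have hconj : ∀ L : StrongDual ℝ V, ∫ x, conj (g x) * Complex.exp (L x * Complex.I) ∂μ = 0 := by
    intro L
    have h0 := congrArg conj (h (-L))
    rw [← integral_conj, map_zero] at h0
    rw [← h0]
    refine integral_congr_ae (.of_forall fun x => ?_)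
    simp only [map_mul, ← Complex.exp_conj, Complex.conj_ofReal, Complex.conj_I]
    congr 2
    simp
  have hre : (fun x => (g x).re) =ᵐ[μ] 0 := by
    refine ae_eq_zero_of_integral_exp_eq_zero_real hg.re fun L => ?_
    have := integral_add (hexp hg L) (hexp hgc L)
    rw [h, hconj, add_zero] at this
    have h2 : ∫ x, 2 * (((g x).re : ℂ) * Complex.exp (L x * Complex.I)) ∂μ = 0 := by
      rw [← this]
      refine integral_congr_ae (.of_forall fun x => ?_)
      simp only [← add_mul, Complex.add_conj]
      push_cast; ring
    rw [integral_const_mul] at h2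
    simpa using h2
  have him : (fun x => (g x).im) =ᵐ[μ] 0 := by
    refine ae_eq_zero_of_integral_exp_eq_zero_real hg.im fun L => ?_
    have := integral_sub (hexp hg L) (hexp hgc L)
    rw [h, hconj, sub_zero] at this
    have h2 : ∫ x, (2 * Complex.I) * (((g x).im : ℂ) * Complex.exp (L x * Complex.I)) ∂μ = 0 := by
      rw [← this]
      refine integral_congr_ae (.of_forall fun x => ?_)
      simp only [← sub_mul, Complex.sub_conj]
      push_cast; ring
    rw [integral_const_mul] at h2
    simpa using h2
  filter_upwards [hre, him] with x h1 h2
  exact Complex.ext h1 h2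

end FourierAnalysis

/-! ### Polarization in two variables -/

section Polarization

variable {E F K : Type*} [NormedAddCommGroup E] [InnerProductSpace ℂ E]
  [NormedAddCommGroup F] [InnerProductSpace ℂ F] [NormedAddCommGroup K] [InnerProductSpace ℂ K]

/-- A sesquilinear map with `‖W u v‖ = ‖u‖ ‖v‖` satisfies the orthogonality relations. -/
theorem inner_eq_of_norm_eq (W : E →ₗ⋆[ℂ] F →ₗ[ℂ] K) (hW : ∀ u v, ‖W u v‖ = ‖u‖ * ‖v‖)
    (u u' : E) (v v' : F) : ⟪W u v, W u' v'⟫_ℂ = ⟪u', u⟫_ℂ * ⟪v, v'⟫_ℂ := by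
  have diag : ∀ u v v', ⟪W u v, W u v'⟫_ℂ = ⟪u, u⟫_ℂ * ⟪v, v'⟫_ℂ := by
    intro u v v'
    rw [inner_eq_sum_norm_sq_div_four, inner_eq_sum_norm_sq_div_four v v',
      inner_self_eq_norm_sq_to_K]
    simp only [← map_smul, ← map_add, ← map_sub, hW]
    push_cast
    ring
  -- The case `u = u'` is ordinary polarization in `v`. These two instances give the sum and the
  -- difference of the two cross terms.
  have h1 := diag (u + u') v v'
  have h2 := diag (u + Complex.I • u') v v'
  simp only [map_add, map_smulₛₗ, LinearMap.add_apply, LinearMap.smul_apply, inner_add_left,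
    inner_add_right, inner_smul_left, inner_smul_right, diag, Complex.conj_I, map_neg,
    neg_neg] at h1 h2
  linear_combination (h1 + Complex.I * h2) / 2 - ((⟪W u' v, W u v'⟫_ℂ - ⟪u, u'⟫_ℂ * ⟪v, v'⟫_ℂ) -
    (⟪W u v, W u' v'⟫_ℂ - ⟪u', u⟫_ℂ * ⟪v, v'⟫_ℂ)) / 2 * Complex.I_sq

end Polarization

/-! ## The Heisenberg group -/

namespace Heis

theorem mem_center_iff (z : Heis) : z ∈ Subgroup.center Heis ↔ z.q = 0 ∧ z.p = 0 := by
  rw [Subgroup.mem_center_iff]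
  constructor
  · intro h
    have h1 := congrArg Heis.t (h ⟨0, 0, 1⟩)
    have h2 := congrArg Heis.t (h ⟨0, 1, 0⟩)
    simp only [mul_t] at h1 h2
    constructor <;> linarith
  · rintro ⟨hq, hp⟩ g
    ext <;> simp [hq, hp, add_comm]

/-- `H¹` is homeomorphic to `ℝ³`. -/
def homeo : Heis ≃ₜ ℝ × ℝ × ℝ := equivProd.toHomeomorphOfIsInducing ⟨rfl⟩

/-- `H¹` is isomorphic to `ℝ³` as a measurable space. -/
def measEquiv : Heis ≃ᵐ ℝ × ℝ × ℝ where
  toEquiv := equivProd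
  measurable_toFun := comap_measurable _
  measurable_invFun := by
    rintro s ⟨t, ht, rfl⟩
    have : equivProd.symm ⁻¹' (equivProd ⁻¹' t) = t := by
      rw [← Set.preimage_comp]; simp
    change MeasurableSet (equivProd.symm ⁻¹' (equivProd ⁻¹' t))
    rwa [this]

theorem continuous_t : Continuous Heis.t := continuous_fst.comp homeo.continuous
theorem continuous_q : Continuous Heis.q := (continuous_fst.comp continuous_snd).comp homeo.continuous
theorem continuous_p : Continuous Heis.p := (continuous_snd.comp continuous_snd).comp homeo.continuous

theorem continuous_mk {Z : Type*} [TopologicalSpace Z] {a b c : Z → ℝ} (ha : Continuous a)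
    (hb : Continuous b) (hc : Continuous c) : Continuous fun z => (⟨a z, b z, c z⟩ : Heis) :=
  homeo.symm.continuous.comp (ha.prodMk (hb.prodMk hc))

theorem continuous_sec : Continuous sec :=
  continuous_mk continuous_const continuous_fst continuous_snd

instance : FirstCountableTopology Heis := homeo.isInducing.firstCountableTopology

theorem haar_eq : haar =
    ENNReal.ofReal (1 / (2 * Real.pi)) • (volume : Measure (ℝ × ℝ × ℝ)).map measEquiv.symm := rfl

/-- Affine shears of `ℝ³` preserve the volume. -/
theorem measurePreserving_shear (a b : ℝ) (c : ℝ × ℝ → ℝ) (hc : Measurable c) :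
    MeasurePreserving (fun x : ℝ × ℝ × ℝ => (x.1 + c x.2, x.2.1 + a, x.2.2 + b)) := by
  have h1 : MeasurePreserving (fun y : (ℝ × ℝ) × ℝ => (y.1 + (a, b), y.2 + c y.1)) := by
    refine (measurePreserving_add_right volume (a, b)).skew_product
      (g := fun y t => t + c y) (by fun_prop) (.of_forall fun y => ?_)
    exact (measurePreserving_add_right volume (c y)).map_eq
  have h2 : MeasurePreserving (Prod.swap : ℝ × ℝ × ℝ → (ℝ × ℝ) × ℝ) :=
    Measure.measurePreserving_swap
  have h3 : MeasurePreserving (Prod.swap : (ℝ × ℝ) × ℝ → ℝ × ℝ × ℝ) :=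
    Measure.measurePreserving_swap
  exact h3.comp (h1.comp h2)

theorem map_haar_of_conj {F : Heis → Heis} {F' : ℝ × ℝ × ℝ → ℝ × ℝ × ℝ}
    (hF' : MeasurePreserving F') (h : ∀ x, F (measEquiv.symm x) = measEquiv.symm (F' x)) :
    haar.map F = haar := by
  have hF : F = measEquiv.symm ∘ F' ∘ measEquiv := by
    funext g
    have := h (measEquiv g)
    simpa using this
  have hmF : Measurable F := by
    rw [hF]
    exact measEquiv.symm.measurable.comp (hF'.measurable.comp measEquiv.measurable)
  rw [haar_eq, Measure.map_smul, Measure.map_map hmF measEquiv.symm.measurable]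
  have : F ∘ measEquiv.symm = measEquiv.symm ∘ F' := funext h
  rw [this, ← Measure.map_map measEquiv.symm.measurable hF'.measurable, hF'.map_eq]

theorem map_mul_left_haar (a : Heis) : haar.map (fun g => a * g) = haar := by
  refine map_haar_of_conj (measurePreserving_shear a.q a.p
    (fun y => a.t + (a.p * y.1 - a.q * y.2) / 2) (by fun_prop)) fun x => ?_
  apply Heis.ext
  · change a.t + x.1 + (a.p * x.2.1 - a.q * x.2.2) / 2 = x.1 + (a.t + (a.p * x.2.1 - a.q * x.2.2) / 2)
    ring
  · exact add_comm _ _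
  · exact add_comm _ _

theorem map_mul_right_haar (a : Heis) : haar.map (fun g => g * a) = haar := by
  refine map_haar_of_conj (measurePreserving_shear a.q a.p
    (fun y => a.t + (y.2 * a.q - y.1 * a.p) / 2) (by fun_prop)) fun x => ?_
  apply Heis.ext
  · change x.1 + a.t + (x.2.2 * a.q - x.2.1 * a.p) / 2 = x.1 + (a.t + (x.2.2 * a.q - x.2.1 * a.p) / 2)
    ring
  · rfl
  · rfl

theorem sec_mul_central (x : ℝ × ℝ) (t : ℝ) : sec x * ⟨t, 0, 0⟩ = ⟨t, x.1, x.2⟩ := by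
  ext <;> simp [sec]

theorem integral_haar (f : Heis → ℂ) (hf : Continuous f) (hfc : HasCompactSupport f) :
    ∫ g, f g ∂haar = ∫ x, (∫ t : ℝ, f (sec x * ⟨t, 0, 0⟩)) ∂phaseMeasure := by
  have hint : Integrable (fun x : ℝ × ℝ × ℝ => f (measEquiv.symm x)) :=
    (hf.comp homeo.symm.continuous).integrable_of_hasCompactSupport
      (hfc.comp_homeomorph homeo.symm)
  rw [haar_eq, phaseMeasure, integral_smul_measure, integral_smul_measure,
    integral_map_equiv, Measure.volume_eq_prod ℝ (ℝ × ℝ), integral_prod_symm _ hint]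
  simp only [sec_mul_central]
  rfl

theorem ofReal_one_div_two_pi_ne_zero : ENNReal.ofReal (1 / (2 * Real.pi)) ≠ 0 := by
  rw [Ne, ENNReal.ofReal_eq_zero, not_le]; positivity

/-- The section itself is a null set, so Fubini only provides some central coordinate `t`; the
central character later moves the conclusion from `t` to `0`. -/
theorem ae_sec_of_ae_haar {P : Heis → Prop} (h : ∀ᵐ g ∂haar, P g) :
    ∃ t : ℝ, ∀ᵐ x ∂phaseMeasure, P ⟨t, x.1, x.2⟩ := by
  rw [haar_eq, Measure.ae_ennreal_smul_measure_iff ofReal_one_div_two_pi_ne_zero] at h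
  have h2 := ae_of_ae_map measEquiv.symm.measurable.aemeasurable h
  rw [Measure.volume_eq_prod] at h2
  obtain ⟨t, ht⟩ := (Measure.ae_ae_of_ae_prod h2).exists
  exact ⟨t, (Measure.ae_ennreal_smul_measure_iff ofReal_one_div_two_pi_ne_zero).2 ht⟩

instance : phaseMeasure.IsAddHaarMeasure :=
  Measure.IsAddHaarMeasure.smul _ ofReal_one_div_two_pi_ne_zero ENNReal.ofReal_ne_top

instance : Measure.InnerRegularCompactLTTop phaseMeasure :=
  Measure.InnerRegularCompactLTTop.smul _

end Heis

/-! ## Translations with a phase -/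

theorem MeasureTheory.Lp.norm_sq_eq_integral {X : Type*} [MeasurableSpace X] {ν : Measure X}
    (f : Lp ℂ 2 ν) : ‖f‖ ^ 2 = ∫ x, ‖f x‖ ^ 2 ∂ν := by
  have h := L2.inner_def (𝕜 := ℂ) f f
  rw [inner_self_eq_norm_sq_to_K] at h
  simp_rw [inner_self_eq_norm_sq_to_K] at h
  apply Complex.ofReal_injective
  push_cast
  rw [← integral_complex_ofReal]
  simpa using h

theorem MeasureTheory.Lp.integrable_norm_sq {X : Type*} [MeasurableSpace X] {ν : Measure X}
    (f : Lp ℂ 2 ν) : Integrable (fun x => ‖f x‖ ^ 2) ν :=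
  (Lp.memLp f).integrable_norm_pow two_ne_zero

section PhaseContinuity

open Topology Filter

variable {X : Type*} [MeasurableSpace X] {ν : Measure X}

/-- Separates the multiplication from the composition, so that continuity can be treated one factor
at a time. -/
theorem phaseComp_eq (m : X → ℂ) (hm : Measurable m) (hm1 : ∀ x, ‖m x‖ = 1) (τ : X → X)
    (hτ : MeasurePreserving τ ν ν) (f : Lp ℂ 2 ν) :
    phaseComp m hm hm1 τ hτ f =
      phaseComp m hm hm1 id (MeasurePreserving.id ν) (Lp.compMeasurePreserving τ hτ f) := by
  apply Lp.ext
  filter_upwards [phaseComp_coeFn m hm hm1 τ hτ f, phaseComp_coeFn m hm hm1 id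
    (MeasurePreserving.id ν) (Lp.compMeasurePreserving τ hτ f),
    Lp.coeFn_compMeasurePreserving f hτ] with x h1 h2 h3
  rw [h1, h2, id, h3, Function.comp_apply]

/-- Dominated convergence: since `‖m z x - m₀ x‖ ≤ 2`, the squared difference is at most `4 ‖g x‖ ^
2`. -/
theorem tendsto_phaseComp_id {Z : Type*} {l : Filter Z} [l.IsCountablyGenerated]
    (m : Z → X → ℂ) (hm : ∀ z, Measurable (m z)) (hm1 : ∀ z x, ‖m z x‖ = 1)
    (m₀ : X → ℂ) (hm₀ : Measurable m₀) (hm₀1 : ∀ x, ‖m₀ x‖ = 1)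
    (h : ∀ x, Tendsto (fun z => m z x) l (𝓝 (m₀ x))) (g : Lp ℂ 2 ν) :
    Tendsto (fun z => phaseComp (m z) (hm z) (hm1 z) id (MeasurePreserving.id ν) g) l
      (𝓝 (phaseComp m₀ hm₀ hm₀1 id (MeasurePreserving.id ν) g)) := by
  rw [tendsto_iff_norm_sub_tendsto_zero]
  have hsq : ∀ z, ‖phaseComp (m z) (hm z) (hm1 z) id (MeasurePreserving.id ν) g -
      phaseComp m₀ hm₀ hm₀1 id (MeasurePreserving.id ν) g‖ =
      √(∫ x, ‖(m z x - m₀ x) * g x‖ ^ 2 ∂ν) := by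
    intro z
    rw [← Real.sqrt_sq (norm_nonneg _), Lp.norm_sq_eq_integral]
    congr 1
    refine integral_congr_ae ?_
    filter_upwards [phaseComp_coeFn (m z) (hm z) (hm1 z) id (MeasurePreserving.id ν) g,
      phaseComp_coeFn m₀ hm₀ hm₀1 id (MeasurePreserving.id ν) g,
      Lp.coeFn_sub (phaseComp (m z) (hm z) (hm1 z) id (MeasurePreserving.id ν) g)
        (phaseComp m₀ hm₀ hm₀1 id (MeasurePreserving.id ν) g)] with x h1 h2 h3
    rw [h3, Pi.sub_apply, h1, h2, id, sub_mul]
  simp_rw [hsq]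
  rw [← Real.sqrt_zero]
  refine (Real.continuous_sqrt.tendsto 0).comp ?_
  have h0 : (0 : ℝ) = ∫ _ : X, (0 : ℝ) ∂ν := by simp
  rw [h0]
  refine tendsto_integral_filter_of_dominated_convergence (fun x => 4 * ‖g x‖ ^ 2) ?_ ?_ ?_ ?_
  · exact .of_forall fun z => ((((hm z).sub hm₀).aestronglyMeasurable.mul
      (Lp.aestronglyMeasurable g)).norm.pow 2)
  · refine .of_forall fun z => .of_forall fun x => ?_
    rw [Real.norm_of_nonneg (by positivity), norm_mul, mul_pow]
    have : ‖m z x - m₀ x‖ ≤ 2 := (norm_sub_le _ _).trans (by rw [hm1, hm₀1]; norm_num)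
    gcongr
    nlinarith [norm_nonneg (m z x - m₀ x)]
  · exact (Lp.integrable_norm_sq g).const_mul 4
  · refine .of_forall fun x => ?_
    have h1 := ((((h x).sub_const (m₀ x)).mul_const (g x)).norm).pow 2
    simpa using h1

variable [TopologicalSpace X] [R1Space X] [BorelSpace X] [ν.InnerRegularCompactLTTop]
  [IsLocallyFiniteMeasure ν]

/-- With `M_z` the multiplication and `T_z` the composition, `M_z T_z f = M_z (T_z f - T_{z₀} f) +
M_z T_{z₀} f`. The first summand tends to zero because `M_z` is isometric and `T_z f` is continuous
in `z`; the second is covered by `tendsto_phaseComp_id`. -/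
theorem continuous_phaseComp {Z : Type*} [TopologicalSpace Z] [FirstCountableTopology Z]
    (m : Z → X → ℂ) (hm : ∀ z, Measurable (m z)) (hm1 : ∀ z x, ‖m z x‖ = 1)
    (τ : Z → X → X) (hτ : ∀ z, MeasurePreserving (τ z) ν ν)
    (hmc : ∀ x, Continuous fun z => m z x) (hτc : Continuous (Function.uncurry τ)) (f : Lp ℂ 2 ν) :
    Continuous fun z => phaseComp (m z) (hm z) (hm1 z) (τ z) (hτ z) f := by
  rw [continuous_iff_continuousAt]
  intro z₀
  have hT : Continuous fun z => Lp.compMeasurePreserving (τ z) (hτ z) f := by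
    have := Continuous.compMeasurePreservingLp (μ := ν) (ν := ν) (f := fun _ : Z => f)
      (g := fun z => (⟨τ z, by fun_prop⟩ : C(X, X))) continuous_const
      (ContinuousMap.continuous_of_continuous_uncurry _ hτc) hτ (by norm_num)
    exact this
  have h1 := tendsto_phaseComp_id (l := 𝓝 z₀) m hm hm1 (m z₀) (hm z₀) (hm1 z₀)
    (fun x => (hmc x).tendsto z₀) (Lp.compMeasurePreserving (τ z₀) (hτ z₀) f)
  have h2 : Tendsto (fun z => phaseComp (m z) (hm z) (hm1 z) id (MeasurePreserving.id ν)
      (Lp.compMeasurePreserving (τ z) (hτ z) f - Lp.compMeasurePreserving (τ z₀) (hτ z₀) f))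
      (𝓝 z₀) (𝓝 0) := by
    rw [tendsto_zero_iff_norm_tendsto_zero]
    simp_rw [LinearIsometry.norm_map]
    exact tendsto_iff_norm_sub_tendsto_zero.1 (hT.tendsto z₀)
  have h3 := h2.add h1
  simp_rw [← map_add, sub_add_cancel, zero_add, ← phaseComp_eq] at h3
  exact h3

end PhaseContinuity

namespace Heis

theorem measurable_schrodinger_phase (g : Heis) : Measurable fun x : ℝ =>
    Complex.exp (Complex.I * ((g.t + g.q * x + g.q * g.p / 2 : ℝ) : ℂ)) := by fun_prop

theorem norm_exp_I_mul_ofReal (r : ℝ) : ‖Complex.exp (Complex.I * (r : ℂ))‖ = 1 := by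
  rw [mul_comm]; exact Complex.norm_exp_ofReal_mul_I _

theorem measurable_cocycle (a : Heis) : Measurable (cocycle a) := by
  simp only [funext (cocycle_eq a)]; fun_prop

theorem norm_cocycle (a : Heis) (x : ℝ × ℝ) : ‖cocycle a x‖ = 1 := by
  rw [cocycle_eq]; exact norm_exp_I_mul_ofReal _

theorem schrodinger_coeFn (g : Heis) (φ : Lp ℂ 2 (volume : Measure ℝ)) :
    ⇑(schrodinger g φ) =ᵐ[volume] fun x : ℝ =>
      Complex.exp (Complex.I * ((g.t + g.q * x + g.q * g.p / 2 : ℝ) : ℂ)) * φ (x + g.p) :=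
  phaseComp_coeFn _ (measurable_schrodinger_phase g) (fun _ => norm_exp_I_mul_ofReal _) _
    (measurePreserving_add_right volume g.p) _

theorem inducedRep_coeFn_cocycle (g : Heis) (f : Lp ℂ 2 phaseMeasure) :
    ⇑(inducedRep g f) =ᵐ[phaseMeasure] fun x => cocycle g x * f (act g⁻¹ x) :=
  phaseComp_coeFn _ (measurable_cocycle g) (norm_cocycle g) _ (measurePreserving_act g⁻¹) _

theorem inducedRep_coeFn (g : Heis) (f : Lp ℂ 2 phaseMeasure) :
    ⇑(inducedRep g f) =ᵐ[phaseMeasure] fun x : ℝ × ℝ =>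
      Complex.exp (Complex.I * ((g.t + (x.1 * g.p - x.2 * g.q) / 2 : ℝ) : ℂ)) *
        f (x.1 - g.q, x.2 - g.p) := by
  filter_upwards [inducedRep_coeFn_cocycle g f] with x hx
  rw [hx, cocycle_eq, act_eq]
  congr 2
  ext <;> simp [sub_eq_neg_add]

theorem isStronglyContinuous_schrodinger : IsStronglyContinuous schrodinger := fun v => by
  have hq := continuous_q
  have hp := continuous_p
  have ht := continuous_t
  exact continuous_phaseComp _ measurable_schrodinger_phase
    (fun _ _ => norm_exp_I_mul_ofReal _) _ (fun g => measurePreserving_add_right volume g.p)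
    (fun x => by fun_prop) (by fun_prop) v

theorem isStronglyContinuous_inducedRep : IsStronglyContinuous inducedRep := fun v => by
  have hq := continuous_q
  have hp := continuous_p
  have ht := continuous_t
  refine continuous_phaseComp _ measurable_cocycle norm_cocycle (fun a => act a⁻¹)
    (fun a => measurePreserving_act a⁻¹) (fun x => ?_) ?_ v
  · simp only [cocycle_eq]
    fun_prop
  · have : Function.uncurry (fun a : Heis => act a⁻¹) =
        fun y : Heis × ℝ × ℝ => (-y.1.q + y.2.1, -y.1.p + y.2.2) := rfl
    rw [this]
    fun_prop

end Heis

/-! ## Coefficients of the Schrödinger representation -/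

theorem MeasureTheory.Lp.enorm_sq_eq_lintegral {X : Type*} [MeasurableSpace X] {ν : Measure X}
    (f : Lp ℂ 2 ν) : ‖f‖ₑ ^ 2 = ∫⁻ x, ‖f x‖ₑ ^ 2 ∂ν := by
  have := eLpNorm_nnreal_pow_eq_lintegral (f := f) (μ := ν) (p := 2) two_ne_zero
  rw [Lp.enorm_def]
  simpa using this

namespace Heis

theorem coeff_schrodinger_sec (u v : Lp ℂ 2 (volume : Measure ℝ)) (q p : ℝ) :
    coeff schrodinger u v (sec (q, p)) = Complex.exp (-(Complex.I * ((q * p / 2 : ℝ) : ℂ))) *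
      ∫ x, Complex.exp (-(Complex.I * (q * x : ℝ))) * (conj (u (x + p)) * v x) := by
  rw [coeff, L2.inner_def, ← integral_const_mul]
  refine integral_congr_ae ?_
  filter_upwards [schrodinger_coeFn (sec (q, p)) u] with x hx
  rw [hx, RCLike.inner_apply]
  simp only [sec, map_mul, ← Complex.exp_conj, Complex.conj_I, Complex.conj_ofReal]
  rw [← mul_assoc (Complex.exp (-(Complex.I * ((q * p / 2 : ℝ) : ℂ)))), ← Complex.exp_add,
    mul_comm (v x), mul_assoc]
  congr 2
  push_cast
  ring

theorem lintegral_translate_mul (u v : Lp ℂ 2 (volume : Measure ℝ)) :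
    ∫⁻ p : ℝ, ∫⁻ x, ‖conj (u (x + p)) * v x‖ₑ ^ 2 = ‖u‖ₑ ^ 2 * ‖v‖ₑ ^ 2 := by
  have hu := (Lp.stronglyMeasurable u).measurable
  have hv := (Lp.stronglyMeasurable v).measurable
  rw [lintegral_lintegral_swap]
  · simp only [enorm_mul, mul_pow, RCLike.enorm_conj]
    have : ∀ x : ℝ, ∫⁻ p, ‖u (x + p)‖ₑ ^ 2 * ‖v x‖ₑ ^ 2 = ‖u‖ₑ ^ 2 * ‖v x‖ₑ ^ 2 := fun x => by
      rw [lintegral_mul_const _ (by fun_prop), Lp.enorm_sq_eq_lintegral u,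
        lintegral_add_left_eq_self (fun p => ‖u p‖ₑ ^ 2) x]
    simp_rw [this]
    rw [lintegral_const_mul _ (by fun_prop), Lp.enorm_sq_eq_lintegral v]
  · have : Measurable fun z : ℝ × ℝ => ‖conj (u (z.2 + z.1)) * v z.2‖ₑ ^ 2 :=
      (((Complex.continuous_conj.measurable.comp (hu.comp (by fun_prop))).mul
        (hv.comp measurable_snd)).enorm).pow_const 2
    exact this.aemeasurable

/-- The function `conj (u (x + p)) * v x` of `x` is integrable for every `p` but square integrable
only for almost every `p`, by Tonelli; for those `p` Plancherel applies in `q`. Its factor `2π`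
cancels the `1 / 2π` in `phaseMeasure`. -/
theorem lintegral_coeff_schrodinger (u v : Lp ℂ 2 (volume : Measure ℝ)) :
    ∫⁻ x, ‖coeff schrodinger u v (sec x)‖ₑ ^ 2 ∂phaseMeasure = ‖u‖ₑ ^ 2 * ‖v‖ₑ ^ 2 := by
  have hu := (Lp.stronglyMeasurable u).measurable
  have hv := (Lp.stronglyMeasurable v).measurable
  have hmeas : Measurable fun x => ‖coeff schrodinger u v (sec x)‖ₑ ^ 2 := by
    have : Continuous fun x => coeff schrodinger u v (sec x) :=
      ((isStronglyContinuous_schrodinger u).comp continuous_sec).inner continuous_const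
    exact this.measurable.enorm.pow_const 2
  have hF : ∀ p : ℝ, Integrable fun x => conj (u (x + p)) * v x := fun p => by
    have h1 : MemLp (fun x => conj (u (x + p))) 2 volume :=
      ((Lp.memLp u).comp_measurePreserving (measurePreserving_add_right volume p)).star
    exact h1.integrable_mul (Lp.memLp v)
  have hae : ∀ᵐ p : ℝ, MemLp (fun x => conj (u (x + p)) * v x) 2 volume := by
    have h1 : ∫⁻ p : ℝ, ∫⁻ x, ‖conj (u (x + p)) * v x‖ₑ ^ 2 ≠ ∞ := by
      rw [lintegral_translate_mul]
      exact ENNReal.mul_ne_top (by simp) (by simp)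
    have hm : Measurable fun p : ℝ => ∫⁻ x, ‖conj (u (x + p)) * v x‖ₑ ^ 2 := by
      have : Measurable fun z : ℝ × ℝ => ‖conj (u (z.2 + z.1)) * v z.2‖ₑ ^ 2 :=
        (((Complex.continuous_conj.measurable.comp (hu.comp (by fun_prop))).mul
          (hv.comp measurable_snd)).enorm).pow_const 2
      exact this.lintegral_prod_right'
    filter_upwards [ae_lt_top hm h1] with p hp
    refine ⟨(hF p).1, ?_⟩
    rw [eLpNorm_lt_top_iff_lintegral_rpow_enorm_lt_top two_ne_zero ENNReal.ofNat_ne_top]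
    simpa using hp
  rw [phaseMeasure, lintegral_smul_measure, smul_eq_mul, Measure.volume_eq_prod,
    lintegral_prod_symm' _ hmeas, ← lintegral_translate_mul]
  have hin : ∀ᵐ p : ℝ, ∫⁻ q : ℝ, ‖coeff schrodinger u v (sec (q, p))‖ₑ ^ 2 =
      ENNReal.ofReal (2 * Real.pi) * ∫⁻ x, ‖conj (u (x + p)) * v x‖ₑ ^ 2 := by
    filter_upwards [hae] with p hp
    rw [← lintegral_enorm_sq_integral_exp (hF p) hp]
    refine lintegral_congr fun q => ?_
    rw [coeff_schrodinger_sec, enorm_mul]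
    have : ‖Complex.exp (-(Complex.I * ((q * p / 2 : ℝ) : ℂ)))‖ₑ = 1 := by
      rw [← ofReal_norm, ← mul_neg, ← Complex.ofReal_neg, norm_exp_I_mul_ofReal, ENNReal.ofReal_one]
    rw [this, one_mul]
  rw [lintegral_congr_ae hin, lintegral_const_mul' _ _ ENNReal.ofReal_ne_top, ← mul_assoc,
    ← ENNReal.ofReal_mul (by positivity), one_div, inv_mul_cancel₀ (by positivity),
    ENNReal.ofReal_one, one_mul]

/-! ### Transfer to equivalent representations -/

section Realizations

variable {H : Type*} [NormedAddCommGroup H] [InnerProductSpace ℂ H]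

/-- The properties shared by all realizations of the Schrödinger representation. -/
structure IsSchrodingerType (ρ : Heis →* (H ≃ₗᵢ[ℂ] H)) : Prop where
  continuous : IsStronglyContinuous ρ
  central : ∀ (t : ℝ) (v : H), ρ ⟨t, 0, 0⟩ v = Complex.exp (Complex.I * t) • v
  lintegral_coeff : ∀ u v : H,
    ∫⁻ x, ‖coeff ρ u v (sec x)‖ₑ ^ 2 ∂phaseMeasure = ‖u‖ₑ ^ 2 * ‖v‖ₑ ^ 2

theorem schrodinger_central (t : ℝ) (v : Lp ℂ 2 (volume : Measure ℝ)) :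
    schrodinger ⟨t, 0, 0⟩ v = Complex.exp (Complex.I * t) • v := by
  apply Lp.ext
  filter_upwards [schrodinger_coeFn ⟨t, 0, 0⟩ v, Lp.coeFn_smul (Complex.exp (Complex.I * t)) v]
    with x h1 h2
  rw [h1, h2]
  simp

theorem IsSchrodingerType.of_equivalent {ρ : Heis →* (H ≃ₗᵢ[ℂ] H)}
    (h : UnitarilyEquivalent ρ schrodinger) : IsSchrodingerType ρ := by
  obtain ⟨V, hV⟩ := h
  have hρ : ∀ g v, ρ g v = V.symm (schrodinger g (V v)) := fun g v => by
    rw [← hV, LinearIsometryEquiv.symm_apply_apply]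
  refine ⟨fun v => ?_, fun t v => ?_, fun u v => ?_⟩
  · simp_rw [hρ]
    exact V.symm.continuous.comp (isStronglyContinuous_schrodinger (V v))
  · rw [hρ, schrodinger_central, map_smul, LinearIsometryEquiv.symm_apply_apply]
  · have : ∀ x, coeff ρ u v (sec x) = coeff schrodinger (V u) (V v) (sec x) := fun x => by
      rw [coeff, coeff, ← hV, LinearIsometryEquiv.inner_map_map]
    simp_rw [this, lintegral_coeff_schrodinger, ← ofReal_norm, LinearIsometryEquiv.norm_map]

end Realizations

end Heis

/-! ## Orthogonality relations and the space of coefficients -/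

namespace Heis

namespace IsSchrodingerType

variable {H : Type*} [NormedAddCommGroup H] [InnerProductSpace ℂ H] {ρ : Heis →* (H ≃ₗᵢ[ℂ] H)}

theorem apply_eq (hρ : IsSchrodingerType ρ) (g : Heis) (v : H) :
    ρ g v = Complex.exp (Complex.I * g.t) • ρ (sec (g.q, g.p)) v := by
  have : g = ⟨g.t, 0, 0⟩ * sec (g.q, g.p) := by ext <;> simp [sec]
  conv_lhs => rw [this]
  rw [map_mul, ← hρ.central]
  rfl

theorem coeff_eq (hρ : IsSchrodingerType ρ) (u v : H) (g : Heis) :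
    coeff ρ u v g = Complex.exp (-(Complex.I * g.t)) * coeff ρ u v (sec (g.q, g.p)) := by
  rw [coeff, hρ.apply_eq, inner_smul_left, ← Complex.exp_conj, coeff]
  simp

theorem continuous_coeff (hρ : IsSchrodingerType ρ) (u v : H) :
    Continuous fun x => coeff ρ u v (sec x) :=
  ((hρ.continuous u).comp continuous_sec).inner continuous_const

theorem memLp_coeff (hρ : IsSchrodingerType ρ) (u v : H) :
    MemLp (coeff ρ u v ∘ sec) 2 phaseMeasure := by
  refine ⟨(hρ.continuous_coeff u v).aestronglyMeasurable, ?_⟩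
  rw [eLpNorm_lt_top_iff_lintegral_rpow_enorm_lt_top two_ne_zero ENNReal.ofNat_ne_top]
  have := hρ.lintegral_coeff u v
  simp only [ENNReal.toReal_ofNat, ENNReal.rpow_ofNat, Function.comp_apply]
  rw [this]
  exact ENNReal.mul_lt_top (by simp) (by simp)

theorem _root_.Heis.coeff_apply_inv (ρ : Heis →* (H ≃ₗᵢ[ℂ] H)) (g a : Heis) (u v : H) :
    coeff ρ u (ρ a v) g = coeff ρ u v (a⁻¹ * g) := by
  rw [coeff, coeff, map_mul, ← LinearIsometryEquiv.inner_map_map (ρ a) (_ : H) v]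
  congr 1
  change ρ g u = (ρ a * (ρ a⁻¹ * ρ g)) u
  rw [← map_mul, ← map_mul, mul_inv_cancel_left]

/-- The map `(u, v) ↦ c_{u,v} ∘ s`. -/
def coeffLp (hρ : IsSchrodingerType ρ) : H →ₗ⋆[ℂ] H →ₗ[ℂ] Lp ℂ 2 phaseMeasure :=
  LinearMap.mk₂'ₛₗ (starRingEnd ℂ) (RingHom.id ℂ) (fun u v => (hρ.memLp_coeff u v).toLp)
    (fun u u' v => by
      rw [← MemLp.toLp_add]
      refine MemLp.toLp_congr _ _ (.of_forall fun x => ?_)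
      simp [coeff])
    (fun c u v => by
      rw [← MemLp.toLp_const_smul]
      refine MemLp.toLp_congr _ _ (.of_forall fun x => ?_)
      simp [coeff, mul_comm])
    (fun u v v' => by
      rw [← MemLp.toLp_add]
      refine MemLp.toLp_congr _ _ (.of_forall fun x => ?_)
      simp [coeff])
    (fun c u v => by
      rw [← MemLp.toLp_const_smul]
      refine MemLp.toLp_congr _ _ (.of_forall fun x => ?_)
      simp [coeff])

theorem coeffLp_coeFn (hρ : IsSchrodingerType ρ) (u v : H) :
    ⇑(hρ.coeffLp u v) =ᵐ[phaseMeasure] coeff ρ u v ∘ sec :=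
  (hρ.memLp_coeff u v).coeFn_toLp

theorem norm_coeffLp (hρ : IsSchrodingerType ρ) (u v : H) :
    ‖hρ.coeffLp u v‖ = ‖u‖ * ‖v‖ := by
  have h : ‖hρ.coeffLp u v‖ₑ ^ 2 = (‖u‖ₑ * ‖v‖ₑ) ^ 2 := by
    rw [Lp.enorm_sq_eq_lintegral, mul_pow, ← hρ.lintegral_coeff]
    refine lintegral_congr_ae ?_
    filter_upwards [hρ.coeffLp_coeFn u v] with x hx
    rw [hx, Function.comp_apply]
  have h2 := congrArg ENNReal.toReal h
  simp only [ENNReal.toReal_pow, ENNReal.toReal_mul, toReal_enorm] at h2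
  exact (pow_left_inj₀ (norm_nonneg _) (by positivity) two_ne_zero).1 h2

theorem inner_coeffLp (hρ : IsSchrodingerType ρ) (u v u' v' : H) :
    ⟪hρ.coeffLp u v, hρ.coeffLp u' v'⟫_ℂ = ⟪u', u⟫_ℂ * ⟪v, v'⟫_ℂ :=
  inner_eq_of_norm_eq hρ.coeffLp hρ.norm_coeffLp u u' v v'

theorem inner_coeffLp_left (hρ : IsSchrodingerType ρ) (u v : H) (f : Lp ℂ 2 phaseMeasure) :
    ⟪hρ.coeffLp u v, f⟫_ℂ = ∫ x, conj (coeff ρ u v (sec x)) * f x ∂phaseMeasure := by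
  rw [L2.inner_def]
  refine integral_congr_ae ?_
  filter_upwards [hρ.coeffLp_coeFn u v] with x h1
  rw [h1, RCLike.inner_apply, mul_comm, Function.comp_apply]

theorem integral_coeff_mul_coeff (hρ : IsSchrodingerType ρ) (u v u' v' : H) :
    ∫ x, conj (coeff ρ u v (sec x)) * coeff ρ u' v' (sec x) ∂phaseMeasure =
      ⟪u', u⟫_ℂ * ⟪v, v'⟫_ℂ := by
  rw [← hρ.inner_coeffLp, hρ.inner_coeffLp_left]
  refine integral_congr_ae ?_
  filter_upwards [hρ.coeffLp_coeFn u' v'] with x h2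
  rw [h2, Function.comp_apply]

theorem integrable_coeff_mul_coeff (hρ : IsSchrodingerType ρ) (u v u' v' : H) :
    Integrable (fun x => conj (coeff ρ u v (sec x)) * coeff ρ u' v' (sec x)) phaseMeasure :=
  (hρ.memLp_coeff u v).star.integrable_mul (hρ.memLp_coeff u' v')

theorem squareIntegrable (hρ : IsSchrodingerType ρ) : SquareIntegrableModCentre ρ :=
  hρ.memLp_coeff

theorem hasFormalDegree (hρ : IsSchrodingerType ρ) : HasFormalDegree ρ 1 :=
  ⟨one_pos, fun u v u' v' => by rw [hρ.integral_coeff_mul_coeff]; simp⟩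

/-- The operator `v ↦ c_{u,v} ∘ s`. -/
def coeffCLM (hρ : IsSchrodingerType ρ) (u : H) : H →L[ℂ] Lp ℂ 2 phaseMeasure :=
  (hρ.coeffLp u).mkContinuous ‖u‖ fun v => (hρ.norm_coeffLp u v).le

theorem coeffOperator_eq (hρ : IsSchrodingerType ρ) (u : H) :
    coeffOperator ρ u = hρ.coeffCLM u := by
  have h : ∃ B, IsCoeffOperator ρ u B := ⟨hρ.coeffCLM u, fun v => hρ.coeffLp_coeFn u v⟩
  rw [coeffOperator, dif_pos h]
  ext1 v
  exact Lp.ext ((h.choose_spec v).trans (hρ.coeffLp_coeFn u v).symm)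

theorem coeffOperator_apply (hρ : IsSchrodingerType ρ) (u v : H) :
    coeffOperator ρ u v = hρ.coeffLp u v := by
  rw [hρ.coeffOperator_eq]; rfl

theorem isCoeffOperator (hρ : IsSchrodingerType ρ) (u : H) :
    IsCoeffOperator ρ u (coeffOperator ρ u) := fun v => by
  rw [hρ.coeffOperator_apply]; exact hρ.coeffLp_coeFn u v

/-- If `V` contains `u ≠ 0` and `v ⊥ V`, then `c_{u,v}` vanishes on the section, and `‖u‖ * ‖v‖ = 0`
forces `v = 0`. -/
theorem isIrreducible [CompleteSpace H] [Nontrivial H] (hρ : IsSchrodingerType ρ) :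
    IsIrreducibleRep ρ := by
  refine ⟨inferInstance, fun V hV hinv => ?_⟩
  by_contra! hne
  obtain ⟨u, hu, hu0⟩ := (Submodule.ne_bot_iff V).1 hne.1
  refine hne.2 ?_
  have : CompleteSpace V := hV.completeSpace_coe
  rw [← Submodule.orthogonal_eq_bot_iff, Submodule.eq_bot_iff]
  intro v hv
  have h0 : hρ.coeffLp u v = 0 := by
    apply Lp.ext
    filter_upwards [hρ.coeffLp_coeFn u v, Lp.coeFn_zero ℂ 2 phaseMeasure] with x hx h0
    rw [hx, h0]
    exact hv _ (hinv (sec x) u hu)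
  have := hρ.norm_coeffLp u v
  rw [h0, norm_zero, eq_comm, mul_eq_zero, norm_eq_zero, norm_eq_zero] at this
  exact this.resolve_left hu0

/-- One has `c_{u,ρ(g)v}(s(x)) = c_{u,v}(g⁻¹ s(x))`, and `g⁻¹ s(x)` differs from `s(g⁻¹.x)` by a
central element, whose character is the cocycle. -/
theorem coeffLp_intertwines (hρ : IsSchrodingerType ρ) (g : Heis) (u v : H) :
    hρ.coeffLp u (ρ g v) = inducedRep g (hρ.coeffLp u v) := by
  apply Lp.ext
  have hq := (measurePreserving_act g⁻¹).quasiMeasurePreserving.ae (hρ.coeffLp_coeFn u v)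
  filter_upwards [hρ.coeffLp_coeFn u (ρ g v), inducedRep_coeFn_cocycle g (hρ.coeffLp u v), hq]
    with x h1 h2 h3
  rw [h1, h2, h3, Function.comp_apply, Function.comp_apply, coeff_apply_inv, hρ.coeff_eq,
    cocycle_eq]
  congr 2
  simp only [sec, mul_t, inv_t, inv_p, inv_q]
  push_cast
  ring

/-- Conjugating `s(x)` by `s(a)` changes only its central coordinate, by the symplectic form of `x`
and `a`. As `a` varies, all characters of `ℝ²` occur, so Fourier analysis on phase space becomes
available. -/
theorem coeff_apply_apply (hρ : IsSchrodingerType ρ) (a x : ℝ × ℝ) (u v : H) :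
    coeff ρ (ρ (sec a) u) (ρ (sec a) v) (sec x) =
      Complex.exp (Complex.I * ((x.1 * a.2 - x.2 * a.1 : ℝ) : ℂ)) * coeff ρ u v (sec x) := by
  rw [coeff_apply_inv]
  have : coeff ρ (ρ (sec a) u) v ((sec a)⁻¹ * sec x) = coeff ρ u v ((sec a)⁻¹ * sec x * sec a) := by
    rw [coeff, coeff, map_mul _ _ (sec a)]
    rfl
  rw [this, hρ.coeff_eq]
  simp only [sec, mul_t, mul_q, mul_p, inv_t, inv_p, inv_q]
  rw [show -a.1 + x.1 + a.1 = x.1 by ring, show -a.2 + x.2 + a.2 = x.2 by ring]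
  congr 2
  push_cast
  ring

/-! ### Completeness of the coefficients -/

/-- A function orthogonal to all coefficients is, pointwise, annihilated by them. -/
theorem coeff_mul_ae_eq_zero (hρ : IsSchrodingerType ρ) {f : Lp ℂ 2 phaseMeasure}
    (hf : ∀ u v, ⟪hρ.coeffLp u v, f⟫_ℂ = 0) (u v : H) :
    (fun x => conj (coeff ρ u v (sec x)) * f x) =ᵐ[phaseMeasure] 0 := by
  refine ae_eq_zero_of_integral_exp_eq_zero
    ((hρ.memLp_coeff u v).star.integrable_mul (Lp.memLp f)) fun L => ?_
  -- This `a` makes `x.1 * a.2 - x.2 * a.1 = -L x`; the sign is undone by the conjugation of the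
  -- coefficient.
  set a : ℝ × ℝ := (L (0, 1), -L (1, 0)) with ha
  rw [← hf (ρ (sec a) u) (ρ (sec a) v), hρ.inner_coeffLp_left]
  refine integral_congr_ae (.of_forall fun x => ?_)
  have hL : L x = x.1 * L (1, 0) + x.2 * L (0, 1) := by
    conv_lhs => rw [show x = x.1 • ((1, 0) : ℝ × ℝ) + x.2 • ((0, 1) : ℝ × ℝ) by ext <;> simp]
    rw [map_add, map_smul, map_smul, smul_eq_mul, smul_eq_mul]
  simp only [hρ.coeff_apply_apply, map_mul, ← Complex.exp_conj, Complex.conj_I, Complex.conj_ofReal]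
  rw [mul_comm, ← mul_assoc]
  congr 3
  rw [hL, ha]
  push_cast
  ring

/-- The coefficients `c_{u,v}`, for fixed `u ≠ 0`, have no common zeros. -/
theorem ae_eq_zero_of_coeff_mul {u : H} (hu : u ≠ 0) (e : HilbertBasis ℕ ℂ H)
    {f : ℝ × ℝ → ℂ}
    (hf : ∀ v, (fun x => conj (coeff ρ u v (sec x)) * f x) =ᵐ[phaseMeasure] 0) :
    f =ᵐ[phaseMeasure] 0 := by
  -- The null set depends on `v`; restricting `v` to a countable basis leaves a single null set, and
  -- the basis still detects `ρ (sec x) u ≠ 0`.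
  have h := ae_all_iff.2 fun n => hf (e n)
  filter_upwards [h] with x hx
  by_contra hfx
  have h0 : ∀ n, ⟪ρ (sec x) u, e n⟫_ℂ = 0 := fun n => by
    have := (mul_eq_zero.1 (hx n)).resolve_right hfx
    exact (map_eq_zero _).1 this
  have h1 : ρ (sec x) u = 0 := by
    rw [← e.repr.map_eq_zero_iff]
    ext n
    rw [e.repr_apply_apply, ← inner_conj_symm, h0 n]
    simp
  exact hu ((map_eq_zero_iff _ (ρ (sec x)).injective).1 h1)

theorem eq_zero_of_inner_coeffLp (hρ : IsSchrodingerType ρ) (e : HilbertBasis ℕ ℂ H)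
    {f : Lp ℂ 2 phaseMeasure} (hf : ∀ u v, ⟪hρ.coeffLp u v, f⟫_ℂ = 0) : f = 0 :=
  Lp.eq_zero_iff_ae_eq_zero.2 (ae_eq_zero_of_coeff_mul (e.orthonormal.ne_zero 0) e
    fun v => hρ.coeff_mul_ae_eq_zero hf (e 0) v)

theorem inner_coeffLp_eq_zero_of_basis (hρ : IsSchrodingerType ρ) (e : HilbertBasis ℕ ℂ H)
    {f : Lp ℂ 2 phaseMeasure} (hf : ∀ n m, ⟪hρ.coeffLp (e n) (e m), f⟫_ℂ = 0) (u v : H) :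
    ⟪hρ.coeffLp u v, f⟫_ℂ = 0 := by
  have hd : Dense (Submodule.span ℂ (Set.range e) : Set H) :=
    Submodule.dense_iff_topologicalClosure_eq_top.2 e.dense_span
  have h1 : ∀ n v, ⟪hρ.coeffLp (e n) v, f⟫_ℂ = 0 := by
    intro n
    have : (innerSL ℂ f : Lp ℂ 2 phaseMeasure →L[ℂ] ℂ).comp (hρ.coeffCLM (e n)) = 0 := by
      refine ContinuousLinearMap.ext_on hd ?_
      rintro _ ⟨m, rfl⟩
      change ⟪f, hρ.coeffLp (e n) (e m)⟫_ℂ = 0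
      rw [← inner_conj_symm, hf, map_zero]
    intro v
    rw [← inner_conj_symm, show ⟪f, hρ.coeffLp (e n) v⟫_ℂ = 0 from
      DFunLike.congr_fun this v, map_zero]
  -- Linear in `u`, because `coeffLp` and the inner product are both conjugate linear there; density
  -- of the basis thus applies to `u` as well.
  let B : H →ₗ[ℂ] ℂ :=
    { toFun := fun u => ⟪hρ.coeffLp u v, f⟫_ℂ
      map_add' := fun u u' => by simp [inner_add_left]
      map_smul' := fun c u => by simp [inner_smul_left] }
  let B' : H →L[ℂ] ℂ := B.mkContinuous (‖v‖ * ‖f‖) fun u => by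
    refine (norm_inner_le_norm (𝕜 := ℂ) (hρ.coeffLp u v) f).trans ?_
    rw [hρ.norm_coeffLp]
    exact le_of_eq (by ring)
  have : B' = 0 := by
    refine ContinuousLinearMap.ext_on hd ?_
    rintro _ ⟨n, rfl⟩
    exact h1 n v
  exact DFunLike.congr_fun this u

/-- The coefficients of an orthonormal basis of `H` are an orthonormal basis of `L²(X, α)`. -/
def coeffBasis (hρ : IsSchrodingerType ρ) (e : HilbertBasis ℕ ℂ H) :
    HilbertBasis (ℕ × ℕ) ℂ (Lp ℂ 2 phaseMeasure) :=
  HilbertBasis.mkOfOrthogonalEqBot (v := fun n : ℕ × ℕ => hρ.coeffLp (e n.1) (e n.2))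
    (by
      rw [orthonormal_iff_ite]
      rintro ⟨i, j⟩ ⟨i', j'⟩
      have := (orthonormal_iff_ite (𝕜 := ℂ)).1 e.orthonormal
      rw [hρ.inner_coeffLp, this, this]
      by_cases h1 : i = i' <;> by_cases h2 : j = j' <;> simp [h1, h2, eq_comm])
    (by
      rw [Submodule.eq_bot_iff]
      intro f hf
      refine hρ.eq_zero_of_inner_coeffLp e (hρ.inner_coeffLp_eq_zero_of_basis e fun n m => ?_)
      exact hf _ (Submodule.subset_span ⟨(n, m), rfl⟩))

theorem coeffBasis_apply (hρ : IsSchrodingerType ρ) (e : HilbertBasis ℕ ℂ H) (n m : ℕ) :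
    hρ.coeffBasis e (n, m) = hρ.coeffLp (e n) (e m) := by
  simp [coeffBasis]

theorem coeffSpace_eq_top (hρ : IsSchrodingerType ρ) (e : HilbertBasis ℕ ℂ H) :
    coeffSpace ρ = ⊤ := by
  rw [eq_top_iff, ← (hρ.coeffBasis e).dense_span, coeffSpace]
  refine Submodule.topologicalClosure_mono (Submodule.span_mono ?_)
  rintro _ ⟨⟨n, m⟩, rfl⟩
  rw [coeffBasis_apply]
  exact ⟨e n, e m, hρ.coeffLp_coeFn _ _⟩

theorem isIsotypic (hρ : IsSchrodingerType ρ) (e : HilbertBasis ℕ ℂ H) :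
    IsIsotypicRepOfType inducedRep ρ := by
  refine ⟨ℕ, fun n => ⟨hρ.coeffLp (e n), fun v => ?_⟩, fun n g v => ?_, fun i j hij v w => ?_, ?_⟩
  · rw [hρ.norm_coeffLp, e.orthonormal.1, one_mul]
  · exact hρ.coeffLp_intertwines g (e n) v
  · change ⟪hρ.coeffLp (e i) v, hρ.coeffLp (e j) w⟫_ℂ = 0
    rw [hρ.inner_coeffLp, e.orthonormal.2 hij.symm, zero_mul]
  · rw [eq_top_iff, ← (hρ.coeffBasis e).dense_span]
    refine Submodule.topologicalClosure_mono (Submodule.span_le.2 ?_)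
    rintro _ ⟨⟨n, m⟩, rfl⟩
    rw [coeffBasis_apply]
    exact Submodule.mem_iSup_of_mem n ⟨e m, rfl⟩

variable [CompleteSpace H]

/-- The operator form of the orthogonality relations; idempotence and mutual orthogonality of the
Neumark projections are read off from it. -/
theorem adjoint_coeffOperator_comp (hρ : IsSchrodingerType ρ) (u u' : H) :
    ContinuousLinearMap.adjoint (coeffOperator ρ u) ∘L coeffOperator ρ u' = ⟪u', u⟫_ℂ • 1 := by
  ext1 v
  refine ext_inner_left ℂ fun w => ?_
  rw [ContinuousLinearMap.comp_apply, ContinuousLinearMap.adjoint_inner_right,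
    hρ.coeffOperator_apply, hρ.coeffOperator_apply, hρ.inner_coeffLp]
  simp [inner_smul_right]

theorem isResolutionOfIdentity (hρ : IsSchrodingerType ρ) (e : HilbertBasis ℕ ℂ H) :
    IsResolutionOfIdentity fun n => neumarkProjection ρ (e n) := by
  have hcomp : ∀ i j, neumarkProjection ρ (e i) ∘L neumarkProjection ρ (e j) =
      ⟪e j, e i⟫_ℂ • (coeffOperator ρ (e i) ∘L
        ContinuousLinearMap.adjoint (coeffOperator ρ (e j))) := by
    intro i j
    ext1 f
    have := congrArg (fun T : H →L[ℂ] H =>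
      coeffOperator ρ (e i) (T (ContinuousLinearMap.adjoint (coeffOperator ρ (e j)) f)))
      (hρ.adjoint_coeffOperator_comp (e i) (e j))
    simpa [neumarkProjection] using this
  refine ⟨fun n => ⟨?_, ?_⟩, fun i j hij => ?_, fun f => ?_⟩
  · have := hcomp n n
    rw [inner_self_eq_norm_sq_to_K, e.orthonormal.1] at this
    rwa [RCLike.ofReal_one, one_pow, one_smul] at this
  · rw [ContinuousLinearMap.isSelfAdjoint_iff']
    simp only [neumarkProjection]
    rw [ContinuousLinearMap.adjoint_comp, ContinuousLinearMap.adjoint_adjoint]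
  · rw [hcomp, e.orthonormal.2 hij.symm, zero_smul]
  -- For fixed `n`, the terms of the expansion of `f` in the basis `c_{e_n,e_m} ∘ s` sum over `m` to
  -- `P_{e_n} f`.
  · refine ((hρ.coeffBasis e).hasSum_repr f).prod_fiberwise fun n => ?_
    have := (e.hasSum_repr (ContinuousLinearMap.adjoint (coeffOperator ρ (e n)) f)).mapL
      (coeffOperator ρ (e n))
    refine this.congr_fun ?_
    intro m
    rw [HilbertBasis.repr_apply_apply, coeffBasis_apply, map_smul, HilbertBasis.repr_apply_apply,
      ContinuousLinearMap.adjoint_inner_right, hρ.coeffOperator_apply]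

end IsSchrodingerType

end Heis

/-! ## Sums of integrable functions -/

section IntegralTsum

variable {X : Type*} [MeasurableSpace X] {ν : Measure X} {ι : Type*} [Countable ι]

theorem ae_summable_of_summable_integral_norm {F : ι → X → ℂ} (hF : ∀ i, Integrable (F i) ν)
    (hs : Summable fun i => ∫ a, ‖F i a‖ ∂ν) : ∀ᵐ a ∂ν, Summable fun i => F i a := by
  have h1 : ∫⁻ a, ∑' i, ‖F i a‖ₑ ∂ν ≠ ∞ := by
    rw [lintegral_tsum fun i => (hF i).1.enorm]
    have : ∀ i, ∫⁻ a, ‖F i a‖ₑ ∂ν = ENNReal.ofReal (∫ a, ‖F i a‖ ∂ν) := fun i =>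
      (ofReal_integral_norm_eq_lintegral_enorm (hF i)).symm
    simp_rw [this]
    exact hs.tsum_ofReal_ne_top
  filter_upwards [ae_lt_top' (AEMeasurable.tsum fun i => (hF i).1.enorm) h1] with a ha
  exact Summable.of_nnnorm (ENNReal.tsum_coe_ne_top_iff_summable.1 ha.ne)

theorem integrable_tsum_of_summable_integral_norm {F : ι → X → ℂ} (hF : ∀ i, Integrable (F i) ν)
    (hs : Summable fun i => ∫ a, ‖F i a‖ ∂ν) : Integrable (fun a => ∑' i, F i a) ν := by
  have hm : AEStronglyMeasurable (fun a => ∑' i, F i a) ν := by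
    refine aestronglyMeasurable_of_tendsto_ae (f := fun (s : Finset ι) a => ∑ i ∈ s, F i a)
      Filter.atTop (fun s => Finset.aestronglyMeasurable_fun_sum s fun i _ => (hF i).1) ?_
    filter_upwards [ae_summable_of_summable_integral_norm hF hs] with a ha
    exact ha.hasSum
  refine ⟨hm, ?_⟩
  refine (lintegral_mono fun a => enorm_tsum_le_tsum_enorm).trans_lt ?_
  rw [lintegral_tsum fun i => (hF i).1.enorm]
  have : ∀ i, ∫⁻ a, ‖F i a‖ₑ ∂ν = ENNReal.ofReal (∫ a, ‖F i a‖ ∂ν) := fun i =>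
    (ofReal_integral_norm_eq_lintegral_enorm (hF i)).symm
  simp_rw [this]
  exact hs.tsum_ofReal_lt_top

end IntegralTsum

/-! ## The projection measure `E ↦ 1_E` -/

section IndicatorProj

variable {X : Type*} [MeasurableSpace X] {ν : Measure X}

theorem indicatorProj_coeFn {E : Set X} (hE : MeasurableSet E) (f : Lp ℂ 2 ν) :
    ⇑(indicatorProj ν E f) =ᵐ[ν] E.indicator f := by
  rw [indicatorProj, dif_pos hE]
  exact ((Lp.memLp f).indicator hE).coeFn_toLp

theorem inner_indicatorProj {E : Set X} (hE : MeasurableSet E) (f g : Lp ℂ 2 ν) :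
    ⟪f, indicatorProj ν E g⟫_ℂ = ∫ x in E, ⟪f x, g x⟫_ℂ ∂ν := by
  rw [L2.inner_def, ← integral_indicator hE]
  refine integral_congr_ae ?_
  filter_upwards [indicatorProj_coeFn hE g] with x hx
  rw [hx]
  by_cases h : x ∈ E <;> simp [h]

theorem integrable_inner_coeFn (f g : Lp ℂ 2 ν) : Integrable (fun x => ⟪f x, g x⟫_ℂ) ν :=
  L2.integrable_inner f g

theorem isStarProjection_indicatorProj {E : Set X} (hE : MeasurableSet E) :
    IsStarProjection (indicatorProj ν E) := by
  constructor
  · ext1 f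
    apply Lp.ext
    rw [mul_apply_eq_comp]
    filter_upwards [indicatorProj_coeFn hE (indicatorProj ν E f), indicatorProj_coeFn hE f]
      with x h1 h2
    rw [h1, h2]
    by_cases h : x ∈ E <;> simp [h, h2]
  · rw [ContinuousLinearMap.isSelfAdjoint_iff']
    ext1 f
    refine ext_inner_left ℂ fun g => ?_
    rw [ContinuousLinearMap.adjoint_inner_right, ← inner_conj_symm, inner_indicatorProj hE,
      inner_indicatorProj hE, ← integral_conj]
    simp only [inner_conj_symm]

theorem isPOM_indicatorProj : IsPOM (indicatorProj ν) where
  positive E hE := by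
    have h := isStarProjection_indicatorProj (ν := ν) hE
    have h2 : indicatorProj ν E =
        ContinuousLinearMap.adjoint (indicatorProj ν E) ∘L indicatorProj ν E := by
      rw [ContinuousLinearMap.isSelfAdjoint_iff'.1 h.isSelfAdjoint]
      exact h.isIdempotentElem.symm
    rw [h2]
    exact ContinuousLinearMap.isPositive_adjoint_comp_self _
  univ := by
    ext1 f
    apply Lp.ext
    filter_upwards [indicatorProj_coeFn MeasurableSet.univ f] with x h
    simp [h]
  iUnion E hE hd v w := by
    simp_rw [inner_indicatorProj (hE _), inner_indicatorProj (MeasurableSet.iUnion hE)]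
    exact hasSum_integral_iUnion hE hd (integrable_inner_coeFn v w).integrableOn

end IndicatorProj

/-! ## Mixtures of vector states -/

section Mixtures

variable {H : Type u} [NormedAddCommGroup H] [InnerProductSpace ℂ H]

theorem HilbertBasis.hasSum_norm_sq {ι : Type*} (b : HilbertBasis ι ℂ H) (x : H) :
    HasSum (fun i => ‖⟪b i, x⟫_ℂ‖ ^ 2) (‖x‖ ^ 2) := by
  have h := b.hasSum_inner_mul_inner x x
  rw [inner_self_eq_norm_sq_to_K] at h
  have h2 : ∀ i, ⟪x, b i⟫_ℂ * ⟪b i, x⟫_ℂ = ((‖⟪b i, x⟫_ℂ‖ ^ 2 : ℝ) : ℂ) := fun i => by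
    rw [← inner_conj_symm, mul_comm, Complex.mul_conj, Complex.normSq_eq_norm_sq]
  simp_rw [h2] at h
  have h3 : (((‖x‖ : ℝ) : ℂ)) ^ 2 = ((‖x‖ ^ 2 : ℝ) : ℂ) := by push_cast; rfl
  exact Complex.hasSum_ofReal.1 (h3 ▸ h)

/-- `T = ∑ |sₙ⟩⟨sₙ|` with `∑ ‖sₙ‖² = 1`. -/
structure IsMixture (T : H →L[ℂ] H) (s : ℕ → H) : Prop where
  hasSum_norm : HasSum (fun n => ‖s n‖ ^ 2) 1
  hasSum_apply : ∀ w, HasSum (fun n => ⟪s n, w⟫_ℂ • s n) (T w)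

theorem IsMixture.hasSum_inner {T : H →L[ℂ] H} {s : ℕ → H} (h : IsMixture T s) (v w : H) :
    HasSum (fun n => ⟪v, s n⟫_ℂ * ⟪s n, w⟫_ℂ) ⟪v, T w⟫_ℂ := by
  have := (h.hasSum_apply w).mapL (innerSL ℂ v)
  refine this.congr_fun fun n => ?_
  simp [mul_comm]

variable [CompleteSpace H]

/-- No spectral decomposition is needed: with `S` the positive square root of `T`, take `s n = S (e
n)`. Expanding `S w` in the basis and applying `S` gives `T w`. -/
theorem IsState.exists_isMixture {T : H →L[ℂ] H} (hT : IsState T) (e : HilbertBasis ℕ ℂ H) :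
    ∃ s, IsMixture T s := by
  have hT0 : 0 ≤ T := (ContinuousLinearMap.nonneg_iff_isPositive T).2 hT.1
  set S := CFC.sqrt T with hS
  have hSS : S * S = T := CFC.sqrt_mul_sqrt_self T hT0
  have hSa : IsSelfAdjoint S := IsSelfAdjoint.of_nonneg (CFC.sqrt_nonneg T)
  have hin : ∀ v w, ⟪S v, w⟫_ℂ = ⟪v, S w⟫_ℂ := fun v w => by
    rw [← ContinuousLinearMap.adjoint_inner_right, ContinuousLinearMap.isSelfAdjoint_iff'.1 hSa]
  refine ⟨fun n => S (e n), ?_, fun w => ?_⟩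
  -- `IsState` speaks of index types in the universe of `H`, so `ℕ` is lifted.
  · let b : HilbertBasis (ULift.{u} ℕ) ℂ H :=
      HilbertBasis.mk (v := fun i => e i.down)
        (e.orthonormal.comp _ ULift.down_injective)
        (by
          rw [← e.dense_span]
          refine Submodule.topologicalClosure_mono (Submodule.span_mono ?_)
          rintro _ ⟨n, rfl⟩
          exact ⟨⟨n⟩, rfl⟩)
    have h1 := hT.2 (ULift.{u} ℕ) b
    have h2 : ∀ i : ULift.{u} ℕ, ⟪b i, T (b i)⟫_ℂ = ((‖S (e i.down)‖ ^ 2 : ℝ) : ℂ) := fun i => by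
      rw [← hSS, mul_apply_eq_comp, ← hin, inner_self_eq_norm_sq_to_K]
      simp [b]
    simp_rw [h2] at h1
    have h3 : HasSum (fun i : ULift.{u} ℕ => ‖S (e i.down)‖ ^ 2) 1 := by
      rw [← Complex.hasSum_ofReal]; simpa using h1
    exact (Equiv.hasSum_iff (Equiv.ulift.{u} : ULift.{u} ℕ ≃ ℕ)).1 h3
  · have := (e.hasSum_repr (S w)).mapL S
    rw [← mul_apply_eq_comp, hSS] at this
    refine this.congr_fun fun n => ?_
    rw [map_smul, e.repr_apply_apply, hin]

/-- The trace `tr[T B]` for a mixture `T`. -/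
theorem IsMixture.hasSum_opTrace {T : H →L[ℂ] H} {s : ℕ → H} (h : IsMixture T s) (B : H →L[ℂ] H) :
    HasSum (fun n => ⟪s n, B (s n)⟫_ℂ) (opTrace (T ∘L B)) := by
  set b := (exists_hilbertBasis ℂ H).choose_spec.choose with hb
  have hB : ∀ n k, ⟪s n, B (b k)⟫_ℂ = ⟪ContinuousLinearMap.adjoint B (s n), b k⟫_ℂ := fun n k => by
    rw [ContinuousLinearMap.adjoint_inner_left]
  -- Absolute summability allows both orders of summation: over `k` first this gives `⟪s n, B (s
  -- n)⟫`, over `n` first the trace. It follows from `|ab| ≤ a² + b²` and Parseval, which bound the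
  -- row sums by a multiple of `‖s n‖ ^ 2`.
  have hsum : Summable fun z : ℕ × (exists_hilbertBasis ℂ H).choose =>
      ⟪s z.1, B (b z.2)⟫_ℂ * ⟪b z.2, s z.1⟫_ℂ := by
    have hle : ∀ n, ‖ContinuousLinearMap.adjoint B (s n)‖ ^ 2 ≤
        ‖ContinuousLinearMap.adjoint B‖ ^ 2 * ‖s n‖ ^ 2 := fun n => by
      rw [← mul_pow]
      exact pow_le_pow_left₀ (norm_nonneg _) (ContinuousLinearMap.le_opNorm _ _) 2
    have hfib : ∀ n, HasSum (fun k => ‖⟪b k, ContinuousLinearMap.adjoint B (s n)⟫_ℂ‖ ^ 2 +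
        ‖⟪b k, s n⟫_ℂ‖ ^ 2) (‖ContinuousLinearMap.adjoint B (s n)‖ ^ 2 + ‖s n‖ ^ 2) := fun n =>
      (b.hasSum_norm_sq _).add (b.hasSum_norm_sq _)
    have hdom : Summable fun z : ℕ × (exists_hilbertBasis ℂ H).choose =>
        ‖⟪b z.2, ContinuousLinearMap.adjoint B (s z.1)⟫_ℂ‖ ^ 2 + ‖⟪b z.2, s z.1⟫_ℂ‖ ^ 2 := by
      rw [summable_prod_of_nonneg fun z => by positivity]
      refine ⟨fun n => (hfib n).summable, ?_⟩
      simp_rw [fun n => (hfib n).tsum_eq]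
      exact (Summable.of_nonneg_of_le (fun n => by positivity) hle
        (h.hasSum_norm.summable.mul_left _)).add h.hasSum_norm.summable
    refine Summable.of_norm_bounded hdom fun z => ?_
    rw [norm_mul, hB, ← inner_conj_symm, RCLike.norm_conj]
    nlinarith [sq_nonneg (‖⟪b z.2, ContinuousLinearMap.adjoint B (s z.1)⟫_ℂ‖ -
      ‖⟪b z.2, s z.1⟫_ℂ‖), sq_nonneg ‖⟪b z.2, ContinuousLinearMap.adjoint B (s z.1)⟫_ℂ‖,
      sq_nonneg ‖⟪b z.2, s z.1⟫_ℂ‖]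
  have h1 : HasSum (fun n => ⟪s n, B (s n)⟫_ℂ)
      (∑' z : ℕ × (exists_hilbertBasis ℂ H).choose, ⟪s z.1, B (b z.2)⟫_ℂ * ⟪b z.2, s z.1⟫_ℂ) := by
    refine hsum.hasSum.prod_fiberwise fun n => ?_
    rw [← ContinuousLinearMap.adjoint_inner_left]
    simp only [hB]
    exact b.hasSum_inner_mul_inner _ _
  have h2 : HasSum (fun k => ⟪b k, T (B (b k))⟫_ℂ)
      (∑' z : ℕ × (exists_hilbertBasis ℂ H).choose, ⟪s z.1, B (b z.2)⟫_ℂ * ⟪b z.2, s z.1⟫_ℂ) := by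
    have hsw := (Equiv.hasSum_iff (Equiv.prodComm (exists_hilbertBasis ℂ H).choose ℕ)).2 hsum.hasSum
    refine hsw.prod_fiberwise fun k => ?_
    refine (h.hasSum_inner (b k) (B (b k))).congr_fun fun n => ?_
    simp [mul_comm]
  have h3 : opTrace (T ∘L B) = ∑' k, ⟪b k, T (B (b k))⟫_ℂ := rfl
  rw [h3, h2.tsum_eq]
  exact h1

end Mixtures

/-! ## Phase space observables -/

namespace Heis

open scoped ComplexOrder

variable {H : Type u} [NormedAddCommGroup H] [InnerProductSpace ℂ H]
  {ρ : Heis →* (H ≃ₗᵢ[ℂ] H)}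

theorem inner_apply_eq (g : Heis) (v w : H) : ⟪v, ρ g w⟫_ℂ = ⟪(ρ g)⁻¹ v, w⟫_ℂ := by
  rw [← LinearIsometryEquiv.inner_map_map (ρ g) ((ρ g)⁻¹ v) w]
  congr 1
  exact ((ρ g).apply_symm_apply v).symm

theorem inner_apply_left (g : Heis) (v w : H) : ⟪ρ g v, w⟫_ℂ = ⟪v, (ρ g)⁻¹ w⟫_ℂ := by
  rw [← inner_conj_symm, inner_apply_eq, inner_conj_symm]

theorem inner_conj_rep_apply (T : H →L[ℂ] H) (g : Heis) (v w : H) :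
    ⟪v, ρ g (T ((ρ g)⁻¹ w))⟫_ℂ = ⟪(ρ g)⁻¹ v, T ((ρ g)⁻¹ w)⟫_ℂ :=
  inner_apply_eq g v _

theorem IsWeakOrbitIntegral.unique {T : H →L[ℂ] H} {E : Set (ℝ × ℝ)} {B B' : H →L[ℂ] H}
    (h : IsWeakOrbitIntegral ρ T E B) (h' : IsWeakOrbitIntegral ρ T E B') : B = B' := by
  ext1 w
  refine ext_inner_left ℂ fun v => ?_
  rw [(h v w).2, (h' v w).2]

theorem IsWeakOrbitIntegral.phaseObservable_eq {T : H →L[ℂ] H} {E : Set (ℝ × ℝ)} {B : H →L[ℂ] H}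
    (h : IsWeakOrbitIntegral ρ T E B) : phaseObservable ρ T E = B := by
  have hex : ∃ B, IsWeakOrbitIntegral ρ T E B := ⟨B, h⟩
  rw [phaseObservable, dif_pos hex]
  exact hex.choose_spec.unique h

namespace IsSchrodingerType

/-- Cauchy–Schwarz and the norm identity. This bound justifies the interchanges of mixture sums and
integrals below. -/
theorem integral_norm_conj_mul_le (hρ : IsSchrodingerType ρ) (u v u' v' : H) :
    ∫ x, ‖conj (coeff ρ u v (sec x)) * coeff ρ u' v' (sec x)‖ ∂phaseMeasure ≤
      (‖u‖ * ‖v‖) * (‖u'‖ * ‖v'‖) := by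
  have key : ∀ a b : H, (∫ x, ‖coeff ρ a b (sec x)‖ ^ (2 : ℝ) ∂phaseMeasure) ^ (1 / 2 : ℝ) =
      ‖a‖ * ‖b‖ := fun a b => by
    rw [← hρ.norm_coeffLp, ← Real.sqrt_eq_rpow, ← Real.sqrt_sq (norm_nonneg (hρ.coeffLp a b)),
      Lp.norm_sq_eq_integral]
    congr 1
    refine integral_congr_ae ?_
    filter_upwards [hρ.coeffLp_coeFn a b] with x hx
    rw [hx]
    norm_num
  have := integral_mul_norm_le_Lp_mul_Lq (μ := phaseMeasure) (p := 2) (q := 2)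
    (f := coeff ρ u v ∘ sec) (g := coeff ρ u' v' ∘ sec) Real.HolderConjugate.two_two
    (by simpa using hρ.memLp_coeff u v) (by simpa using hρ.memLp_coeff u' v')
  simp only [Function.comp_apply, key] at this
  simpa [norm_mul] using this

theorem norm_coeffOperator_le (hρ : IsSchrodingerType ρ) (u : H) :
    ‖coeffOperator ρ u‖ ≤ ‖u‖ :=
  ContinuousLinearMap.opNorm_le_bound _ (norm_nonneg _) fun v => by
    rw [hρ.coeffOperator_apply, hρ.norm_coeffLp]

theorem norm_indicatorProj_le {X : Type*} [MeasurableSpace X] {ν : Measure X} {E : Set X}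
    (hE : MeasurableSet E) : ‖indicatorProj ν E‖ ≤ 1 := by
  rw [indicatorProj, dif_pos hE]
  exact LinearMap.mkContinuous_norm_le _ zero_le_one _

theorem hasSum_inner_orbit {T : H →L[ℂ] H} {s : ℕ → H} (hs : IsMixture T s) (v w : H)
    (x : ℝ × ℝ) :
    HasSum (fun n => conj (coeff ρ (s n) v (sec x)) * coeff ρ (s n) w (sec x))
      ⟪v, ρ (sec x) (T ((ρ (sec x))⁻¹ w))⟫_ℂ := by
  rw [inner_conj_rep_apply]
  refine (hs.hasSum_inner _ _).congr_fun fun n => ?_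
  rw [coeff, coeff, inner_conj_symm, inner_apply_eq, inner_apply_left]

theorem summable_integral_norm (hρ : IsSchrodingerType ρ) {T : H →L[ℂ] H} {s : ℕ → H}
    (hs : IsMixture T s) (v w : H) (E : Set (ℝ × ℝ)) :
    Summable fun n => ∫ x in E, ‖conj (coeff ρ (s n) v (sec x)) * coeff ρ (s n) w (sec x)‖
      ∂phaseMeasure := by
  refine Summable.of_nonneg_of_le (fun n => by positivity) (fun n => ?_)
    (hs.hasSum_norm.summable.mul_right (‖v‖ * ‖w‖))
  refine (setIntegral_le_integral (hρ.integrable_coeff_mul_coeff _ _ _ _).norm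
    (.of_forall fun x => norm_nonneg _)).trans ((hρ.integral_norm_conj_mul_le _ _ _ _).trans ?_)
  exact le_of_eq (by ring)

theorem integrableOn_orbit (hρ : IsSchrodingerType ρ) {T : H →L[ℂ] H} {s : ℕ → H}
    (hs : IsMixture T s) (v w : H) (E : Set (ℝ × ℝ)) :
    IntegrableOn (fun x => ⟪v, ρ (sec x) (T ((ρ (sec x))⁻¹ w))⟫_ℂ) E phaseMeasure := by
  have := integrable_tsum_of_summable_integral_norm
    (fun n => (hρ.integrable_coeff_mul_coeff (s n) v (s n) w).integrableOn)
    (hρ.summable_integral_norm hs v w E)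
  simp only [fun x => (hasSum_inner_orbit (ρ := ρ) hs v w x).tsum_eq] at this
  exact this

theorem hasSum_integral_orbit (hρ : IsSchrodingerType ρ) {T : H →L[ℂ] H} {s : ℕ → H}
    (hs : IsMixture T s) (v w : H) (E : Set (ℝ × ℝ)) :
    HasSum (fun n => ∫ x in E, conj (coeff ρ (s n) v (sec x)) * coeff ρ (s n) w (sec x)
      ∂phaseMeasure) (∫ x in E, ⟪v, ρ (sec x) (T ((ρ (sec x))⁻¹ w))⟫_ℂ ∂phaseMeasure) := by
  have := hasSum_integral_of_summable_integral_norm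
    (fun n => (hρ.integrable_coeff_mul_coeff (s n) v (s n) w).integrableOn)
    (hρ.summable_integral_norm hs v w E)
  simpa only [fun x => (hasSum_inner_orbit (ρ := ρ) hs v w x).tsum_eq] using this

/-- A positive `T` whose orbit has weak integrals, normalized on the whole space, defines a
normalized positive operator measure. -/
theorem _root_.Heis.isPOM_of_isWeakOrbitIntegral {T : H →L[ℂ] H} (hT : T.IsPositive)
    (h : ∀ E, MeasurableSet E → IsWeakOrbitIntegral ρ T E (phaseObservable ρ T E))
    (h1 : ∀ v w : H, ∫ x, ⟪v, ρ (sec x) (T ((ρ (sec x))⁻¹ w))⟫_ℂ ∂phaseMeasure = ⟪v, w⟫_ℂ) :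
    IsPOM (phaseObservable ρ T) where
  positive E hE := by
    have hnn : ∀ v, 0 ≤ ⟪v, phaseObservable ρ T E v⟫_ℂ := fun v => by
      rw [(h E hE v v).2]
      refine integral_nonneg fun x => ?_
      change (0 : ℂ) ≤ ⟪v, ρ (sec x) (T ((ρ (sec x))⁻¹ v))⟫_ℂ
      rw [inner_conj_rep_apply]
      exact hT.inner_nonneg_right _
    rw [ContinuousLinearMap.isPositive_iff_complex]
    intro v
    have h2 := hnn v
    rw [Complex.le_def] at h2
    rw [← inner_conj_symm]
    generalize ⟪v, phaseObservable ρ T E v⟫_ℂ = z at h2 ⊢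
    refine ⟨Complex.ext ?_ ?_, ?_⟩
    · simp
    · simpa using h2.2.symm
    · simpa using h2.1
  univ := by
    ext1 w
    refine ext_inner_left ℂ fun v => ?_
    rw [(h _ MeasurableSet.univ v w).2, Measure.restrict_univ, h1]
    rfl
  iUnion E hE hd v w := by
    simp_rw [(h _ (hE _) v w).2, (h _ (MeasurableSet.iUnion hE) v w).2]
    exact hasSum_integral_iUnion hE hd (h _ (MeasurableSet.iUnion hE) v w).1

variable [CompleteSpace H]

theorem inner_dilation (hρ : IsSchrodingerType ρ) {E : Set (ℝ × ℝ)} (hE : MeasurableSet E)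
    (u v w : H) :
    ⟪v, (ContinuousLinearMap.adjoint (coeffOperator ρ u) ∘L indicatorProj phaseMeasure E ∘L
      coeffOperator ρ u) w⟫_ℂ =
      ∫ x in E, conj (coeff ρ u v (sec x)) * coeff ρ u w (sec x) ∂phaseMeasure := by
  rw [ContinuousLinearMap.comp_apply, ContinuousLinearMap.adjoint_inner_right,
    ContinuousLinearMap.comp_apply, inner_indicatorProj hE]
  refine integral_congr_ae (ae_restrict_of_ae ?_)
  filter_upwards [hρ.isCoeffOperator u v, hρ.isCoeffOperator u w] with x h1 h2
  rw [h1, h2, RCLike.inner_apply, mul_comm]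
  rfl

/-- A bounded operator has to be exhibited: it is the series of the dilations `W̃* P̃(E) W̃` for the
vectors `s n`, which converges in norm because its terms are bounded by `‖s n‖ ^ 2`. -/
theorem isWeakOrbitIntegral (hρ : IsSchrodingerType ρ) {T : H →L[ℂ] H} {s : ℕ → H}
    (hs : IsMixture T s) {E : Set (ℝ × ℝ)} (hE : MeasurableSet E) :
    IsWeakOrbitIntegral ρ T E (phaseObservable ρ T E) := by
  have hsum : Summable fun n => ContinuousLinearMap.adjoint (coeffOperator ρ (s n)) ∘L
      indicatorProj phaseMeasure E ∘L coeffOperator ρ (s n) := by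
    refine Summable.of_norm_bounded hs.hasSum_norm.summable fun n => ?_
    have h1 := hρ.norm_coeffOperator_le (s n)
    have h2 := norm_indicatorProj_le (ν := phaseMeasure) hE
    calc _ ≤ ‖ContinuousLinearMap.adjoint (coeffOperator ρ (s n))‖ *
        (‖indicatorProj phaseMeasure E‖ * ‖coeffOperator ρ (s n)‖) :=
          (ContinuousLinearMap.opNorm_comp_le _ _).trans (by
            gcongr; exact ContinuousLinearMap.opNorm_comp_le _ _)
      _ ≤ ‖s n‖ * (1 * ‖s n‖) := by
          rw [LinearIsometryEquiv.norm_map]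
          gcongr
      _ = ‖s n‖ ^ 2 := by ring
  have hB : IsWeakOrbitIntegral ρ T E (∑' n, ContinuousLinearMap.adjoint (coeffOperator ρ (s n)) ∘L
      indicatorProj phaseMeasure E ∘L coeffOperator ρ (s n)) := by
    refine fun v w => ⟨hρ.integrableOn_orbit hs v w E, ?_⟩
    have h1 := (hsum.hasSum.mapL (ContinuousLinearMap.apply ℂ H w)).mapL (innerSL ℂ v)
    simp only [ContinuousLinearMap.apply_apply, innerSL_apply_apply, hρ.inner_dilation hE] at h1
    exact h1.unique (hρ.hasSum_integral_orbit hs v w E)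
  rwa [hB.phaseObservable_eq]

theorem isPOM_phaseObservable (hρ : IsSchrodingerType ρ) {T : H →L[ℂ] H} (hT : T.IsPositive)
    {s : ℕ → H} (hs : IsMixture T s) : IsPOM (phaseObservable ρ T) := by
  refine isPOM_of_isWeakOrbitIntegral hT (fun E hE => hρ.isWeakOrbitIntegral hs hE) fun v w => ?_
  have h1 := hρ.hasSum_integral_orbit hs v w Set.univ
  simp only [Measure.restrict_univ, hρ.integral_coeff_mul_coeff] at h1
  have h2 := (Complex.hasSum_ofReal.2 hs.hasSum_norm).mul_right ⟪v, w⟫_ℂ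
  rw [Complex.ofReal_one, one_mul] at h2
  refine h1.unique (h2.congr_fun fun n => ?_)
  rw [inner_self_eq_norm_sq_to_K]
  simp

theorem phaseObservable_rankOne (hρ : IsSchrodingerType ρ) (u : H) {E : Set (ℝ × ℝ)}
    (hE : MeasurableSet E) :
    phaseObservable ρ (InnerProductSpace.rankOne ℂ u u) E =
      ContinuousLinearMap.adjoint (coeffOperator ρ u) ∘L indicatorProj phaseMeasure E ∘L
        coeffOperator ρ u := by
  refine IsWeakOrbitIntegral.phaseObservable_eq fun v w => ?_
  have heq : ∀ x, ⟪v, ρ (sec x) (InnerProductSpace.rankOne ℂ u u ((ρ (sec x))⁻¹ w))⟫_ℂ =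
      conj (coeff ρ u v (sec x)) * coeff ρ u w (sec x) := fun x => by
    rw [InnerProductSpace.rankOne_apply, map_smul, inner_smul_right, coeff, coeff,
      inner_conj_symm, mul_comm, inner_apply_left]
  simp_rw [heq, hρ.inner_dilation hE]
  exact ⟨(hρ.integrable_coeff_mul_coeff u v u w).integrableOn, trivial⟩

theorem isMinimalNeumarkDilation (hρ : IsSchrodingerType ρ) (e : HilbertBasis ℕ ℂ H) {u : H}
    (hu : ‖u‖ = 1) :
    IsMinimalNeumarkDilation (phaseObservable ρ (InnerProductSpace.rankOne ℂ u u))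
      (indicatorProj phaseMeasure) (coeffOperator ρ u) where
  pom := isPOM_indicatorProj
  projection E hE := isStarProjection_indicatorProj hE
  isometry v := by rw [hρ.coeffOperator_apply, hρ.norm_coeffLp, hu, one_mul]
  dilation E hE := (hρ.phaseObservable_rankOne u hE).symm
  minimal := by
    rw [Submodule.topologicalClosure_eq_top_iff, Submodule.eq_bot_iff]
    intro f hf
    have hu0 : u ≠ 0 := fun h => by simp [h] at hu
    -- If `f` is orthogonal to all `P̃(E) W̃_u v`, then `conj c_{u,v} · f` has integral zero over
    -- every measurable set, hence vanishes, and the coefficients have no common zero.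
    refine Lp.eq_zero_iff_ae_eq_zero.2 (ae_eq_zero_of_coeff_mul (ρ := ρ) hu0 e fun v => ?_)
    have hint : Integrable (fun x => conj (coeff ρ u v (sec x)) * f x) phaseMeasure :=
      (hρ.memLp_coeff u v).star.integrable_mul (Lp.memLp f)
    refine hint.ae_eq_of_forall_setIntegral_eq _ _ (integrable_zero _ _ _) fun E hE _ => ?_
    have h1 := hf _ (Submodule.subset_span ⟨E, hE, v, rfl⟩)
    rw [← inner_conj_symm, inner_indicatorProj hE, ← integral_conj] at h1
    simp only [inner_conj_symm] at h1
    simp only [Pi.zero_apply, integral_zero]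
    rw [← h1]
    refine integral_congr_ae (ae_restrict_of_ae ?_)
    filter_upwards [hρ.isCoeffOperator u v] with x h1
    rw [h1, RCLike.inner_apply, mul_comm]
    rfl

end IsSchrodingerType

end Heis

/-! ## Informational completeness -/

namespace Heis

namespace IsSchrodingerType

variable {H : Type u} [NormedAddCommGroup H] [InnerProductSpace ℂ H]
  {ρ : Heis →* (H ≃ₗᵢ[ℂ] H)}

/-- The density `∑ |⟨ρ(s(x)) sᵢ, wⱼ⟩|²` of the measure `tr[W Q_T(·)]`. -/
def mixtureDensity (ρ : Heis →* (H ≃ₗᵢ[ℂ] H)) (s w : ℕ → H) (x : ℝ × ℝ) : ℂ :=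
  ∑' z : ℕ × ℕ, conj (coeff ρ (s z.1) (w z.2) (sec x)) * coeff ρ (s z.1) (w z.2) (sec x)

theorem summable_norm_sq_mul {T W : H →L[ℂ] H} {s w : ℕ → H} (hs : IsMixture T s)
    (hw : IsMixture W w) : Summable fun z : ℕ × ℕ => ‖s z.1‖ ^ 2 * ‖w z.2‖ ^ 2 :=
  hs.hasSum_norm.summable.mul_of_nonneg hw.hasSum_norm.summable (fun _ => by positivity)
    (fun _ => by positivity)

theorem summable_integral_norm_mixture (hρ : IsSchrodingerType ρ) {T W : H →L[ℂ] H} {s w : ℕ → H}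
    (hs : IsMixture T s) (hw : IsMixture W w) (E : Set (ℝ × ℝ)) :
    Summable fun z : ℕ × ℕ => ∫ x in E, ‖conj (coeff ρ (s z.1) (w z.2) (sec x)) *
      coeff ρ (s z.1) (w z.2) (sec x)‖ ∂phaseMeasure := by
  refine Summable.of_nonneg_of_le (fun n => by positivity) (fun n => ?_)
    (summable_norm_sq_mul hs hw)
  refine (setIntegral_le_integral (hρ.integrable_coeff_mul_coeff _ _ _ _).norm
    (.of_forall fun x => norm_nonneg _)).trans ((hρ.integral_norm_conj_mul_le _ _ _ _).trans ?_)
  exact le_of_eq (by ring)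

theorem integrable_mixtureDensity (hρ : IsSchrodingerType ρ) {T W : H →L[ℂ] H} {s w : ℕ → H}
    (hs : IsMixture T s) (hw : IsMixture W w) :
    Integrable (mixtureDensity ρ s w) phaseMeasure := by
  have := hρ.summable_integral_norm_mixture hs hw Set.univ
  rw [Measure.restrict_univ] at this
  exact integrable_tsum_of_summable_integral_norm
    (fun z => hρ.integrable_coeff_mul_coeff (s z.1) (w z.2) (s z.1) (w z.2)) this

/-- The Fourier transform of the density of `tr[W Q_T(·)]` is `conj tr[T ρ(a)] · tr[W ρ(a)]`. -/
theorem integral_exp_mul_mixtureDensity (hρ : IsSchrodingerType ρ) {T W : H →L[ℂ] H} {s w : ℕ → H}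
    (hs : IsMixture T s) (hw : IsMixture W w) (a : ℝ × ℝ) {τ ω : ℂ}
    (hτ : HasSum (fun n => ⟪s n, ρ (sec a) (s n)⟫_ℂ) τ)
    (hω : HasSum (fun n => ⟪w n, ρ (sec a) (w n)⟫_ℂ) ω) :
    ∫ x, Complex.exp (Complex.I * ((x.1 * a.2 - x.2 * a.1 : ℝ) : ℂ)) * mixtureDensity ρ s w x
      ∂phaseMeasure = conj τ * ω := by
  -- The exponential is absorbed by translating both vectors of the second coefficient; the
  -- orthogonality relations then split each integral into a factor from `T` and a factor from `W`.
  have hterm : ∀ (z : ℕ × ℕ) (x : ℝ × ℝ),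
      Complex.exp (Complex.I * ((x.1 * a.2 - x.2 * a.1 : ℝ) : ℂ)) *
        (conj (coeff ρ (s z.1) (w z.2) (sec x)) * coeff ρ (s z.1) (w z.2) (sec x)) =
      conj (coeff ρ (s z.1) (w z.2) (sec x)) *
        coeff ρ (ρ (sec a) (s z.1)) (ρ (sec a) (w z.2)) (sec x) := fun z x => by
    rw [hρ.coeff_apply_apply]; ring
  have h1 := hasSum_integral_of_summable_integral_norm (μ := phaseMeasure)
    (F := fun (z : ℕ × ℕ) x => conj (coeff ρ (s z.1) (w z.2) (sec x)) *
        coeff ρ (ρ (sec a) (s z.1)) (ρ (sec a) (w z.2)) (sec x))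
    (fun z => hρ.integrable_coeff_mul_coeff _ _ _ _)
    (by
      refine Summable.of_nonneg_of_le (fun n => by positivity) (fun n => ?_)
        (summable_norm_sq_mul hs hw)
      refine (hρ.integral_norm_conj_mul_le _ _ _ _).trans ?_
      simp only [LinearIsometryEquiv.norm_map]
      exact le_of_eq (by ring))
  have hint : ∀ x, ∑' z : ℕ × ℕ, conj (coeff ρ (s z.1) (w z.2) (sec x)) *
        coeff ρ (ρ (sec a) (s z.1)) (ρ (sec a) (w z.2)) (sec x) =
      Complex.exp (Complex.I * ((x.1 * a.2 - x.2 * a.1 : ℝ) : ℂ)) * mixtureDensity ρ s w x := by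
    intro x
    rw [mixtureDensity, ← tsum_mul_left]
    exact tsum_congr fun z => (hterm z x).symm
  simp_rw [hint] at h1
  have h2 : HasSum (fun z : ℕ × ℕ => ⟪ρ (sec a) (s z.1), s z.1⟫_ℂ * ⟪w z.2, ρ (sec a) (w z.2)⟫_ℂ)
      (∫ x, Complex.exp (Complex.I * ((x.1 * a.2 - x.2 * a.1 : ℝ) : ℂ)) * mixtureDensity ρ s w x
        ∂phaseMeasure) :=
    h1.congr_fun fun z => (hρ.integral_coeff_mul_coeff _ _ _ _).symm
  have hτ' : HasSum (fun n => ⟪ρ (sec a) (s n), s n⟫_ℂ) (conj τ) := by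
    refine (hτ.mapL (Complex.conjCLE : ℂ →L[ℝ] ℂ)).congr_fun fun n => ?_
    exact (inner_conj_symm _ _).symm
  have h3 := HasSum.mul hτ' hω h2.summable
  exact HasSum.unique h2 h3

variable [CompleteSpace H]

theorem opTrace_comp_phaseObservable (hρ : IsSchrodingerType ρ) {T W : H →L[ℂ] H} {s w : ℕ → H}
    (hs : IsMixture T s) (hw : IsMixture W w) {E : Set (ℝ × ℝ)} (hE : MeasurableSet E) :
    opTrace (W ∘L phaseObservable ρ T E) = ∫ x in E, mixtureDensity ρ s w x ∂phaseMeasure := by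
  have h1 := hasSum_integral_of_summable_integral_norm
    (fun z : ℕ × ℕ =>
      (hρ.integrable_coeff_mul_coeff (s z.1) (w z.2) (s z.1) (w z.2)).integrableOn (s := E))
    (hρ.summable_integral_norm_mixture hs hw E)
  -- The swap lets the vectors of `T` be summed first, producing `⟪w j, Q_T(E) (w j)⟫`; the
  -- remaining sum is the trace.
  have h2 := (Equiv.hasSum_iff (Equiv.prodComm ℕ ℕ)).2 h1
  have h3 := h2.prod_fiberwise fun j => by
    have := hρ.hasSum_integral_orbit hs (w j) (w j) E
    rw [← (hρ.isWeakOrbitIntegral hs hE (w j) (w j)).2] at this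
    exact this
  exact (hw.hasSum_opTrace (phaseObservable ρ T E)).unique h3

/-- A mixture is determined by the function `tr[W ρ(s(x))]`. -/
theorem inner_mixture_eq (hρ : IsSchrodingerType ρ) {W : H →L[ℂ] H} {w : ℕ → H}
    (hw : IsMixture W w) (u v : H) :
    ⟪u, W v⟫_ℂ = ∫ x, opTrace (W ∘L repOp ρ (sec x)) * coeff ρ u v (sec x) ∂phaseMeasure := by
  -- The orthogonality relations evaluate the `n`-th integral as `⟪u, w n⟫ * ⟪w n, v⟫`, the `n`-th
  -- term of `⟪u, W v⟫`.
  have h1 := hasSum_integral_of_summable_integral_norm (μ := phaseMeasure)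
    (F := fun n x => conj (coeff ρ (w n) (w n) (sec x)) * coeff ρ u v (sec x))
    (fun z => hρ.integrable_coeff_mul_coeff _ _ _ _)
    (by
      refine Summable.of_nonneg_of_le (fun n => by positivity) (fun n => ?_)
        (hw.hasSum_norm.summable.mul_right (‖u‖ * ‖v‖))
      refine (hρ.integral_norm_conj_mul_le _ _ _ _).trans ?_
      exact le_of_eq (by ring))
  have htr : ∀ x, ∑' n, conj (coeff ρ (w n) (w n) (sec x)) = opTrace (W ∘L repOp ρ (sec x)) := by
    intro x
    refine HasSum.tsum_eq ((hw.hasSum_opTrace (repOp ρ (sec x))).congr_fun fun n => ?_)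
    exact inner_conj_symm _ _
  simp only [hρ.integral_coeff_mul_coeff, tsum_mul_right, htr] at h1
  exact (hw.hasSum_inner u v).unique h1

theorem isInformationallyComplete (hρ : IsSchrodingerType ρ) (e : HilbertBasis ℕ ℂ H)
    {T : H →L[ℂ] H} (hT : IsState T) (hne : ∀ᵐ g ∂haar, opTrace (T ∘L repOp ρ g) ≠ 0) :
    IsInformationallyComplete (phaseObservable ρ T) := by
  intro W₁ W₂ hW₁ hW₂ heq
  obtain ⟨s, hs⟩ := hT.exists_isMixture e
  obtain ⟨w₁, hw₁⟩ := hW₁.exists_isMixture e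
  obtain ⟨w₂, hw₂⟩ := hW₂.exists_isMixture e
  have hdens : mixtureDensity ρ s w₁ =ᵐ[phaseMeasure] mixtureDensity ρ s w₂ := by
    refine (hρ.integrable_mixtureDensity hs hw₁).ae_eq_of_forall_setIntegral_eq _ _
      (hρ.integrable_mixtureDensity hs hw₂) fun E hE _ => ?_
    rw [← hρ.opTrace_comp_phaseObservable hs hw₁ hE, ← hρ.opTrace_comp_phaseObservable hs hw₂ hE,
      heq E hE]
  obtain ⟨t, ht⟩ := ae_sec_of_ae_haar hne
  -- The traces at `(t, x)` and at `s(x)` differ by the factor `e^{it}`.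
  have hne' : ∀ᵐ x ∂phaseMeasure, opTrace (T ∘L repOp ρ (sec x)) ≠ 0 := by
    filter_upwards [ht] with x hx h0
    refine hx ?_
    have h1 := (hs.hasSum_opTrace (repOp ρ (sec x))).mul_left (Complex.exp (Complex.I * t))
    rw [h0, mul_zero] at h1
    refine (hs.hasSum_opTrace (repOp ρ ⟨t, x.1, x.2⟩)).unique (h1.congr_fun fun n => ?_)
    change ⟪s n, ρ ⟨t, x.1, x.2⟩ (s n)⟫_ℂ = Complex.exp (Complex.I * t) * ⟪s n, ρ (sec x) (s n)⟫_ℂ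
    rw [hρ.apply_eq, inner_smul_right]
  have htr : ∀ᵐ x ∂phaseMeasure,
      opTrace (W₁ ∘L repOp ρ (sec x)) = opTrace (W₂ ∘L repOp ρ (sec x)) := by
    filter_upwards [hne'] with a ha
    have h1 := hρ.integral_exp_mul_mixtureDensity hs hw₁ a (hs.hasSum_opTrace (repOp ρ (sec a)))
      (hw₁.hasSum_opTrace (repOp ρ (sec a)))
    have h2 := hρ.integral_exp_mul_mixtureDensity hs hw₂ a (hs.hasSum_opTrace (repOp ρ (sec a)))
      (hw₂.hasSum_opTrace (repOp ρ (sec a)))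
    refine mul_left_cancel₀ ((map_ne_zero _).2 ha) (h1.symm.trans (Eq.trans ?_ h2))
    refine integral_congr_ae ?_
    filter_upwards [hdens] with x hx
    rw [hx]
  ext1 v
  refine ext_inner_left ℂ fun u => ?_
  rw [hρ.inner_mixture_eq hw₁, hρ.inner_mixture_eq hw₂]
  refine integral_congr_ae ?_
  filter_upwards [htr] with x hx
  rw [hx]

end IsSchrodingerType

end Heis

/-! ## Hermite functions -/

section HermiteFunctions

open Polynomial

/-- The function `p(x) e^{-x²/2}`. -/
def gaussPoly (p : ℂ[X]) (x : ℝ) : ℂ := p.eval (x : ℂ) * Complex.exp (-(x : ℂ) ^ 2 / 2)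

theorem continuous_gaussPoly (p : ℂ[X]) : Continuous (gaussPoly p) := by
  unfold gaussPoly
  fun_prop

theorem norm_exp_neg_sq_div_two (x : ℝ) :
    ‖Complex.exp (-(x : ℂ) ^ 2 / 2)‖ = Real.exp (-x ^ 2 / 2) := by
  have : (-(x : ℂ) ^ 2 / 2) = ((-x ^ 2 / 2 : ℝ) : ℂ) := by push_cast; ring
  rw [this, Complex.norm_exp_ofReal]

theorem exists_norm_gaussPoly_le (p : ℂ[X]) :
    ∃ C, 0 ≤ C ∧ ∀ x, ‖gaussPoly p x‖ ≤ C * Real.exp (-(1 / 4) * x ^ 2) := by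
  induction p using Polynomial.induction_on' with
  | add p q hp hq =>
    obtain ⟨C, hC, hp⟩ := hp
    obtain ⟨D, hD, hq⟩ := hq
    refine ⟨C + D, add_nonneg hC hD, fun x => ?_⟩
    have : gaussPoly (p + q) x = gaussPoly p x + gaussPoly q x := by
      simp [gaussPoly, add_mul]
    rw [this, add_mul]
    exact (norm_add_le _ _).trans (add_le_add (hp x) (hq x))
  | monomial n a =>
    -- From `|x| ^ n ≤ n! e^{|x|}` and `|x| - x²/2 ≤ 1 - x²/4`.
    refine ⟨‖a‖ * (n.factorial * Real.exp 1), by positivity, fun x => ?_⟩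
    rw [gaussPoly, eval_monomial, norm_mul, norm_mul, norm_pow, norm_exp_neg_sq_div_two,
      Complex.norm_real, Real.norm_eq_abs, mul_assoc, mul_assoc]
    refine mul_le_mul_of_nonneg_left ?_ (norm_nonneg a)
    have h1 : |x| ^ n ≤ n.factorial * Real.exp |x| := by
      have := Real.pow_div_factorial_le_exp |x| (abs_nonneg x) n
      rwa [div_le_iff₀' (by positivity)] at this
    refine (mul_le_mul_of_nonneg_right h1 (Real.exp_pos _).le).trans ?_
    rw [mul_assoc, mul_assoc, ← Real.exp_add, ← Real.exp_add]
    refine mul_le_mul_of_nonneg_left (Real.exp_le_exp.2 ?_) (by positivity)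
    nlinarith [sq_nonneg (|x| / 2 - 1), sq_abs x]

theorem memLp_exp_neg_mul_sq {b : ℝ} (hb : 0 < b) :
    MemLp (fun x : ℝ => Real.exp (-b * x ^ 2)) 2 volume := by
  rw [memLp_two_iff_integrable_sq (by fun_prop)]
  have := integrable_exp_neg_mul_sq (b := 2 * b) (by positivity)
  refine this.congr (.of_forall fun x => ?_)
  simp only [← Real.exp_nat_mul]
  congr 1
  push_cast
  ring

theorem memLp_gaussPoly (p : ℂ[X]) : MemLp (gaussPoly p) 2 volume := by
  obtain ⟨C, hC, h⟩ := exists_norm_gaussPoly_le p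
  refine ((memLp_exp_neg_mul_sq (b := 1 / 4) (by norm_num)).const_mul C).of_le
    (continuous_gaussPoly p).aestronglyMeasurable (.of_forall fun x => ?_)
  rw [Real.norm_of_nonneg (by positivity)]
  exact h x

/-- The functions `p(x) e^{-x²/2}` in `L²(ℝ)`. -/
def gaussPolyLp : ℂ[X] →ₗ[ℂ] Lp ℂ 2 (volume : Measure ℝ) where
  toFun p := (memLp_gaussPoly p).toLp
  map_add' p q := by
    rw [← MemLp.toLp_add]
    exact MemLp.toLp_congr _ _ (.of_forall fun x => by simp [gaussPoly, add_mul])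
  map_smul' c p := by
    rw [RingHom.id_apply, ← MemLp.toLp_const_smul]
    exact MemLp.toLp_congr _ _ (.of_forall fun x => by simp [gaussPoly, mul_assoc])

theorem gaussPolyLp_coeFn (p : ℂ[X]) : ⇑(gaussPolyLp p) =ᵐ[volume] gaussPoly p :=
  (memLp_gaussPoly p).coeFn_toLp

theorem hasDerivAt_gaussPoly (p : ℂ[X]) (x : ℝ) :
    HasDerivAt (gaussPoly p) (gaussPoly (derivative p - X * p) x) x := by
  have h1 : HasDerivAt (fun x : ℝ => p.eval (x : ℂ)) ((derivative p).eval (x : ℂ)) x :=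
    (p.hasDerivAt (x : ℂ)).comp_ofReal
  have h2 : HasDerivAt (fun z : ℂ => Complex.exp (-z ^ 2 / 2))
      (Complex.exp (-(x : ℂ) ^ 2 / 2) * -(x : ℂ)) (x : ℂ) := by
    have := (((hasDerivAt_id (x : ℂ)).pow 2).neg.div_const 2).cexp
    refine this.congr_deriv ?_
    simp
    ring_nf
  refine (h1.mul h2.comp_ofReal).congr_deriv ?_
  simp [gaussPoly]
  ring

theorem conj_gaussPoly (p : ℂ[X]) (x : ℝ) :
    conj (gaussPoly p x) = gaussPoly (p.map (starRingEnd ℂ)) x := by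
  have h : conj (p.eval (x : ℂ)) = (p.map (starRingEnd ℂ)).eval (x : ℂ) := by
    conv_rhs => rw [← Complex.conj_ofReal x, eval_map, eval₂_hom]
  rw [gaussPoly, map_mul, h, ← Complex.exp_conj, gaussPoly]
  simp [map_ofNat]

theorem inner_gaussPolyLp (p q : ℂ[X]) :
    ⟪gaussPolyLp p, gaussPolyLp q⟫_ℂ =
      ∫ x, gaussPoly (p.map (starRingEnd ℂ)) x * gaussPoly q x := by
  rw [L2.inner_def]
  refine integral_congr_ae ?_
  filter_upwards [gaussPolyLp_coeFn p, gaussPolyLp_coeFn q] with x h1 h2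
  rw [h1, h2, RCLike.inner_apply, conj_gaussPoly, mul_comm]

theorem integrable_gaussPoly_mul (p q : ℂ[X]) :
    Integrable (fun x => gaussPoly p x * gaussPoly q x) :=
  (memLp_gaussPoly p).integrable_mul (memLp_gaussPoly q)

/-! ### Ladder operators on polynomials -/

/-- The lowering operator on `p(x) e^{-x²/2}`. -/
def polyLower (p : ℂ[X]) : ℂ[X] := C (1 / (√2 : ℝ) : ℂ) * derivative p

/-- The raising operator on `p(x) e^{-x²/2}`. -/
def polyRaise (p : ℂ[X]) : ℂ[X] := C (1 / (√2 : ℝ) : ℂ) * (2 * X * p - derivative p)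

theorem one_div_sqrt_two_mul_self : (1 / (√2 : ℝ) : ℂ) * (1 / (√2 : ℝ) : ℂ) = 1 / 2 := by
  rw [div_mul_div_comm, ← Complex.ofReal_mul, Real.mul_self_sqrt (by norm_num)]
  norm_num

theorem polyLower_polyRaise (p : ℂ[X]) : polyLower (polyRaise p) = polyRaise (polyLower p) + p := by
  have h : C (1 / (√2 : ℝ) : ℂ) * C (1 / (√2 : ℝ) : ℂ) * 2 = (1 : ℂ[X]) := by
    rw [← C_mul, one_div_sqrt_two_mul_self, ← C_ofNat, ← C_mul, ← C_1]
    norm_num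
  simp only [polyLower, polyRaise, derivative_mul, derivative_C, map_sub, derivative_X,
    derivative_ofNat]
  linear_combination p * h

/-- Integration by parts: up to the factor `1 / √2`, the difference of the two integrands is the
derivative of a polynomial multiple of `e^{-x²}`, whose integral vanishes. -/
theorem inner_polyLower (p q : ℂ[X]) :
    ⟪gaussPolyLp (polyLower p), gaussPolyLp q⟫_ℂ = ⟪gaussPolyLp p, gaussPolyLp (polyRaise q)⟫_ℂ := by
  rw [inner_gaussPolyLp, inner_gaussPolyLp, ← sub_eq_zero,
    ← integral_sub (integrable_gaussPoly_mul _ _) (integrable_gaussPoly_mul _ _)]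
  set p' := p.map (starRingEnd ℂ) with hp'
  have h1 := integral_eq_zero_of_hasDerivAt_of_integrable
    (fun x => (hasDerivAt_gaussPoly p' x).mul (hasDerivAt_gaussPoly q x))
    ((integrable_gaussPoly_mul _ _).add (integrable_gaussPoly_mul _ _))
    (integrable_gaussPoly_mul p' q)
  have h2 := congrArg (fun z => (1 / (√2 : ℝ) : ℂ) * z) h1
  simp only [mul_zero] at h2
  rw [← integral_const_mul] at h2
  rw [← h2]
  refine integral_congr_ae (.of_forall fun x => ?_)
  have hc : (polyLower p).map (starRingEnd ℂ) = polyLower p' := by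
    simp [polyLower, derivative_map, hp']
  simp only [hc]
  simp only [gaussPoly, polyLower, polyRaise, eval_mul, eval_C, eval_sub, eval_X, eval_ofNat]
  ring

/-- The polynomials of the normalized Hermite functions. -/
def hermitePoly : ℕ → ℂ[X]
  | 0 => C ((Real.pi ^ (-(1 / 4) : ℝ) : ℝ) : ℂ)
  | n + 1 => C (1 / (√((n : ℝ) + 1) : ℝ) : ℂ) * polyRaise (hermitePoly n)

theorem ofReal_sqrt_succ_ne_zero (n : ℕ) : ((√((n : ℝ) + 1) : ℝ) : ℂ) ≠ 0 := by
  rw [Complex.ofReal_ne_zero]; positivity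

theorem ofReal_sqrt_mul_self (n : ℕ) :
    ((√((n : ℝ) + 1) : ℝ) : ℂ) * ((√((n : ℝ) + 1) : ℝ) : ℂ) = n + 1 := by
  rw [← Complex.ofReal_mul, Real.mul_self_sqrt (by positivity)]
  push_cast; rfl

theorem polyRaise_C_mul (c : ℂ) (p : ℂ[X]) : polyRaise (C c * p) = C c * polyRaise p := by
  simp only [polyRaise, derivative_mul, derivative_C]; ring

theorem polyLower_C_mul (c : ℂ) (p : ℂ[X]) : polyLower (C c * p) = C c * polyLower p := by
  simp only [polyLower, derivative_mul, derivative_C]; ring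

theorem polyRaise_hermitePoly (n : ℕ) :
    polyRaise (hermitePoly n) = C ((√((n : ℝ) + 1) : ℝ) : ℂ) * hermitePoly (n + 1) := by
  rw [hermitePoly, ← mul_assoc, ← C_mul, mul_one_div_cancel (ofReal_sqrt_succ_ne_zero n), C_1,
    one_mul]

theorem polyLower_hermitePoly_zero : polyLower (hermitePoly 0) = 0 := by
  simp [hermitePoly, polyLower]

theorem polyLower_hermitePoly_succ (n : ℕ) :
    polyLower (hermitePoly (n + 1)) = C ((√((n : ℝ) + 1) : ℝ) : ℂ) * hermitePoly n := by
  -- The number operator has eigenvalue `n`, by induction from the commutation relation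
  -- `polyLower_polyRaise`.
  have key : polyRaise (polyLower (hermitePoly n)) = C (n : ℂ) * hermitePoly n := by
    induction n with
    | zero => simp [polyLower_hermitePoly_zero, polyRaise]
    | succ m ih =>
      rw [hermitePoly, polyLower_C_mul, polyLower_polyRaise, ih, polyRaise_C_mul,
        show C (m : ℂ) * hermitePoly m + hermitePoly m = C ((m : ℂ) + 1) * hermitePoly m by
          rw [C_add, C_1]; ring,
        polyRaise_C_mul]
      push_cast
      ring
  rw [hermitePoly, polyLower_C_mul, polyLower_polyRaise, key,
    show C (n : ℂ) * hermitePoly n + hermitePoly n = C ((n : ℂ) + 1) * hermitePoly n by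
      rw [C_add, C_1]; ring, ← mul_assoc, ← C_mul, ← ofReal_sqrt_mul_self, ← mul_assoc,
    one_div_mul_cancel (ofReal_sqrt_succ_ne_zero n), one_mul]

theorem gaussPolyLp_C_mul (c : ℂ) (p : ℂ[X]) : gaussPolyLp (C c * p) = c • gaussPolyLp p := by
  rw [← smul_eq_C_mul, map_smul]

theorem norm_hermite_zero : ⟪gaussPolyLp (hermitePoly 0), gaussPolyLp (hermitePoly 0)⟫_ℂ = 1 := by
  rw [inner_gaussPolyLp]
  have h : ∀ x : ℝ, gaussPoly ((hermitePoly 0).map (starRingEnd ℂ)) x * gaussPoly (hermitePoly 0) x =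
      ((Real.pi ^ (-(1 / 2) : ℝ) * Real.exp (-1 * x ^ 2) : ℝ) : ℂ) := fun x => by
    have h1 : Real.pi ^ (-(1 / 2) : ℝ) = Real.pi ^ (-(1 / 4) : ℝ) * Real.pi ^ (-(1 / 4) : ℝ) := by
      rw [← Real.rpow_add Real.pi_pos]; norm_num
    have h2 : Complex.exp ((-1 * x ^ 2 : ℝ) : ℂ) =
        Complex.exp (-(x : ℂ) ^ 2 / 2) * Complex.exp (-(x : ℂ) ^ 2 / 2) := by
      rw [← Complex.exp_add]; congr 1; push_cast; ring
    rw [h1, Complex.ofReal_mul, Complex.ofReal_exp, h2]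
    simp only [gaussPoly, hermitePoly, map_C, eval_C, Complex.conj_ofReal]
    push_cast
    ring
  simp_rw [h]
  rw [integral_complex_ofReal, integral_const_mul, integral_gaussian, div_one, Real.sqrt_eq_rpow,
    ← Real.rpow_add Real.pi_pos]
  norm_num

/-- Moving the raising operator to the other side as a lowering operator lowers both indices by one,
down to the ground state, which lowering annihilates. -/
theorem orthonormal_hermite : Orthonormal ℂ fun n => gaussPolyLp (hermitePoly n) := by
  have hraise : ∀ n (f : Lp ℂ 2 (volume : Measure ℝ)), ⟪f, gaussPolyLp (hermitePoly (n + 1))⟫_ℂ =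
      (1 / (√((n : ℝ) + 1) : ℝ) : ℂ) * ⟪f, gaussPolyLp (polyRaise (hermitePoly n))⟫_ℂ := by
    intro n f
    rw [hermitePoly, gaussPolyLp_C_mul, inner_smul_right]
  have hzero : ∀ n, ⟪gaussPolyLp (hermitePoly 0), gaussPolyLp (hermitePoly (n + 1))⟫_ℂ = 0 := by
    intro n
    rw [hraise, ← inner_polyLower, polyLower_hermitePoly_zero, map_zero, inner_zero_left, mul_zero]
  have hsucc : ∀ m n, ⟪gaussPolyLp (hermitePoly (m + 1)), gaussPolyLp (hermitePoly (n + 1))⟫_ℂ =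
      (1 / (√((n : ℝ) + 1) : ℝ) : ℂ) * ((√((m : ℝ) + 1) : ℝ) *
        ⟪gaussPolyLp (hermitePoly m), gaussPolyLp (hermitePoly n)⟫_ℂ) := by
    intro m n
    rw [hraise, ← inner_polyLower, polyLower_hermitePoly_succ, gaussPolyLp_C_mul, inner_smul_left,
      Complex.conj_ofReal]
  rw [orthonormal_iff_ite]
  intro m
  induction m with
  | zero =>
    rintro (_ | n)
    · simpa using norm_hermite_zero
    · rw [hzero]; simp
  | succ m ih =>
    rintro (_ | n)
    · rw [← inner_conj_symm, hzero]; simp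
    · rw [hsucc, ih]
      by_cases h : m = n
      · subst h
        simp only [if_true, mul_one]
        exact one_div_mul_cancel (ofReal_sqrt_succ_ne_zero m)
      · simp [h]

theorem X_mul_eq (p : ℂ[X]) : X * p = C (1 / (√2 : ℝ) : ℂ) * (polyLower p + polyRaise p) := by
  have h : C (1 / (√2 : ℝ) : ℂ) * C (1 / (√2 : ℝ) : ℂ) * 2 = (1 : ℂ[X]) := by
    rw [← C_mul, one_div_sqrt_two_mul_self, ← C_ofNat, ← C_mul, ← C_1]
    norm_num
  simp only [polyLower, polyRaise]
  linear_combination -(X * p) * h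

/-- The span contains `1` and is stable under multiplication by `X`, a combination of the two ladder
operators. -/
theorem mem_span_hermitePoly (p : ℂ[X]) : p ∈ Submodule.span ℂ (Set.range hermitePoly) := by
  set S := Submodule.span ℂ (Set.range hermitePoly) with hS
  have hC : ∀ (c : ℂ) q, q ∈ S → C c * q ∈ S := fun c q hq => by
    rw [← smul_eq_C_mul]; exact S.smul_mem c hq
  have hH : ∀ n, hermitePoly n ∈ S := fun n => Submodule.subset_span ⟨n, rfl⟩
  have hX : ∀ q ∈ S, X * q ∈ S := by
    intro q hq
    induction hq using Submodule.span_induction with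
    | mem q hq =>
      obtain ⟨n, rfl⟩ := hq
      rw [X_mul_eq]
      refine hC _ _ (S.add_mem ?_ ?_)
      · cases n with
        | zero => rw [polyLower_hermitePoly_zero]; exact S.zero_mem
        | succ n => rw [polyLower_hermitePoly_succ]; exact hC _ _ (hH n)
      · rw [polyRaise_hermitePoly]; exact hC _ _ (hH _)
    | zero => rw [mul_zero]; exact S.zero_mem
    | add a b _ _ ha hb => rw [mul_add]; exact S.add_mem ha hb
    | smul c a _ ha => rw [mul_smul_comm]; exact S.smul_mem c ha
  have h1 : (1 : ℂ[X]) ∈ S := by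
    have h0 : ((Real.pi ^ (-(1 / 4) : ℝ) : ℝ) : ℂ) ≠ 0 := by
      rw [Complex.ofReal_ne_zero]; positivity
    have := hC (1 / ((Real.pi ^ (-(1 / 4) : ℝ) : ℝ) : ℂ)) _ (hH 0)
    rwa [hermitePoly, ← C_mul, one_div_mul_cancel h0, C_1] at this
  induction p using Polynomial.induction_on' with
  | add p q hp hq => exact S.add_mem hp hq
  | monomial n a =>
    have : ∀ n, (X : ℂ[X]) ^ n ∈ S := fun n => by
      induction n with
      | zero => simpa using h1
      | succ n ih => rw [pow_succ']; exact hX _ ih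
    rw [← C_mul_X_pow_eq_monomial]
    exact hC _ _ (this n)

/-! ### Completeness of the Hermite functions -/

/-- A function orthogonal to all `p(x) e^{-x²/2}` is orthogonal to all `e^{zx} e^{-x²/2}`. -/
theorem integral_exp_mul_eq_zero {f : Lp ℂ 2 (volume : Measure ℝ)}
    (hf : ∀ p, ⟪gaussPolyLp p, f⟫_ℂ = 0) (z : ℂ) :
    ∫ x : ℝ, Complex.exp (z * x) * Complex.exp (-(x : ℂ) ^ 2 / 2) * f x = 0 := by
  have hterm : ∀ n : ℕ, ∫ x : ℝ, (z * x) ^ n / n.factorial * Complex.exp (-(x : ℂ) ^ 2 / 2) * f x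
      = 0 := by
    intro n
    have h1 := congrArg (fun w => z ^ n / n.factorial * w) (hf (X ^ n))
    simp only [mul_zero] at h1
    rw [L2.inner_def, ← integral_const_mul] at h1
    rw [← h1]
    refine integral_congr_ae ?_
    filter_upwards [gaussPolyLp_coeFn (X ^ n)] with x hx
    rw [hx, RCLike.inner_apply, conj_gaussPoly, gaussPoly]
    simp only [Polynomial.map_pow, map_X, eval_pow, eval_X]
    ring
  have hexp : ∀ w : ℂ, HasSum (fun n : ℕ => w ^ n / n.factorial) (Complex.exp w) := fun w => by
    rw [Complex.exp_eq_exp_ℂ]; exact NormedSpace.expSeries_div_hasSum_exp w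
  have hrexp : ∀ w : ℝ, HasSum (fun n : ℕ => w ^ n / n.factorial) (Real.exp w) := fun w => by
    rw [Real.exp_eq_exp_ℝ]; exact NormedSpace.expSeries_div_hasSum_exp w
  have hbs : ∀ x : ℝ, HasSum (fun n : ℕ => (‖z‖ * |x|) ^ n / n.factorial *
      (Real.exp (-x ^ 2 / 2) * ‖f x‖)) (Real.exp (‖z‖ * |x|) * (Real.exp (-x ^ 2 / 2) * ‖f x‖)) :=
    fun x => (hrexp _).mul_right _
  have hfm := (Lp.aestronglyMeasurable f)
  have hsum := hasSum_integral_of_dominated_convergence (μ := (volume : Measure ℝ))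
    (F := fun (n : ℕ) (x : ℝ) => (z * x) ^ n / n.factorial * Complex.exp (-(x : ℂ) ^ 2 / 2) * f x)
    (f := fun x : ℝ => Complex.exp (z * x) * Complex.exp (-(x : ℂ) ^ 2 / 2) * f x)
    (fun (n : ℕ) (x : ℝ) => (‖z‖ * |x|) ^ n / n.factorial * (Real.exp (-x ^ 2 / 2) * ‖f x‖))
    (fun n => (by fun_prop : Continuous fun x : ℝ => (z * x) ^ n / n.factorial *
      Complex.exp (-(x : ℂ) ^ 2 / 2)).aestronglyMeasurable.mul hfm)
    (fun n => .of_forall fun x => by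
      rw [norm_mul, norm_mul, norm_div, norm_pow, norm_mul, norm_exp_neg_sq_div_two,
        Complex.norm_real, Real.norm_eq_abs, Complex.norm_natCast, mul_assoc])
    (.of_forall fun x => (hbs x).summable)
    (by
      simp_rw [fun x => (hbs x).tsum_eq]
      -- The exponential series is integrated termwise; its majorant is controlled by `‖z‖ |x| -
      -- x²/2 ≤ ‖z‖² - x²/4`.
      have hint := (((memLp_exp_neg_mul_sq (b := 1 / 4) (by norm_num)).integrable_mul
        (Lp.memLp f).norm)).const_mul (Real.exp (‖z‖ ^ 2))
      refine hint.mono' ?_ (.of_forall fun x => ?_)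
      · exact (by fun_prop : Continuous fun x : ℝ => Real.exp (‖z‖ * |x|)).aestronglyMeasurable.mul
          ((by fun_prop : Continuous fun x : ℝ =>
            Real.exp (-x ^ 2 / 2)).aestronglyMeasurable.mul hfm.norm)
      · rw [Real.norm_of_nonneg (by positivity), ← mul_assoc, ← Real.exp_add, Pi.mul_apply,
          ← mul_assoc, ← Real.exp_add]
        refine mul_le_mul_of_nonneg_right (Real.exp_le_exp.2 ?_) (norm_nonneg _)
        nlinarith [sq_nonneg (‖z‖ - |x| / 2), sq_abs x])
    (.of_forall fun x => ((hexp (z * x)).mul_right _).mul_right _)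
  simp only [hterm] at hsum
  exact hsum.unique hasSum_zero

theorem Heis.isSchrodingerType_schrodinger : Heis.IsSchrodingerType Heis.schrodinger :=
  .of_equivalent ⟨LinearIsometryEquiv.refl ℂ _, fun _ _ => rfl⟩

/-- At `s(q, p)` the coefficient of the Gaussian against `f` is a multiple of the integral in
`integral_exp_mul_eq_zero` at `z = -iq - p`. All these coefficients vanish, so the norm identity
yields `f = 0`. -/
theorem eq_zero_of_inner_gaussPolyLp {f : Lp ℂ 2 (volume : Measure ℝ)}
    (hf : ∀ p, ⟪gaussPolyLp p, f⟫_ℂ = 0) : f = 0 := by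
  have hS := Heis.isSchrodingerType_schrodinger
  have h0 : ∀ x, Heis.coeff Heis.schrodinger (gaussPolyLp 1) f (Heis.sec x) = 0 := by
    rintro ⟨q, p⟩
    have h1 := congrArg (fun w => Complex.exp (-(Complex.I * (q * p / 2)) - p ^ 2 / 2) * w)
      (integral_exp_mul_eq_zero hf (-(Complex.I * q) - p))
    simp only [mul_zero] at h1
    rw [← integral_const_mul] at h1
    rw [Heis.coeff, L2.inner_def, ← h1]
    refine integral_congr_ae ?_
    have hq := (measurePreserving_add_right (volume : Measure ℝ) p).quasiMeasurePreserving.ae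
      (gaussPolyLp_coeFn 1)
    filter_upwards [Heis.schrodinger_coeFn (Heis.sec (q, p)) (gaussPolyLp 1), hq] with x h2 h3
    have h3' : (gaussPolyLp 1 : ℝ → ℂ) (x + p) = gaussPoly 1 (x + p) := h3
    rw [h2, RCLike.inner_apply, Heis.sec, h3', map_mul, conj_gaussPoly, ← Complex.exp_conj,
      gaussPoly]
    simp only [Polynomial.map_one, eval_one, one_mul, map_mul, Complex.conj_I, Complex.conj_ofReal]
    rw [mul_comm, ← Complex.exp_add, ← mul_assoc, ← mul_assoc, ← Complex.exp_add, ← Complex.exp_add]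
    congr 2
    push_cast
    ring
  have h1 : hS.coeffLp (gaussPolyLp 1) f = 0 := by
    rw [Lp.eq_zero_iff_ae_eq_zero]
    filter_upwards [hS.coeffLp_coeFn (gaussPolyLp 1) f] with x hx
    rw [hx]
    exact h0 x
  have h2 := hS.norm_coeffLp (gaussPolyLp 1) f
  rw [h1, norm_zero, eq_comm, mul_eq_zero, norm_eq_zero, norm_eq_zero] at h2
  refine h2.resolve_left fun h3 => ?_
  have h4 := orthonormal_hermite.ne_zero 0
  refine h4 ?_
  rw [hermitePoly, ← mul_one (C _), gaussPolyLp_C_mul, h3, smul_zero]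

/-- The Hermite functions are an orthonormal basis of `L²(ℝ)`. -/
def hermiteBasis : HilbertBasis ℕ ℂ (Lp ℂ 2 (volume : Measure ℝ)) :=
  HilbertBasis.mkOfOrthogonalEqBot orthonormal_hermite (by
    rw [Submodule.eq_bot_iff]
    intro f hf
    refine eq_zero_of_inner_gaussPolyLp fun p => ?_
    have := mem_span_hermitePoly p
    induction this using Submodule.span_induction with
    | mem q hq =>
      obtain ⟨n, rfl⟩ := hq
      exact hf _ (Submodule.subset_span ⟨n, rfl⟩)
    | zero => rw [map_zero, inner_zero_left]
    | add a b _ _ ha hb => rw [map_add, inner_add_left, ha, hb, add_zero]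
    | smul c a _ ha => rw [map_smul, inner_smul_left, ha, mul_zero])

theorem hermiteBasis_apply (n : ℕ) : hermiteBasis n = gaussPolyLp (hermitePoly n) := by
  simp [hermiteBasis]

end HermiteFunctions

/-! ## Number states -/

section NumberRepresentation

open Polynomial Topology Filter

/-! ### Derivatives along one-parameter subgroups -/

/-- The ray `r ↦ (rt, rq, rp)` of `H¹`. -/
def Heis.ray (g : Heis) (r : ℝ) : Heis := ⟨r * g.t, r * g.q, r * g.p⟩

theorem Heis.ray_add (g : Heis) (r s : ℝ) : g.ray (r + s) = g.ray r * g.ray s := by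
  ext <;> simp [Heis.ray] <;> ring

theorem Heis.ray_one (g : Heis) : g.ray 1 = g := by
  ext <;> simp [Heis.ray]

theorem Heis.continuous_ray (g : Heis) : Continuous g.ray :=
  continuous_mk (by fun_prop) (by fun_prop) (by fun_prop)

/-- The polynomial of the image of `r(x) e^{-x²/2}` under `i(t + qx) + p d/dx`. -/
def rayDerivPoly (g : Heis) (r : ℂ[X]) : ℂ[X] :=
  C Complex.I * (C (g.t : ℂ) * r + C (g.q : ℂ) * (X * r)) + C (g.p : ℂ) * (derivative r - X * r)

/-- The function `(π(st, sq, sp) φ)(x)` for `φ(x) = r(x) e^{-x²/2}`. -/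
def rayOrbit (g : Heis) (r : ℂ[X]) (s x : ℝ) : ℂ :=
  Complex.exp (Complex.I * ((s * g.t + s * g.q * x + s * g.q * (s * g.p) / 2 : ℝ) : ℂ)) *
    gaussPoly r (x + s * g.p)

/-- The derivative is again an orbit function, so the Gaussian bounds for orbits also control
difference quotients. -/
theorem hasDerivAt_rayOrbit (g : Heis) (r : ℂ[X]) (s x : ℝ) :
    HasDerivAt (fun s => rayOrbit g r s x) (rayOrbit g (rayDerivPoly g r) s x) s := by
  have h0 : HasDerivAt (fun s : ℝ => s * g.t + s * g.q * x + s * g.q * (s * g.p) / 2)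
      (g.t + g.q * x + s * g.q * g.p) s := by
    have h := (((hasDerivAt_id s).mul_const g.t).add (((hasDerivAt_id s).mul_const g.q).mul_const x)).add
      ((((hasDerivAt_id s).mul_const g.q).mul ((hasDerivAt_id s).mul_const g.p)).div_const 2)
    refine h.congr_deriv ?_
    simp only [id]
    ring
  have h1 := (h0.ofReal_comp.const_mul Complex.I).cexp
  have h2 : HasDerivAt (fun s : ℝ => x + s * g.p) g.p s := by
    simpa using ((hasDerivAt_id s).mul_const g.p).const_add x
  have h3 := (hasDerivAt_gaussPoly r (x + s * g.p)).scomp s h2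
  refine (h1.mul h3).congr_deriv ?_
  simp only [rayOrbit, rayDerivPoly, gaussPoly, Function.comp_apply, Complex.real_smul, eval_add,
    eval_mul, eval_sub, eval_C, eval_X]
  push_cast
  ring

theorem norm_rayOrbit (g : Heis) (r : ℂ[X]) (s x : ℝ) :
    ‖rayOrbit g r s x‖ = ‖gaussPoly r (x + s * g.p)‖ := by
  rw [rayOrbit, norm_mul, Heis.norm_exp_I_mul_ofReal, one_mul]

theorem exists_norm_rayOrbit_le (g : Heis) (r : ℂ[X]) :
    ∃ D, 0 ≤ D ∧ ∀ s ∈ Set.Icc (-1 : ℝ) 1, ∀ x,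
      ‖rayOrbit g r s x‖ ≤ D * Real.exp (-(1 / 8) * x ^ 2) := by
  obtain ⟨C, hC, h⟩ := exists_norm_gaussPoly_le r
  -- For `|s| ≤ 1`, `-(x + sp)²/4 ≤ p²/4 - x²/8`; the difference is controlled by the square `(x +
  -- 2sp)²`.
  refine ⟨C * Real.exp (g.p ^ 2 / 4), by positivity, fun s hs x => ?_⟩
  rw [norm_rayOrbit, mul_assoc, ← Real.exp_add]
  refine (h _).trans (mul_le_mul_of_nonneg_left (Real.exp_le_exp.2 ?_) hC)
  have h1 : (s * g.p) ^ 2 ≤ g.p ^ 2 := by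
    rw [mul_pow]
    have : s ^ 2 ≤ 1 := by nlinarith [hs.1, hs.2]
    nlinarith [sq_nonneg g.p]
  nlinarith [sq_nonneg (x + 2 * (s * g.p))]

theorem norm_rayOrbit_sub_le (g : Heis) (r : ℂ[X]) {D : ℝ}
    (hb : ∀ s ∈ Set.Icc (-1 : ℝ) 1, ∀ x,
      ‖rayOrbit g (rayDerivPoly g r) s x‖ ≤ D * Real.exp (-(1 / 8) * x ^ 2))
    {s : ℝ} (hs : s ∈ Set.Icc (-1 : ℝ) 1) (x : ℝ) :
    ‖rayOrbit g r s x - rayOrbit g r 0 x‖ ≤ D * Real.exp (-(1 / 8) * x ^ 2) * ‖s‖ := by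
  have h0 : (0 : ℝ) ∈ Set.Icc (-1 : ℝ) 1 := ⟨by norm_num, by norm_num⟩
  have h := Convex.norm_image_sub_le_of_norm_hasDerivWithin_le (𝕜 := ℝ)
    (f := fun s => rayOrbit g r s x) (f' := fun s => rayOrbit g (rayDerivPoly g r) s x)
    (C := D * Real.exp (-(1 / 8) * x ^ 2))
    (fun s _ => (hasDerivAt_rayOrbit g r s x).hasDerivWithinAt) (fun s hs => hb s hs x)
    (convex_Icc (-1 : ℝ) 1) h0 hs
  rwa [sub_zero] at h

theorem schrodinger_ray_coeFn (g : Heis) (r : ℂ[X]) (s : ℝ) :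
    ⇑(Heis.schrodinger (g.ray s) (gaussPolyLp r)) =ᵐ[volume] rayOrbit g r s := by
  have hq := (measurePreserving_add_right (volume : Measure ℝ)
    (s * g.p)).quasiMeasurePreserving.ae (gaussPolyLp_coeFn r)
  filter_upwards [Heis.schrodinger_coeFn (g.ray s) (gaussPolyLp r), hq] with x h1 h2
  have h2' : (gaussPolyLp r : ℝ → ℂ) (x + s * g.p) = gaussPoly r (x + s * g.p) := h2
  rw [h1]
  simp only [Heis.ray, rayOrbit, h2']

theorem rayOrbit_zero (g : Heis) (r : ℂ[X]) (x : ℝ) : rayOrbit g r 0 x = gaussPoly r x := by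
  simp [rayOrbit]

theorem continuous_rayOrbit (g : Heis) (r : ℂ[X]) (s : ℝ) : Continuous (rayOrbit g r s) := by
  have := continuous_gaussPoly r
  unfold rayOrbit
  fun_prop

/-- The polynomial multiples of the Gaussian are differentiable vectors. -/
theorem hasDerivAt_schrodinger_ray (g : Heis) (r : ℂ[X]) :
    HasDerivAt (fun s => Heis.schrodinger (g.ray s) (gaussPolyLp r))
      (gaussPolyLp (rayDerivPoly g r)) 0 := by
  rw [hasDerivAt_iff_tendsto_slope_zero, tendsto_iff_norm_sub_tendsto_zero]
  simp only [zero_add]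
  have hsq : ∀ s : ℝ, ‖s⁻¹ • (Heis.schrodinger (g.ray s) (gaussPolyLp r) -
      Heis.schrodinger (g.ray 0) (gaussPolyLp r)) - gaussPolyLp (rayDerivPoly g r)‖ =
      √(∫ x, ‖s⁻¹ • (rayOrbit g r s x - rayOrbit g r 0 x) -
        rayOrbit g (rayDerivPoly g r) 0 x‖ ^ 2) := by
    intro s
    rw [← Real.sqrt_sq (norm_nonneg _), Lp.norm_sq_eq_integral]
    congr 1
    refine integral_congr_ae ?_
    filter_upwards [schrodinger_ray_coeFn g r s, schrodinger_ray_coeFn g r 0,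
      gaussPolyLp_coeFn (rayDerivPoly g r),
      Lp.coeFn_sub (s⁻¹ • (Heis.schrodinger (g.ray s) (gaussPolyLp r) -
        Heis.schrodinger (g.ray 0) (gaussPolyLp r))) (gaussPolyLp (rayDerivPoly g r)),
      Lp.coeFn_smul s⁻¹ (Heis.schrodinger (g.ray s) (gaussPolyLp r) -
        Heis.schrodinger (g.ray 0) (gaussPolyLp r)),
      Lp.coeFn_sub (Heis.schrodinger (g.ray s) (gaussPolyLp r))
        (Heis.schrodinger (g.ray 0) (gaussPolyLp r))] with x h1 h2 h3 h4 h5 h6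
    rw [h4, Pi.sub_apply, h5, Pi.smul_apply, h6, Pi.sub_apply, h1, h2, h3, rayOrbit_zero g
      (rayDerivPoly g r)]
  simp_rw [hsq]
  suffices h : Tendsto (fun s : ℝ => ∫ x, ‖s⁻¹ • (rayOrbit g r s x - rayOrbit g r 0 x) -
      rayOrbit g (rayDerivPoly g r) 0 x‖ ^ 2) (𝓝[≠] 0) (𝓝 (∫ _ : ℝ, (0 : ℝ))) by
    rw [integral_zero] at h
    have h' := (Real.continuous_sqrt.tendsto 0).comp h
    rwa [Real.sqrt_zero] at h'
  obtain ⟨D, hD, hb⟩ := exists_norm_rayOrbit_le g (rayDerivPoly g r)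
  -- By the mean value inequality the difference quotient and its limit are each at most `D
  -- e^{-x²/8}`, whence the factor `4 * D ^ 2`.
  refine tendsto_integral_filter_of_dominated_convergence
    (fun x => 4 * D ^ 2 * (Real.exp (-(1 / 8) * x ^ 2)) ^ 2) ?_ ?_ ?_ ?_
  · exact .of_forall fun s => ((((continuous_rayOrbit g r s).sub
      (continuous_rayOrbit g r 0)).const_smul s⁻¹).sub
        (continuous_rayOrbit g _ 0)).norm.pow 2 |>.aestronglyMeasurable
  · have hev : Set.Icc (-1 : ℝ) 1 ∈ 𝓝[≠] (0 : ℝ) :=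
      mem_nhdsWithin_of_mem_nhds (Icc_mem_nhds (by norm_num) (by norm_num))
    filter_upwards [hev, self_mem_nhdsWithin] with s hs hs0
    refine .of_forall fun x => ?_
    rw [Real.norm_of_nonneg (by positivity)]
    have hmv := norm_rayOrbit_sub_le g r hb hs x
    have h1 : ‖s⁻¹ • (rayOrbit g r s x - rayOrbit g r 0 x)‖ ≤ D * Real.exp (-(1 / 8) * x ^ 2) := by
      rw [norm_smul, norm_inv, inv_mul_le_iff₀ (norm_pos_iff.2 hs0), mul_comm]
      exact hmv
    have h2 := hb 0 ⟨by norm_num, by norm_num⟩ x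
    refine (pow_le_pow_left₀ (norm_nonneg _)
      ((norm_sub_le _ _).trans (add_le_add h1 h2)) 2).trans (le_of_eq ?_)
    ring
  · exact ((memLp_exp_neg_mul_sq (b := 1 / 8) (by norm_num)).integrable_sq).const_mul _
  · refine .of_forall fun x => ?_
    have h1 := (hasDerivAt_rayOrbit g r 0 x).tendsto_slope_zero
    simp only [zero_add] at h1
    have h2 := (tendsto_iff_norm_sub_tendsto_zero.1 h1).pow 2
    simpa using h2

variable {H : Type*} [NormedAddCommGroup H] [InnerProductSpace ℂ H]

/-- The generator of a one-parameter unitary group is closed. -/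
theorem hasDerivAt_zero_of_tendsto {U : ℝ → H ≃ₗᵢ[ℂ] H} (hU : ∀ r s, U (r + s) = U r * U s)
    {v : ℕ → H} {w : ℕ → H} {v₀ w₀ : H} (hd : ∀ n, HasDerivAt (fun r => U r (v n)) (w n) 0)
    (hv : Tendsto v atTop (𝓝 v₀)) (hw : Tendsto w atTop (𝓝 w₀)) :
    HasDerivAt (fun r => U r v₀) w₀ 0 := by
  -- The group law carries differentiability from `0` to every `r`. As `U r` is isometric, the
  -- derivatives converge uniformly in `r`, so the limit can be differentiated.
  have hd' : ∀ n r, HasDerivAt (fun r => U r (v n)) (U r (w n)) r := by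
    intro n r
    have h1 : HasDerivAt (fun s => U (s - r) (v n)) (w n) r := by
      have := (hd n)
      rw [← sub_self r] at this
      exact this.comp_sub_const r r
    have h2 := ((U r).toContinuousLinearEquiv : H →L[ℂ] H).restrictScalars ℝ |>.hasFDerivAt
      |>.comp_hasDerivAt r h1
    refine h2.congr_of_eventuallyEq (.of_forall fun s => ?_)
    have h3 : U s = U r * U (s - r) := by rw [← hU]; congr 1; ring
    change U s (v n) = U r (U (s - r) (v n))
    rw [h3]
    rfl
  have hu : TendstoUniformly (fun n r => U r (w n)) (fun r => U r w₀) atTop := by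
    rw [Metric.tendstoUniformly_iff]
    intro ε hε
    filter_upwards [Metric.tendsto_nhds.1 hw ε hε] with n hn r
    rw [LinearIsometryEquiv.dist_map, dist_comm]
    exact hn
  have h1 := hasDerivAt_of_tendstoUniformly hu (.of_forall fun n r => hd' n r)
    (fun r => ((U r).continuous.tendsto v₀).comp hv) 0
  have hU0 : U 0 = 1 := by
    have := hU 0 0
    rw [add_zero] at this
    exact (left_eq_mul.1 this)
  rw [hU0] at h1
  exact h1

variable [CompleteSpace H] (e : HilbertBasis ℕ ℂ H)

theorem HilbertBasis.summable_smul {e : HilbertBasis ℕ ℂ H} {c : ℕ → ℂ}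
    (hc : Summable fun n => ‖c n‖ ^ 2) : Summable fun n => c n • e n := by
  have := (e.orthonormal.orthogonalFamily.summable_iff_norm_sq_summable c).2 hc
  simpa using this

/-- Rewrites the operator as a series over the expansion of `v`, as closedness of the generator
requires. At `n = 0` the truncated index `n - 1` is harmless, as the coefficient is `√0`. -/
theorem hasSum_lowering {v : H} (hv : v ∈ ladderDomain e) :
    HasSum (fun n : ℕ => ⟪e n, v⟫_ℂ • (((√(n : ℝ) : ℝ) : ℂ) • e (n - 1))) (lowering e v) := by
  have h1 : Summable fun n : ℕ => (((√((n : ℝ) + 1) : ℝ) : ℂ) * ⟪e (n + 1), v⟫_ℂ) • e n := by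
    refine HilbertBasis.summable_smul ?_
    have := (summable_nat_add_iff 1).2 hv
    refine this.congr fun n => ?_
    rw [norm_mul, mul_pow, Complex.norm_real, Real.norm_of_nonneg (Real.sqrt_nonneg _),
      Real.sq_sqrt (by positivity)]
    push_cast
    rfl
  rw [← hasSum_nat_add_iff' 1]
  simp only [Finset.range_one, Finset.sum_singleton, CharP.cast_eq_zero, Real.sqrt_zero,
    Complex.ofReal_zero, zero_smul, smul_zero, sub_zero]
  refine h1.hasSum.congr_fun fun n => ?_
  rw [smul_smul, mul_comm, Nat.add_sub_cancel, Nat.cast_add_one]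

theorem hasSum_raising {v : H} (hv : v ∈ ladderDomain e) :
    HasSum (fun n : ℕ => ⟪e n, v⟫_ℂ • (((√((n : ℝ) + 1) : ℝ) : ℂ) • e (n + 1))) (raising e v) := by
  have h1 : Summable fun n : ℕ => (((√((n : ℝ) + 1) : ℝ) : ℂ) * ⟪e n, v⟫_ℂ) • e (n + 1) := by
    have h2 : Summable fun n : ℕ => (((√(n : ℝ) : ℝ) : ℂ) * ⟪e (n - 1), v⟫_ℂ) • e n := by
      refine HilbertBasis.summable_smul ?_
      rw [← summable_nat_add_iff 1]
      refine (Summable.add hv (e.hasSum_norm_sq v).summable).congr fun n => ?_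
      rw [norm_mul, mul_pow, Complex.norm_real, Real.norm_of_nonneg (Real.sqrt_nonneg _),
        Real.sq_sqrt (by positivity)]
      push_cast
      simp [add_mul]
    have := (summable_nat_add_iff 1).2 h2
    simpa using this
  refine h1.hasSum.congr_fun fun n => ?_
  rw [smul_smul, mul_comm]

/-- A representation whose derivatives on the number states are given by the ladder operators is
`e^{i(t + qQ + pP)}`. -/
theorem isNumberRep_of_hasDerivAt {ρ : Heis →* (H ≃ₗᵢ[ℂ] H)} (hρ : IsStronglyContinuous ρ)
    (h : ∀ (g : Heis) (n : ℕ), HasDerivAt (fun r => ρ (g.ray r) (e n))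
      (Complex.I • ((g.t : ℂ) • e n +
        (g.q : ℂ) • (1 / ((√2 : ℝ) : ℂ)) • (((√(n : ℝ) : ℝ) : ℂ) • e (n - 1) +
          ((√((n : ℝ) + 1) : ℝ) : ℂ) • e (n + 1)) +
        (g.p : ℂ) • (1 / (((√2 : ℝ) : ℂ) * Complex.I)) • (((√(n : ℝ) : ℝ) : ℂ) • e (n - 1) -
          ((√((n : ℝ) + 1) : ℝ) : ℂ) • e (n + 1)))) 0) :
    IsNumberRep e ρ := by
  intro g
  refine ⟨fun r => ρ (g.ray r), fun r s => by simp only [g.ray_add, map_mul],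
    fun v => (hρ v).comp g.continuous_ray, fun v hv => ?_, by simp only [g.ray_one]⟩
  have hid : HasSum (fun n : ℕ => ⟪e n, v⟫_ℂ • e n) v :=
    (e.hasSum_repr v).congr_fun fun n => by rw [e.repr_apply_apply]
  have hsum := ((((hid.const_smul (g.t : ℂ)).add ((((hasSum_lowering e hv).add
    (hasSum_raising e hv)).const_smul (1 / ((√2 : ℝ) : ℂ))).const_smul (g.q : ℂ))).add
    ((((hasSum_lowering e hv).sub (hasSum_raising e hv)).const_smul
      (1 / (((√2 : ℝ) : ℂ) * Complex.I))).const_smul (g.p : ℂ))).const_smul Complex.I).tendsto_sum_nat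
  -- The partial sums of `v` converge together with their derivatives: the domain condition makes
  -- both ladder series converge.
  refine hasDerivAt_zero_of_tendsto (U := fun r => ρ (g.ray r))
    (fun r s => by simp only [g.ray_add, map_mul]) (fun N => ?_) hid.tendsto_sum_nat hsum
  simp only [map_sum, map_smul]
  refine HasDerivAt.fun_sum fun n _ => ?_
  refine ((h g n).const_smul ⟪e n, v⟫_ℂ).congr_deriv ?_
  module

/-- The Schrödinger representation is transported by `e n ↦` the `n`-th Hermite function. There `x =
(a + a*) / √2` and `d/dx = (a - a*) / √2`, so the generator `i(t + qx) + p d/dx` becomes `i(t + qQ +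
pP)`. -/
theorem exists_isNumberRep : ∃ ρ : Heis →* (H ≃ₗᵢ[ℂ] H),
    IsNumberRep e ρ ∧ UnitarilyEquivalent ρ Heis.schrodinger := by
  let V : H ≃ₗᵢ[ℂ] Lp ℂ 2 (volume : Measure ℝ) := e.repr.trans hermiteBasis.repr.symm
  have hVe : ∀ n, V (e n) = gaussPolyLp (hermitePoly n) := fun n => by
    rw [← hermiteBasis_apply]
    change hermiteBasis.repr.symm (e.repr (e n)) = _
    rw [e.repr_self, HilbertBasis.repr_symm_single]
  have hVs : ∀ n, V.symm (gaussPolyLp (hermitePoly n)) = e n := fun n => by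
    rw [← hVe, LinearIsometryEquiv.symm_apply_apply]
  let ρ : Heis →* (H ≃ₗᵢ[ℂ] H) :=
    { toFun := fun g => (V.trans (Heis.schrodinger g)).trans V.symm
      map_one' := by ext v; simp
      map_mul' := fun a b => by ext v; simp }
  have hρ : ∀ g v, ρ g v = V.symm (Heis.schrodinger g (V v)) := fun _ _ => rfl
  have heq : UnitarilyEquivalent ρ Heis.schrodinger := ⟨V, fun g v => by simp [hρ]⟩
  refine ⟨ρ, isNumberRep_of_hasDerivAt e (Heis.IsSchrodingerType.of_equivalent heq).continuous
    fun g n => ?_, heq⟩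
  have h1 := (V.symm.toContinuousLinearEquiv : _ →L[ℂ] H).restrictScalars ℝ |>.hasFDerivAt
    |>.comp_hasDerivAt 0 (hasDerivAt_schrodinger_ray g (hermitePoly n))
  have hfun : (fun r => ρ (g.ray r) (e n)) = (fun r => V.symm (Heis.schrodinger (g.ray r)
      (gaussPolyLp (hermitePoly n)))) := by
    funext r; rw [hρ, hVe]
  rw [hfun]
  refine h1.congr_deriv ?_
  change V.symm (gaussPolyLp (rayDerivPoly g (hermitePoly n))) = _
  have hlow : gaussPolyLp (polyLower (hermitePoly n)) =
      ((√(n : ℝ) : ℝ) : ℂ) • gaussPolyLp (hermitePoly (n - 1)) := by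
    cases n with
    | zero => rw [polyLower_hermitePoly_zero]; simp
    | succ n => rw [polyLower_hermitePoly_succ, gaussPolyLp_C_mul]; simp
  have hraise : gaussPolyLp (polyRaise (hermitePoly n)) =
      ((√((n : ℝ) + 1) : ℝ) : ℂ) • gaussPolyLp (hermitePoly (n + 1)) := by
    rw [polyRaise_hermitePoly, gaussPolyLp_C_mul]
  have hder : derivative (hermitePoly n) - X * hermitePoly n =
      C (1 / (√2 : ℝ) : ℂ) * (polyLower (hermitePoly n) - polyRaise (hermitePoly n)) := by
    have h : C (1 / (√2 : ℝ) : ℂ) * C (1 / (√2 : ℝ) : ℂ) * 2 = (1 : ℂ[X]) := by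
      rw [← C_mul, one_div_sqrt_two_mul_self, ← C_ofNat, ← C_mul, ← C_1]
      norm_num
    simp only [polyLower, polyRaise]
    linear_combination -(derivative (hermitePoly n) - X * hermitePoly n) * h
  have hI : (1 / (((√2 : ℝ) : ℂ) * Complex.I)) = -Complex.I * (1 / ((√2 : ℝ) : ℂ)) := by
    rw [one_div, mul_inv, Complex.inv_I, one_div]; ring
  rw [rayDerivPoly, hder, X_mul_eq]
  simp only [map_add, map_sub, gaussPolyLp_C_mul, hlow, hraise, map_smul, hVs, hI]
  match_scalars <;> ring_nf <;> simp [Complex.I_sq] <;> ring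

end NumberRepresentation

end

/-! ### The main theorem -/

theorem mainTheorem6 :
    -- the group `H¹`, its centre and its Haar measures
    (∀ z : Heis, z ∈ Subgroup.center Heis ↔ z.q = 0 ∧ z.p = 0) ∧
    (∀ a : Heis, Heis.haar.map (fun g => a * g) = Heis.haar ∧
      Heis.haar.map (fun g => g * a) = Heis.haar) ∧
    (∀ f : Heis → ℂ, Continuous f → HasCompactSupport f →
      ∫ g, f g ∂Heis.haar =
        ∫ x, (∫ t : ℝ, f (Heis.sec x * ⟨t, 0, 0⟩)) ∂Heis.phaseMeasure) ∧
    -- explicit form of the Schrödinger representation and of the induced representation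
    (∀ (g : Heis) (φ : Lp ℂ 2 (volume : Measure ℝ)),
      ⇑(Heis.schrodinger g φ) =ᵐ[volume] fun x : ℝ =>
        Complex.exp (Complex.I * ((g.t + g.q * x + g.q * g.p / 2 : ℝ) : ℂ)) * φ (x + g.p)) ∧
    (∀ (g : Heis) (f : Lp ℂ 2 Heis.phaseMeasure),
      ⇑(Heis.inducedRep g f) =ᵐ[Heis.phaseMeasure] fun x : ℝ × ℝ =>
        Complex.exp (Complex.I * ((g.t + (x.1 * g.p - x.2 * g.q) / 2 : ℝ) : ℂ)) *
          f (x.1 - g.q, x.2 - g.p)) ∧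
    IsStronglyContinuous Heis.inducedRep ∧
    -- the representation `e^{i(t + qQ + pP)}` defined by number states is equivalent to it
    (∀ (H : Type u) [NormedAddCommGroup H] [InnerProductSpace ℂ H] [CompleteSpace H]
      (e : HilbertBasis ℕ ℂ H), ∃ ρ : Heis →* (H ≃ₗᵢ[ℂ] H),
        IsNumberRep e ρ ∧ UnitarilyEquivalent ρ Heis.schrodinger) ∧
    -- every realization `ρ` of the Schrödinger representation
    (∀ (H : Type u) [NormedAddCommGroup H] [InnerProductSpace ℂ H] [CompleteSpace H]
      (ρ : Heis →* (H ≃ₗᵢ[ℂ] H)), UnitarilyEquivalent ρ Heis.schrodinger →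
      -- is an irreducible representation with central character `e^{it}`
      IsStronglyContinuous ρ ∧ IsIrreducibleRep ρ ∧
      (∀ (t : ℝ) (v : H), ρ ⟨t, 0, 0⟩ v = Complex.exp (Complex.I * t) • v) ∧
      -- square integrable modulo the centre, with formal degree `1`
      Heis.SquareIntegrableModCentre ρ ∧ Heis.HasFormalDegree ρ 1 ∧
      -- the induced representation is isotypic and its space equals `M̃(ρ)`
      IsIsotypicRepOfType Heis.inducedRep ρ ∧ Heis.coeffSpace ρ = ⊤ ∧
      -- phase space observables and their minimal Neumark dilations
      (∀ u : H, Heis.IsCoeffOperator ρ u (Heis.coeffOperator ρ u)) ∧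
      (∀ T : H →L[ℂ] H, IsState T →
        (∀ E, MeasurableSet E →
          Heis.IsWeakOrbitIntegral ρ T E (Heis.phaseObservable ρ T E)) ∧
        IsPOM (Heis.phaseObservable ρ T)) ∧
      (∀ u : H, ‖u‖ = 1 →
        IsMinimalNeumarkDilation (Heis.phaseObservable ρ (InnerProductSpace.rankOne ℂ u u))
          (indicatorProj Heis.phaseMeasure) (Heis.coeffOperator ρ u)) ∧
      -- the Neumark projections of an orthonormal basis give a resolution of the identity
      (∀ e : HilbertBasis ℕ ℂ H,
        IsResolutionOfIdentity fun n => Heis.neumarkProjection ρ (e n)) ∧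
      -- informational completeness
      (∀ T : H →L[ℂ] H, IsState T →
        (∀ᵐ g ∂Heis.haar, opTrace (T ∘L Heis.repOp ρ g) ≠ 0) →
        IsInformationallyComplete (Heis.phaseObservable ρ T))) := by
  refine ⟨Heis.mem_center_iff, fun a => ⟨Heis.map_mul_left_haar a, Heis.map_mul_right_haar a⟩,
    Heis.integral_haar, Heis.schrodinger_coeFn, Heis.inducedRep_coeFn,
    Heis.isStronglyContinuous_inducedRep, fun H _ _ _ e => exists_isNumberRep e,
    fun H _ _ _ ρ h => ?_⟩
  have hρ := Heis.IsSchrodingerType.of_equivalent h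
  obtain ⟨V, -⟩ := h
  -- The Hermite basis pulled back by the equivalence supplies the countable basis that the
  -- completeness and mixture arguments need.
  let e : HilbertBasis ℕ ℂ H := HilbertBasis.ofRepr (V.trans hermiteBasis.repr)
  have : Nontrivial H := ⟨e 0, 0, e.orthonormal.ne_zero 0⟩
  refine ⟨hρ.continuous, hρ.isIrreducible, hρ.central, hρ.squareIntegrable, hρ.hasFormalDegree,
    hρ.isIsotypic e, hρ.coeffSpace_eq_top e, hρ.isCoeffOperator, fun T hT => ?_,
    fun u hu => hρ.isMinimalNeumarkDilation e hu, fun e => hρ.isResolutionOfIdentity e,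
    fun T hT hne => hρ.isInformationallyComplete e hT hne⟩
  obtain ⟨s, hs⟩ := hT.exists_isMixture e
  exact ⟨fun E hE => hρ.isWeakOrbitIntegral hs hE, hρ.isPOM_phaseObservable hT.1 hs⟩
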